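/- Let $\mathfrak X$ and $U$ be separable Hilbert spaces over $\mathbb K\in\{\mathbb R,\mathbb C\}$, let $T>0$, let $B\in L(U,\mathfrak X)$, and let $A$ be the generator of a strongly continuous semigroup $\mathfrak U(t)$, $t\ge 0$, on $\mathfrak X$ such that $\mathfrak U(t)$ is compact for every $t>0$. Let $f,g:[0,T]\times\mathfrak X\to\mathfrak X$ be continuous and assume: (F) $f$ has a Fréchet derivative $f'_z(t,z)\in L(\mathfrak X)$ with respect to $z$, continuous in $(t,z)\in[0,T]\times\mathfrak X$ for the operator norm, and $\|f'_z(t,z)\|\le L$ for some constant $L$ and all $(t,z)$; (G) there is a continuous $m:[0,T]\to[0,\infty)$ with $\|g(t,z)\|\le m(t)$ for all $(t,z)$; (AC) for every $G\in L^2(0,T;L(\mathfrak X))$ the system $y(t)=\mathfrak U(t)y_0+\int_0^t\mathfrak U(t-s)[Bu(s)+G(s)y(s)]\,ds$, $t\in[0,T]$, is approximately controllable: for all $y_0,y_f\in\mathfrak X$ and $\delta>0$ there is $u\in L^2(0,T;U)$ whose solution $y\in C([0,T],\mathfrak X)$ satisfies $\|y(T)-y_f\|<\delta$. Put $F(t,z)=\int_0^1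 f'_z(t,rz)\,dr\in L(\mathfrak X)$. For $z\in C([0,T],\mathfrak X)$ let $\mathfrak T(t,s)=\mathfrak T(t,s;F(z))$, $0\le s\le t\le T$, be the evolution operator generated by $A+F(\cdot,z(\cdot))$, i.e. the strongly continuous $L(\mathfrak X)$-valued solution of $$\mathfrak T(t,s)x=\mathfrak U(t-s)x+\int_s^t\mathfrak U(t-r)F(r,z(r))\mathfrak T(r,s)x\,dr ,\qquad x\in\mathfrak X,$$ and let $\Gamma_0^T(F(z))x=\int_0^T\mathfrak T(T,s)BB^*\mathfrak T(T,s)^*x\,ds$. Let $M\subset\mathfrak X$ be a finite-dimensional subspace with orthogonal projection $\pi_M$, let $x_0,h\in\mathfrak X$ and $\varepsilon>0$, and define $$u_\varepsilon(t,z)=B^*\mathfrak T(T,t)^*\bigl(\varepsilon(I-\pi_M)+\Gamma_0^T(F(z))\bigr)^{-1}\Bigl(h-\mathfrak T(T,0)x_0-\int_0^T\mathfrak T(T,s)g(s,z(s))\,ds\Bigr),$$ $$(\Theta_\varepsilon z)(t)=\mathfrak T(t,0)x_0+\int_0^t\mathfrak T(t,s)\bigl[Bu_\varepsilon(s,z)+g(s,z(s))\bigr]ds,\qquad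 t\in[0,T].$$ Then for every $z\in C([0,T],\mathfrak X)$ the evolution operator $\mathfrak T(\cdot,\cdot;F(z))$ exists and $\varepsilon(I-\pi_M)+\Gamma_0^T(F(z))$ is boundedly invertible, $\Theta_\varepsilon$ maps $C([0,T],\mathfrak X)$ into itself, and $\Theta_\varepsilon$ has at least one fixed point in $C([0,T],\mathfrak X)$. -/

import Mathlib

open Set Filter Topology MeasureTheory

noncomputable section

namespace EvolutionControl

/-- A strongly continuous (`C₀`) semigroup of bounded linear operators on `X`. Only the values at
times `t ≥ 0` are meaningful. -/
structure C0Semigroup (𝕜 X : Type*) [RCLike 𝕜] [NormedAddCommGroup X] [NormedSpace 𝕜 X] where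
  op : ℝ → X →L[𝕜] X
  op_zero : op 0 = ContinuousLinearMap.id 𝕜 X
  op_add : ∀ s t : ℝ, 0 ≤ s → 0 ≤ t → op (s + t) = (op s).comp (op t)
  continuousOn_op : ∀ x : X, ContinuousOn (fun t => op t x) (Ici 0)

variable {𝕜 X W : Type*} [RCLike 𝕜]
  [NormedAddCommGroup X] [InnerProductSpace 𝕜 X] [NormedSpace ℝ X] [IsScalarTower ℝ 𝕜 X]
  [CompleteSpace X]
  [NormedAddCommGroup W] [InnerProductSpace 𝕜 W] [CompleteSpace W]

/-- The (unbounded) operator `A` is the infinitesimal generator of the semigroup: `x ∈ D(A)` and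
`A x = y` if and only if `(S(t) x - x) / t → y` as `t → 0⁺`. -/
def C0Semigroup.IsGenerator (S : C0Semigroup 𝕜 X) (A : X →ₗ.[𝕜] X) : Prop :=
  ∀ x y : X, (x, y) ∈ A.graph ↔
    Tendsto (fun t : ℝ => t⁻¹ • (S.op t x - x)) (𝓝[>] 0) (𝓝 y)

/-- The semigroup is compact: `S(t)` is a compact operator for every `t > 0`. -/
def C0Semigroup.IsCompactSemigroup (S : C0Semigroup 𝕜 X) : Prop :=
  ∀ t : ℝ, 0 < t → IsCompactOperator (S.op t)

/-- `y` is a mild solution on `[0,T]` of `y' = A y + B u + G y`, `y(0) = y₀`. -/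
def IsLinearMildSolution (S : C0Semigroup 𝕜 X) (B : W →L[𝕜] X) (T : ℝ) (G : ℝ → X →L[𝕜] X)
    (y₀ : X) (u : ℝ → W) (y : ℝ → X) : Prop :=
  ContinuousOn y (Icc 0 T) ∧
    ∀ t ∈ Icc (0 : ℝ) T,
      y t = S.op t y₀ + ∫ s in (0 : ℝ)..t, S.op (t - s) (B (u s) + G s (y s))

/-- Approximate controllability on `[0,T]` of `y' = A y + B u + G y`, with controls in
`L²(0,T;W)`. -/
def IsApproxControllable (S : C0Semigroup 𝕜 X) (B : W →L[𝕜] X) (T : ℝ)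
    (G : ℝ → X →L[𝕜] X) : Prop :=
  ∀ y₀ yf : X, ∀ δ : ℝ, 0 < δ →
    ∃ u : ℝ → W, MemLp u 2 (volume.restrict (Icc 0 T)) ∧
      ∃ y : ℝ → X, IsLinearMildSolution S B T G y₀ u y ∧ ‖y T - yf‖ < δ

/-- `E` is the evolution operator generated by `A + G(·)` on `0 ≤ s ≤ t ≤ T`: it is strongly
continuous there and solves the variation of constants equation. -/
structure IsEvolutionOperator (S : C0Semigroup 𝕜 X) (T : ℝ) (G : ℝ → X →L[𝕜] X)
    (E : ℝ → ℝ → X →L[𝕜] X) : Prop where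
  continuousOn : ∀ x : X,
    ContinuousOn (fun p : ℝ × ℝ => E p.1 p.2 x) {p | 0 ≤ p.2 ∧ p.2 ≤ p.1 ∧ p.1 ≤ T}
  eq_integral : ∀ (x : X) (s t : ℝ), 0 ≤ s → s ≤ t → t ≤ T →
    E t s x = S.op (t - s) x + ∫ r in s..t, S.op (t - r) (G r (E r s x))

/-- The evolution operator `𝔗(t,s;G)` generated by `A + G(·)`. Its values for `0 ≤ s ≤ t ≤ T` are
determined by `IsEvolutionOperator`; no other value is ever used. -/
def evolutionOperator (S : C0Semigroup 𝕜 X) (T : ℝ) (G : ℝ → X →L[𝕜] X) :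
    ℝ → ℝ → X →L[𝕜] X :=
  Classical.epsilon (IsEvolutionOperator S T G)

/-- The controllability Gramian `Γ₀ᵀ(G) x = ∫₀ᵀ 𝔗(T,s;G) B B* 𝔗(T,s;G)* x ds`. -/
def gramian (S : C0Semigroup 𝕜 X) (B : W →L[𝕜] X) (T : ℝ) (G : ℝ → X →L[𝕜] X) (x : X) : X :=
  ∫ s in (0 : ℝ)..T,
    evolutionOperator S T G T s
      (B (ContinuousLinearMap.adjoint B
        (ContinuousLinearMap.adjoint (evolutionOperator S T G T s) x)))

/-- The map `ε (I - π_M) + Γ₀ᵀ(G)`, where `π_M` is the orthogonal projection onto `M`. -/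
def regularizedGramian (S : C0Semigroup 𝕜 X) (B : W →L[𝕜] X) (T : ℝ) (M : Submodule 𝕜 X)
    [M.HasOrthogonalProjection] (ε : ℝ) (G : ℝ → X →L[𝕜] X) (x : X) : X :=
  ε • (x - M.starProjection x) + gramian S B T G x

/-- `F(t,z) = ∫₀¹ f'_z(t, r z) dr`, an operator on `X`. -/
def meanDerivative (f : ℝ → X → X) (t : ℝ) (z : X) : X →L[𝕜] X :=
  ∫ r in (0 : ℝ)..1, fderiv 𝕜 (f t) (r • z)

/-- The operator family `F(z) : t ↦ F(t, z(t))`. -/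
def linearization (f : ℝ → X → X) (z : ℝ → X) (t : ℝ) : X →L[𝕜] X :=
  meanDerivative f t (z t)

/-- The feedback control
`u_ε(t,z) = B* 𝔗(T,t;F(z))* (ε (I - π_M) + Γ₀ᵀ(F(z)))⁻¹
  (h - 𝔗(T,0;F(z)) x₀ - ∫₀ᵀ 𝔗(T,s;F(z)) g(s,z(s)) ds)`. -/
def feedbackControl (S : C0Semigroup 𝕜 X) (B : W →L[𝕜] X) (T : ℝ) (f g : ℝ → X → X)
    (M : Submodule 𝕜 X) [M.HasOrthogonalProjection] (x₀ h : X) (ε : ℝ) (z : ℝ → X) (t : ℝ) : W :=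
  ContinuousLinearMap.adjoint B
    (ContinuousLinearMap.adjoint (evolutionOperator S T (linearization f z) T t)
      (Function.invFun (regularizedGramian S B T M ε (linearization f z))
        (h - evolutionOperator S T (linearization f z) T 0 x₀
          - ∫ s in (0 : ℝ)..T, evolutionOperator S T (linearization f z) T s (g s (z s)))))

/-- `(Θ_ε z)(t) = 𝔗(t,0;F(z)) x₀ + ∫₀ᵗ 𝔗(t,s;F(z)) (B u_ε(s,z) + g(s,z(s))) ds`. -/
def thetaFun (S : C0Semigroup 𝕜 X) (B : W →L[𝕜] X) (T : ℝ) (f g : ℝ → X → X)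
    (M : Submodule 𝕜 X) [M.HasOrthogonalProjection] (x₀ h : X) (ε : ℝ) (z : ℝ → X) (t : ℝ) : X :=
  evolutionOperator S T (linearization f z) t 0 x₀
    + ∫ s in (0 : ℝ)..t, evolutionOperator S T (linearization f z) t s
        (B (feedbackControl S B T f g M x₀ h ε z s) + g s (z s))

end EvolutionControl

end

/-!
`Θ_ε` is a continuous self-map of a ball of `C([0, T], X)` with relatively compact range, because
the semigroup is compact and the controls are uniformly bounded; Schauder's theorem then gives the
fixed point.

The uniform bound on the controls amounts to uniform coercivity of `ε (I - π_M) + Γ₀ᵀ(G)` over all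
continuous `G` with `‖G‖ ≤ L`, and is proved by contradiction. The quadratic form of the operator at
`x` is `ε ‖x - π_M x‖² + ∫₀ᵀ ‖B* 𝔗(T, s; G)* x‖² ds`. If it tends to zero along unit vectors `xₙ`
and operators `Gₙ`, then `xₙ` converges along a subsequence to a unit vector of `M`, the
trajectories `𝔗(T, s; Gₙ)* xₙ` converge uniformly, and their forcing terms converge weakly in `L²`.
The limit trajectory is annihilated by `B*` and its forcing term is pointwise at most `L` times its
norm, so rank-one operators exhibit it as an adjoint trajectory of some measurable `G` with
`‖G‖ ≤ L`. Its endpoint is then orthogonal to every state reachable from `0`, which approximate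
controllability excludes.
-/

noncomputable section

namespace EvolutionControl

section Brouwer

open Metric Polynomial

lemma exists_polynomial_eval_eq_det_one_add_smul {R M : Type*} [CommRing R] [Nontrivial R]
    [AddCommGroup M] [Module R M] [Module.Free R M] [Module.Finite R M] (A : M →ₗ[R] M) :
    ∃ p : R[X], p.natDegree ≤ Module.finrank R M ∧
      ∀ t : R, p.eval t = LinearMap.det (1 + t • A) := by
  classical
  let b := Module.finBasis R M
  let N := LinearMap.toMatrix b b A
  refine ⟨((X : R[X]) • N.map C + (1 : Matrix _ _ R).map C).det, ?_, fun t => ?_⟩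
  · simpa using natDegree_det_X_add_C_le N 1
  · rw [← LinearMap.det_toMatrix b, ← coe_evalRingHom, RingHom.map_det]
    congr 1
    ext i j
    simp only [map_add, map_smul, LinearMap.toMatrix_one, RingHom.mapMatrix_apply,
      Matrix.map_apply, Matrix.add_apply, Matrix.smul_apply, smul_eq_mul, map_mul, N]
    simp [add_comm]

lemma integral_polynomial_eval_eq_of_infinite {α : Type*} [MeasurableSpace α] {μ : Measure α}
    {P : α → ℝ[X]} {n : ℕ} (hdeg : ∀ x, (P x).natDegree ≤ n) {s : Set ℝ} (hs : s.Infinite) {V : ℝ}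
    (hint : ∀ t ∈ s, Integrable (fun x => (P x).eval t) μ)
    (hV : ∀ t ∈ s, ∫ x, (P x).eval t ∂μ = V) (a : ℝ) :
    ∫ x, (P x).eval a ∂μ = V := by
  obtain ⟨t, hts, htcard⟩ := hs.exists_subset_card_eq (n + 1)
  have hinterp (p : ℝ[X]) (hp : p.natDegree ≤ n) :
      p.eval a = ∑ i ∈ t, p.eval i * (Lagrange.basis t id i).eval a := by
    have hlt : p.degree < t.card :=
      degree_le_natDegree.trans_lt (by rw [htcard]; exact_mod_cast Nat.lt_succ_of_le hp)
    conv_lhs => rw [Lagrange.eq_interpolate (v := id) Function.injective_id.injOn hlt]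
    simp [Lagrange.interpolate_apply, eval_finsetSum]
  have hsum : ∑ i ∈ t, (Lagrange.basis t id i).eval a = 1 := by
    simpa using (hinterp 1 (by simp)).symm
  calc ∫ x, (P x).eval a ∂μ
      = ∫ x, ∑ i ∈ t, (P x).eval i * (Lagrange.basis t id i).eval a ∂μ := by
        simp_rw [hinterp _ (hdeg _)]
    _ = ∑ i ∈ t, V * (Lagrange.basis t id i).eval a := by
        rw [integral_finsetSum _ fun i hi => (hint i (hts hi)).mul_const _]
        exact Finset.sum_congr rfl fun i hi => by rw [integral_mul_const, hV i (hts hi)]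
    _ = V := by rw [← Finset.mul_sum, hsum, mul_one]

variable {E : Type*} [NormedAddCommGroup E]

lemma approximatesLinearOn_add_smul [NormedSpace ℝ E] {g : E → E} {s : Set E} {K : NNReal}
    (hg : LipschitzOnWith K g s) (t : ℝ) :
    ApproximatesLinearOn (fun x => x + t • g x) (ContinuousLinearEquiv.refl ℝ E : E →L[ℝ] E) s
      (‖t‖₊ * K) := by
  refine ApproximatesLinearOn.approximatesLinearOn_iff_lipschitzOnWith.2 ?_
  convert! (lipschitzWith_smul t).comp_lipschitzOnWith hg using 1
  ext x
  simp

lemma injOn_and_isOpen_image_add_smul [NormedSpace ℝ E] [CompleteSpace E] {g : E → E} {s : Set E}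
    {K : NNReal} (hg : LipschitzOnWith K g s) {t : ℝ} (htK : ‖t‖₊ * K < 1) (hs : IsOpen s) :
    InjOn (fun x => x + t • g x) s ∧ IsOpen ((fun x => x + t • g x) '' s) := by
  have happrox := approximatesLinearOn_add_smul hg t
  have hsmall : Subsingleton E ∨
      ‖t‖₊ * K < ‖((ContinuousLinearEquiv.refl ℝ E).symm : E →L[ℝ] E)‖₊⁻¹ := by
    rcases subsingleton_or_nontrivial E with h | h
    · exact .inl h
    · right
      simpa using htK
  exact ⟨happrox.injOn hsmall,
    happrox.open_image (ContinuousLinearEquiv.refl ℝ E).toNonlinearRightInverse hs hsmall⟩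

lemma image_add_smul_sub_ball [NormedSpace ℝ E] [FiniteDimensional ℝ E] {r : E → E} {K : NNReal}
    (hlip : LipschitzOnWith K (fun x => r x - x) (closedBall 0 1))
    (hmaps : MapsTo r (closedBall 0 1) (closedBall 0 1)) (hid : EqOn r id (sphere 0 1))
    {t : ℝ} (ht0 : 0 < t) (ht1 : t < 1) (htK : ‖t‖₊ * K < 1) :
    (fun x => x + t • (r x - x)) '' ball 0 1 = ball 0 1 := by
  set φ : E → E := fun x => x + t • (r x - x) with hφ
  have hφball : φ '' ball 0 1 ⊆ ball 0 1 := by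
    rintro _ ⟨x, hx, rfl⟩
    have hr : ‖r x‖ ≤ 1 := by simpa using hmaps (ball_subset_closedBall hx)
    rw [mem_ball_zero_iff] at hx ⊢
    calc ‖φ x‖ = ‖(1 - t) • x + t • r x‖ := by congr 1; simp only [hφ]; module
      _ ≤ (1 - t) * ‖x‖ + t * ‖r x‖ := by
        refine (norm_add_le _ _).trans_eq ?_
        rw [norm_smul, norm_smul, Real.norm_of_nonneg ht0.le, Real.norm_of_nonneg (by linarith)]
      _ < 1 := by nlinarith
  have hopen : IsOpen (φ '' ball 0 1) :=
    (injOn_and_isOpen_image_add_smul (hlip.mono ball_subset_closedBall) htK isOpen_ball).2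
  have hclosure : closure (φ '' ball 0 1) ⊆ φ '' closedBall 0 1 :=
    closure_minimal (image_mono ball_subset_closedBall)
      ((isCompact_closedBall 0 1).image_of_continuousOn
        (approximatesLinearOn_add_smul hlip t).continuousOn).isClosed
  refine hφball.antisymm ((convex_ball 0 1).isPreconnected.subset_of_closure_inter_subset hopen
    ⟨φ 0, hφball (mem_image_of_mem φ (by simp)), mem_image_of_mem φ (by simp)⟩ ?_)
  rintro y ⟨hy, hyball⟩
  obtain ⟨x, hx, rfl⟩ := hclosure hy
  rcases (mem_closedBall_zero_iff.1 hx).lt_or_eq with h | h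
  · exact mem_image_of_mem φ (by simpa using h)
  · have hφx : φ x = x := by simp [hφ, hid (mem_sphere_zero_iff_norm.2 h)]
    rw [hφx] at hyball
    exact mem_image_of_mem φ hyball

lemma det_one_add_pos_of_norm_lt_one [NormedSpace ℝ E] [FiniteDimensional ℝ E] {A : E →L[ℝ] E}
    (hA : ‖A‖ < 1) : 0 < (1 + A).det := by
  have hne (s : ℝ) (hs : s ∈ Icc (0 : ℝ) 1) : (1 + s • A).det ≠ 0 := by
    have hunit : IsUnit (1 + s • A) := by
      have hnorm : ‖-(s • A)‖ < 1 := by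
        rw [norm_neg, norm_smul, Real.norm_of_nonneg hs.1]
        exact (mul_le_of_le_one_left (norm_nonneg A) hs.2).trans_lt hA
      simpa using isUnit_one_sub_of_norm_lt_one hnorm
    exact ((hunit.map ContinuousLinearMap.toLinearMapRingHom).map LinearMap.det).ne_zero
  have hcont : ContinuousOn (fun s : ℝ => (1 + s • A).det) (Icc 0 1) :=
    (ContinuousLinearMap.continuous_det.comp (by fun_prop)).continuousOn
  by_contra! hneg
  obtain ⟨s, hs, hs0⟩ := intermediate_value_Icc' zero_le_one hcont
    (show (0 : ℝ) ∈ Icc _ _ by simpa [ContinuousLinearMap.det] using hneg)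
  exact hne s hs hs0

variable [InnerProductSpace ℝ E]

/-- The point where the ray from `x` in the direction `u` leaves the closed unit ball. -/
def sphereExit (x u : E) : E :=
  x + ((-inner ℝ x u + √(inner ℝ x u ^ 2 + ‖u‖ ^ 2 * (1 - ‖x‖ ^ 2))) / ‖u‖ ^ 2) • u

lemma norm_sphereExit {x u : E} (hx : ‖x‖ ≤ 1) (hu : u ≠ 0) : ‖sphereExit x u‖ = 1 := by
  have hu2 : 0 < ‖u‖ ^ 2 := by positivity
  set b : ℝ := inner ℝ x u
  set d : ℝ := b ^ 2 + ‖u‖ ^ 2 * (1 - ‖x‖ ^ 2) with hd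
  have hsqrt : √d ^ 2 = d := Real.sq_sqrt <|
    add_nonneg (sq_nonneg b) (mul_nonneg hu2.le (by nlinarith [norm_nonneg x]))
  have hsq : ‖sphereExit x u‖ ^ 2 = 1 := by
    rw [sphereExit, norm_add_sq_real, norm_smul, inner_smul_right, mul_pow, Real.norm_eq_abs,
      sq_abs]
    change ‖x‖ ^ 2 + 2 * ((-b + √d) / ‖u‖ ^ 2 * b) + ((-b + √d) / ‖u‖ ^ 2) ^ 2 * ‖u‖ ^ 2 = 1
    field_simp
    linear_combination hsqrt + hd
  exact (pow_eq_one_iff_of_nonneg (norm_nonneg _) two_ne_zero).1 hsq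

lemma sphereExit_eq_self {x u : E} (hx : ‖x‖ = 1) (hxu : 0 ≤ inner ℝ x u) :
    sphereExit x u = x := by
  simp [sphereExit, hx, Real.sqrt_sq hxu]

lemma contDiffAt_sphereExit {u : E → E} {x : E} (hu : ContDiffAt ℝ 1 u x) (hux : u x ≠ 0)
    (hx : ‖x‖ < 1 ∨ inner ℝ x (u x) ≠ 0) (hx1 : ‖x‖ ≤ 1) :
    ContDiffAt ℝ 1 (fun y => sphereExit y (u y)) x := by
  have hinner : ContDiffAt ℝ 1 (fun y => inner ℝ y (u y)) x := contDiffAt_id.inner ℝ hu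
  have hnorm : ContDiffAt ℝ 1 (fun y => ‖u y‖ ^ 2) x := hu.norm_sq ℝ
  have hdisc : inner ℝ x (u x) ^ 2 + ‖u x‖ ^ 2 * (1 - ‖x‖ ^ 2) ≠ 0 := by
    have hnonneg : 0 ≤ 1 - ‖x‖ ^ 2 := by nlinarith [norm_nonneg x]
    rcases hx with hx | hx
    · have hpos : 0 < 1 - ‖x‖ ^ 2 := by nlinarith [norm_nonneg x]
      positivity
    · positivity
  exact contDiffAt_id.add (((hinner.neg.add (((hinner.pow 2).add (hnorm.mul
    (contDiffAt_const.sub (contDiffAt_id.norm_sq ℝ)))).sqrt hdisc)).div hnorm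
    (by positivity)).smul hu)

variable [FiniteDimensional ℝ E]

lemma det_fderiv_eq_zero_of_norm_eq_one {r : E → E} {x : E} (hr : DifferentiableAt ℝ r x)
    (hnorm : ∀ᶠ y in 𝓝 x, ‖r y‖ = 1) : (fderiv ℝ r x).det = 0 := by
  have horth (w : E) : inner ℝ (r x) (fderiv ℝ r x w) = 0 := by
    have hconst : (fun y => inner ℝ (r y) (r y)) =ᶠ[𝓝 x] fun _ => (1 : ℝ) :=
      hnorm.mono fun y hy => by simp [hy]
    have hderiv := fderiv_inner_apply ℝ hr hr w
    rw [hconst.fderiv_eq, fderiv_fun_const, real_inner_comm (r x)] at hderiv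
    simpa using hderiv.symm
  by_contra hdet
  obtain ⟨w, hw : fderiv ℝ r x w = r x⟩ := ((Module.End.isUnit_iff _).1
    ((LinearMap.isUnit_iff_isUnit_det _).2 (isUnit_iff_ne_zero.2 hdet))).2 (r x)
  have hself : inner ℝ (r x) (r x) = 0 := by simpa only [hw] using horth w
  rw [real_inner_self_eq_norm_sq, hnorm.self_of_nhds] at hself
  norm_num at hself

/- For small `t > 0` the map `x ↦ x + t (r x - x)` is a diffeomorphism of the ball, so the integral
of its Jacobian is the volume of the ball. -/
lemma integral_det_one_add_smul_fderiv [MeasurableSpace E] [BorelSpace E] {r : E → E} {K : NNReal}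
    (hr : DifferentiableOn ℝ r (ball 0 1))
    (hlip : LipschitzOnWith K (fun x => r x - x) (closedBall 0 1))
    (hmaps : MapsTo r (closedBall 0 1) (closedBall 0 1)) (hid : EqOn r id (sphere 0 1))
    {t : ℝ} (ht0 : 0 < t) (ht1 : t < 1) (htK : t * K < 1) :
    IntegrableOn (fun x => (1 + t • fderiv ℝ (fun x => r x - x) x).det) (ball 0 1) ∧
      ∫ x in ball 0 1, (1 + t • fderiv ℝ (fun x => r x - x) x).det =
        volume.real (ball (0 : E) 1) := by
  have htK' : ‖t‖₊ * K < 1 := by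
    rw [← NNReal.coe_lt_coe]; simpa [abs_of_pos ht0] using htK
  have hφ' : ∀ x ∈ ball (0 : E) 1, HasFDerivWithinAt (fun x => x + t • (r x - x))
      (1 + t • fderiv ℝ (fun x => r x - x) x) (ball 0 1) x := fun x hx =>
    ((hasFDerivAt_id x).add ((((hr x hx).differentiableAt (isOpen_ball.mem_nhds hx)).sub
      differentiableAt_id).hasFDerivAt.const_smul t)).hasFDerivWithinAt
  have hdet : ∀ x ∈ ball (0 : E) 1, |(1 + t • fderiv ℝ (fun x => r x - x) x).det| =
      (1 + t • fderiv ℝ (fun x => r x - x) x).det := fun x hx => by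
    refine abs_of_pos (det_one_add_pos_of_norm_lt_one ?_)
    rw [norm_smul, Real.norm_of_nonneg ht0.le]
    exact (mul_le_mul_of_nonneg_left (norm_fderiv_le_of_lipschitzOn ℝ
      (closedBall_mem_nhds_of_mem hx) hlip) ht0.le).trans_lt htK
  have hinj := (injOn_and_isOpen_image_add_smul (hlip.mono ball_subset_closedBall) htK'
    isOpen_ball).1
  have himage := image_add_smul_sub_ball hlip hmaps hid ht0 ht1 htK'
  constructor
  · refine IntegrableOn.congr_fun ?_ hdet measurableSet_ball
    have := integrableOn_image_iff_integrableOn_abs_det_fderiv_smul volume measurableSet_ball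
      hφ' hinj (fun _ => (1 : ℝ))
    simpa [himage, measure_ball_lt_top] using this
  · have := integral_image_eq_integral_abs_det_fderiv_smul volume measurableSet_ball
      hφ' hinj (fun _ => (1 : ℝ))
    rw [← setIntegral_congr_fun measurableSet_ball hdet]
    simpa [himage] using this.symm

theorem not_contDiffOn_retraction {r : E → E} (hr : ContDiffOn ℝ 1 r (closedBall 0 1))
    (hid : EqOn r id (sphere 0 1)) : ¬ MapsTo r (closedBall 0 1) (sphere 0 1) := by
  intro hmaps
  borelize E
  obtain ⟨K, hK⟩ := (hr.sub contDiffOn_id).exists_lipschitzOnWith one_ne_zero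
    (convex_closedBall 0 1) (isCompact_closedBall 0 1)
  have hdiff : DifferentiableOn ℝ r (ball 0 1) :=
    (hr.differentiableOn one_ne_zero).mono ball_subset_closedBall
  choose P hPdeg hPeval using fun x =>
    exists_polynomial_eval_eq_det_one_add_smul (fderiv ℝ (fun x => r x - x) x : E →ₗ[ℝ] E)
  have hsmall (t : ℝ) (ht : t ∈ Ioo 0 (1 / (K + 1) : ℝ)) :=
    integral_det_one_add_smul_fderiv hdiff hK (hmaps.mono_right sphere_subset_closedBall) hid ht.1
      (ht.2.trans_le (by rw [div_le_one (by positivity)]; simp))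
      (by have := (lt_div_iff₀ (by positivity : (0 : ℝ) < K + 1)).1 ht.2; linarith [ht.1])
  have hvolume : ∫ x in ball 0 1, (P x).eval 1 = volume.real (ball (0 : E) 1) := by
    refine integral_polynomial_eval_eq_of_infinite hPdeg
      (Ioo_infinite (by positivity : (0 : ℝ) < 1 / (K + 1)))
      (fun t ht => ?_) (fun t ht => ?_) 1
    · exact (hsmall t ht).1.congr_fun (fun x _ => (hPeval x t).symm) measurableSet_ball
    · exact Eq.trans (by simp_rw [hPeval]; rfl) (hsmall t ht).2
  have hzero : ∀ x ∈ ball (0 : E) 1, (P x).eval 1 = 0 := fun x hx => by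
    have hrx := (hdiff x hx).differentiableAt (isOpen_ball.mem_nhds hx)
    have hderiv : (1 : E →ₗ[ℝ] E) + (1 : ℝ) • (fderiv ℝ (fun x => r x - x) x : E →ₗ[ℝ] E) =
        fderiv ℝ r x := by
      rw [fderiv_fun_sub hrx differentiableAt_fun_id, fderiv_fun_id]
      ext; simp
    rw [hPeval, hderiv]
    exact det_fderiv_eq_zero_of_norm_eq_one hrx <| (isOpen_ball.mem_nhds hx |>
      Filter.eventually_of_mem) fun y hy => by simpa using hmaps (ball_subset_closedBall hy)
  rw [setIntegral_congr_fun measurableSet_ball hzero, integral_zero] at hvolume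
  exact (ENNReal.toReal_pos (measure_ball_pos volume 0 one_pos).ne'
    measure_ball_lt_top.ne).ne hvolume

lemma exists_fixedPoint_of_contDiff_of_norm_lt_one {p : E → E} (hp : ContDiff ℝ 1 p)
    (hp1 : ∀ x, ‖p x‖ < 1) : ∃ x ∈ closedBall 0 1, p x = x := by
  by_contra! hne
  have hne' : ∀ x ∈ closedBall (0 : E) 1, x - p x ≠ 0 := fun x hx =>
    sub_ne_zero.2 (hne x hx).symm
  have hinner (x : E) (hx : ‖x‖ = 1) : 0 < inner ℝ x (x - p x) := by
    have := real_inner_le_norm x (p x)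
    rw [inner_sub_right, real_inner_self_eq_norm_sq, hx]
    rw [hx] at this
    linarith [hp1 x]
  refine not_contDiffOn_retraction (r := fun x => sphereExit x (x - p x)) (fun x hx => ?_)
    (fun x hx => ?_) (fun x hx => ?_)
  · have hx1 := mem_closedBall_zero_iff.1 hx
    exact (contDiffAt_sphereExit (contDiffAt_id.sub hp.contDiffAt) (hne' x hx)
      (hx1.lt_or_eq.imp_right fun h => (hinner x h).ne') hx1).contDiffWithinAt
  · have hx1 := mem_sphere_zero_iff_norm.1 hx
    exact sphereExit_eq_self hx1 (hinner x hx1).le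
  · exact mem_sphere_zero_iff_norm.2 (norm_sphereExit (mem_closedBall_zero_iff.1 hx) (hne' x hx))

theorem brouwer_exists_fixedPoint {f : E → E} (hf : Continuous f)
    (hf1 : ∀ x, ‖f x‖ ≤ 1) : ∃ x, f x = x := by
  by_contra! hne
  obtain ⟨x₀, -, hx₀⟩ := (isCompact_closedBall (0 : E) 1).exists_isMinOn ⟨0, by simp⟩
    (hf.sub continuous_id).norm.continuousOn
  set δ := ‖f x₀ - x₀‖
  have hδ0 : 0 < δ := norm_pos_iff.2 (sub_ne_zero.2 (hne x₀))
  obtain ⟨q, hq, hqf, -⟩ := hf.exists_contDiff_approx (ε := fun _ => δ / 4) 1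
    continuous_const (fun _ => by positivity)
  have hk : 0 < 1 + δ / 3 := by positivity
  have hp1 (x : E) : ‖(1 + δ / 3)⁻¹ • q x‖ < 1 := by
    rw [norm_smul, Real.norm_of_nonneg (by positivity), inv_mul_lt_one₀ hk]
    have := norm_le_norm_add_norm_sub' (q x) (f x)
    have := hqf x
    rw [dist_eq_norm] at this
    linarith [hf1 x]
  obtain ⟨x, hx, hpx⟩ := exists_fixedPoint_of_contDiff_of_norm_lt_one
    (hq.const_smul (1 + δ / 3)⁻¹) hp1
  have hqx : q x - x = (δ / 3) • x := by
    rw [inv_smul_eq_iff₀ hk.ne'] at hpx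
    rw [hpx, add_smul, one_smul, add_sub_cancel_left]
  have hmin : δ ≤ ‖f x - x‖ := hx₀ hx
  have hlt : ‖f x - x‖ < δ := by
    have hfq := hqf x
    rw [dist_comm, dist_eq_norm] at hfq
    calc ‖f x - x‖ ≤ ‖f x - q x‖ + ‖q x - x‖ := norm_sub_le_norm_sub_add_norm_sub _ _ _
      _ < δ / 4 + δ / 3 * 1 := by
        rw [hqx, norm_smul, Real.norm_of_nonneg (by positivity)]
        exact add_lt_add_of_lt_of_le hfq (by gcongr; exact mem_closedBall_zero_iff.1 hx)
      _ < δ := by linarith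
  exact hlt.not_ge hmin

end Brouwer

section Schauder

lemma norm_le_one_of_mem_stdSimplex {ι : Type*} [Fintype ι] {l : EuclideanSpace ℝ ι}
    (hl : (l : ι → ℝ) ∈ stdSimplex ℝ ι) : ‖l‖ ≤ 1 := by
  have hle (i : ι) : l i ≤ 1 :=
    hl.2 ▸ Finset.single_le_sum (fun j _ => hl.1 j) (Finset.mem_univ i)
  rw [← sq_le_one_iff₀ (norm_nonneg _), EuclideanSpace.norm_sq_eq, ← hl.2]
  refine Finset.sum_le_sum fun i _ => ?_
  rw [Real.norm_of_nonneg (hl.1 i), sq]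
  exact mul_le_of_le_one_left (hl.1 i) (hle i)

lemma exists_fixedPoint_of_mem_stdSimplex {ι : Type*} [Fintype ι] {φ : (ι → ℝ) → ι → ℝ}
    (hφ : Continuous φ) (hmem : ∀ l, φ l ∈ stdSimplex ℝ ι) : ∃ l, φ l = l := by
  obtain ⟨l, hl⟩ := brouwer_exists_fixedPoint
    (f := fun l : EuclideanSpace ℝ ι => WithLp.toLp 2 (φ l.ofLp)) (by fun_prop)
    fun l => norm_le_one_of_mem_stdSimplex (hmem l.ofLp)
  exact ⟨l.ofLp, congrArg WithLp.ofLp hl⟩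

variable {E : Type*} [NormedAddCommGroup E]

lemma exists_continuous_weights_mem_stdSimplex {K : Set E} (hK : IsCompact K) {ε : ℝ} (hε : 0 < ε) :
    ∃ (t : Finset E) (w : E → t → ℝ), ContinuousOn w K ∧ (∀ x ∈ K, w x ∈ stdSimplex ℝ t) ∧
      ∀ x i, w x i ≠ 0 → ‖x - i‖ < ε := by
  obtain ⟨t, -, htfin, hcover⟩ := hK.finite_cover_balls hε
  lift t to Finset E using htfin
  set v : t → E → ℝ := fun i x => max 0 (ε - ‖x - i‖)
  have hv0 (i : t) (x : E) : 0 ≤ v i x := le_max_left _ _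
  have hpos : ∀ x ∈ K, 0 < ∑ i, v i x := fun x hx => by
    obtain ⟨i, hi, hxi⟩ := mem_iUnion₂.1 (hcover hx)
    refine Finset.sum_pos' (fun i _ => hv0 i x) ⟨⟨i, hi⟩, Finset.mem_univ _, ?_⟩
    exact lt_max_of_lt_right (sub_pos.2 (by simpa [dist_eq_norm] using hxi))
  refine ⟨t, fun x i => v i x / ∑ j, v j x, ?_, fun x hx => ⟨fun i => ?_, ?_⟩, fun x i hxi => ?_⟩
  · refine continuousOn_pi.2 fun i => ContinuousOn.div (by fun_prop) (by fun_prop) fun x hx => ?_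
    exact (hpos x hx).ne'
  · exact div_nonneg (hv0 i x) (hpos x hx).le
  · rw [← Finset.sum_div, div_self (hpos x hx).ne']
  · by_contra! hle
    exact hxi (by simp [v, hle])

variable [NormedSpace ℝ E] {f : E → E} {K : Set E}

lemma exists_norm_sub_lt_of_range_subset_isCompact (hf : Continuous f) (hK : IsCompact K)
    (hfK : ∀ x, f x ∈ K) {ε : ℝ} (hε : 0 < ε) : ∃ x, ‖f x - x‖ < ε := by
  obtain ⟨t, w, hw, hwmem, hwsupp⟩ := exists_continuous_weights_mem_stdSimplex hK hε
  set c : (t → ℝ) → E := fun l => ∑ i, l i • (i : E)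
  have hc : Continuous c := by fun_prop
  obtain ⟨l, hl⟩ := exists_fixedPoint_of_mem_stdSimplex
    (hw.comp_continuous (hf.comp hc) fun l => hfK (c l)) fun l => hwmem _ (hfK (c l))
  refine ⟨c l, ?_⟩
  have hlmem : l ∈ stdSimplex ℝ t := hl ▸ hwmem _ (hfK (c l))
  have hsum : ∑ i with l i ≠ 0, l i • (i : E) = c l :=
    Finset.sum_filter_of_ne fun i _ h => left_ne_zero_of_smul h
  have hcl : ∑ i with l i ≠ 0, l i • (i : E) ∈ Metric.ball (f (c l)) ε := by
    refine (convex_ball _ _).sum_mem (fun i _ => hlmem.1 i) ?_ fun i hi => ?_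
    · rw [Finset.sum_filter_ne_zero, hlmem.2]
    · rw [Metric.mem_ball, dist_comm, dist_eq_norm]
      exact hwsupp _ i ((congrFun hl i).trans_ne (Finset.mem_filter.1 hi).2)
  rwa [hsum, Metric.mem_ball, dist_comm, dist_eq_norm] at hcl

theorem schauder_exists_fixedPoint (hf : Continuous f) (hK : IsCompact K)
    (hfK : ∀ x, f x ∈ K) : ∃ x, f x = x := by
  choose x hx using fun n : ℕ => exists_norm_sub_lt_of_range_subset_isCompact hf hK hfK
    (ε := 1 / ((n : ℝ) + 1)) (by positivity)
  obtain ⟨y, -, φ, hφ, hy⟩ := hK.tendsto_subseq fun n => hfK (x n)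
  have hdiff : Tendsto (fun n => f (x (φ n)) - x (φ n)) atTop (𝓝 0) :=
    squeeze_zero_norm (fun n => (hx (φ n)).le)
      (tendsto_one_div_add_atTop_nhds_zero_nat.comp hφ.tendsto_atTop)
  have hxy : Tendsto (x ∘ φ) atTop (𝓝 y) := by
    simpa [Function.comp_def] using Tendsto.sub hy hdiff
  exact ⟨y, tendsto_nhds_unique ((hf.tendsto y).comp hxy) hy⟩

end Schauder

section StrongConvergence

variable {𝕜 α X Y : Type*} [NontriviallyNormedField 𝕜] [NormedAddCommGroup X] [NormedSpace 𝕜 X]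
  [NormedAddCommGroup Y] [NormedSpace 𝕜 Y] {l : Filter α} {A : α → X →L[𝕜] Y} {C : ℝ}

lemma tendsto_clm_apply_of_norm_le (hA : ∀ᶠ a in l, ‖A a‖ ≤ C) {x : α → X} {x₀ : X} {y : Y}
    (hAx₀ : Tendsto (fun a => A a x₀) l (𝓝 y)) (hx : Tendsto x l (𝓝 x₀)) :
    Tendsto (fun a => A a (x a)) l (𝓝 y) := by
  have hdiff : Tendsto (fun a => A a (x a - x₀)) l (𝓝 0) := by
    refine squeeze_zero_norm' (hA.mono fun a ha => (A a).le_of_opNorm_le ha _) ?_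
    simpa using ((hx.sub_const x₀).norm.const_mul C)
  simpa using hdiff.add hAx₀

lemma tendsto_clm_apply_of_dense (hA : ∀ᶠ a in l, ‖A a‖ ≤ C) {A₀ : X →L[𝕜] Y} {D : Set X}
    (hD : Dense D) (hAD : ∀ x ∈ D, Tendsto (fun a => A a x) l (𝓝 (A₀ x))) (x : X) :
    Tendsto (fun a => A a x) l (𝓝 (A₀ x)) := by
  rcases l.eq_or_neBot with rfl | hl
  · simp
  have hC : 0 ≤ C := (hA.exists.choose_spec).trans' (norm_nonneg _)
  rw [Metric.tendsto_nhds]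
  intro ε hε
  obtain ⟨y, hy, hxy⟩ := hD.exists_dist_lt x (ε := ε / (2 * (C + ‖A₀‖ + 1))) (by positivity)
  filter_upwards [hA, Metric.tendsto_nhds.1 (hAD y hy) (ε / 2) (by positivity)] with a ha hay
  rw [dist_eq_norm] at *
  calc ‖A a x - A₀ x‖ = ‖A a (x - y) + (A a y - A₀ y) - A₀ (x - y)‖ := by
        rw [map_sub, map_sub]; abel_nf
    _ ≤ C * ‖x - y‖ + ‖A a y - A₀ y‖ + ‖A₀‖ * ‖x - y‖ :=
        (norm_sub_le _ _).trans (add_le_add ((norm_add_le _ _).trans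
          (add_le_add_left ((A a).le_of_opNorm_le ha _) _)) (A₀.le_opNorm _))
    _ ≤ (C + ‖A₀‖ + 1) * ‖x - y‖ + ‖A a y - A₀ y‖ := by linarith [norm_nonneg (x - y)]
    _ < (C + ‖A₀‖ + 1) * (ε / (2 * (C + ‖A₀‖ + 1))) + ε / 2 := by gcongr
    _ = ε := by field_simp; ring

end StrongConvergence

section Semigroup

variable {𝕜 X : Type*} [RCLike 𝕜] [NormedAddCommGroup X] [NormedSpace 𝕜 X]

/-- The semigroup extended to negative times by the identity, which makes it total in `t` and
strongly continuous on the whole line. -/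
def C0Semigroup.extend (S : C0Semigroup 𝕜 X) (t : ℝ) : X →L[𝕜] X := S.op (max t 0)

namespace C0Semigroup

variable (S : C0Semigroup 𝕜 X)

lemma extend_of_nonneg {t : ℝ} (ht : 0 ≤ t) : S.extend t = S.op t := by
  rw [extend, max_eq_left ht]

@[simp] lemma extend_zero : S.extend 0 = ContinuousLinearMap.id 𝕜 X := by
  rw [S.extend_of_nonneg le_rfl, S.op_zero]

lemma extend_add_apply {s t : ℝ} (hs : 0 ≤ s) (ht : 0 ≤ t) (x : X) :
    S.extend (s + t) x = S.extend s (S.extend t x) := by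
  rw [S.extend_of_nonneg hs, S.extend_of_nonneg ht, S.extend_of_nonneg (add_nonneg hs ht),
    S.op_add s t hs ht, ContinuousLinearMap.comp_apply]

lemma continuous_extend_const (x : X) : Continuous fun t => S.extend t x :=
  (S.continuousOn_op x).comp_continuous (by fun_prop) fun t => le_max_right t 0

variable [CompleteSpace X]

lemma exists_forall_norm_extend_le (T : ℝ) : ∃ K : ℝ, 0 < K ∧ ∀ t ≤ T, ‖S.extend t‖ ≤ K := by
  obtain ⟨C, hC⟩ := banach_steinhaus (ι := Icc (0 : ℝ) (max T 0)) (g := fun t => S.op t)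
    fun x => by
      obtain ⟨C, hC⟩ := isCompact_Icc.exists_bound_of_continuousOn
        ((S.continuousOn_op x).mono fun t (ht : t ∈ Icc (0 : ℝ) (max T 0)) => ht.1)
      exact ⟨C, fun t => hC t t.2⟩
  exact ⟨max C 1, by positivity, fun t ht =>
    (hC ⟨max t 0, le_max_right _ _, max_le_max ht le_rfl⟩).trans (le_max_left _ _)⟩

/-- A positive bound for `‖S(t)‖` on `0 ≤ t ≤ T`, provided by the uniform boundedness principle. -/
def growthBound (T : ℝ) : ℝ := (S.exists_forall_norm_extend_le T).choose

lemma growthBound_pos (T : ℝ) : 0 < S.growthBound T :=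
  (S.exists_forall_norm_extend_le T).choose_spec.1

lemma norm_extend_le {t T : ℝ} (ht : t ≤ T) : ‖S.extend t‖ ≤ S.growthBound T :=
  (S.exists_forall_norm_extend_le T).choose_spec.2 t ht

lemma norm_extend_apply_le {t T : ℝ} (ht : t ≤ T) (x : X) :
    ‖S.extend t x‖ ≤ S.growthBound T * ‖x‖ :=
  (S.extend t).le_of_opNorm_le (S.norm_extend_le ht) x

lemma continuous_extend_apply {Z : Type*} [TopologicalSpace Z] {a : Z → ℝ} {b : Z → X}
    (ha : Continuous a) (hb : Continuous b) : Continuous fun z => S.extend (a z) (b z) := by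
  refine continuous_iff_continuousAt.2 fun z => tendsto_clm_apply_of_norm_le
    (C := S.growthBound (a z + 1)) ?_ ?_ (hb.tendsto z)
  · filter_upwards [(ha.tendsto z).eventually_le_const (lt_add_one (a z))] with z' hz'
    exact S.norm_extend_le hz'
  · exact ((S.continuous_extend_const (b z)).comp ha).tendsto z

lemma eventually_forall_norm_extend_sub_lt {C : Set X} (hC : IsCompact C) (t₀ : ℝ) {ε : ℝ}
    (hε : 0 < ε) : ∀ᶠ t in 𝓝 t₀, ∀ x ∈ C, ‖S.extend t x - S.extend t₀ x‖ < ε := by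
  refine hC.eventually_forall_of_forall_eventually fun x _ => ?_
  have hcont : Continuous fun p : ℝ × X => ‖S.extend p.1 p.2 - S.extend t₀ p.2‖ :=
    ((S.continuous_extend_apply continuous_fst continuous_snd).sub
      ((S.extend t₀).continuous.comp continuous_snd)).norm
  exact (hcont.tendsto (t₀, x)).eventually_lt_const (by simpa using hε)

/- Past the time `δ`, `S(t) = S(t - δ) S(δ)` and `S(δ)` maps the unit ball into a compact set, on
which strong continuity is uniform. -/
lemma continuousAt_extend_of_isCompactOperator {δ t₀ : ℝ} (hδ : 0 ≤ δ)
    (hcomp : IsCompactOperator (S.op δ)) (ht₀ : δ < t₀) : ContinuousAt S.extend t₀ := by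
  have hC : IsCompact (closure (S.extend δ '' Metric.closedBall 0 1)) := by
    rw [S.extend_of_nonneg hδ]
    exact hcomp.isCompact_closure_image_closedBall (f := (S.op δ : X →ₗ[𝕜] X)) 1
  rw [Metric.continuousAt_iff']
  intro ε hε
  have hshift : Tendsto (fun t : ℝ => t - δ) (𝓝 t₀) (𝓝 (t₀ - δ)) :=
    (continuous_id.sub continuous_const).tendsto t₀
  filter_upwards [hshift.eventually
    (S.eventually_forall_norm_extend_sub_lt hC (t₀ - δ) (half_pos hε)), eventually_ge_nhds ht₀]
    with t ht htδ
  rw [dist_eq_norm]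
  refine lt_of_le_of_lt ?_ (half_lt_self hε)
  refine ContinuousLinearMap.opNorm_le_of_unit_norm (𝕜 := 𝕜) (half_pos hε).le fun x hx => ?_
  have hsplit (r : ℝ) (hr : δ ≤ r) : S.extend r x = S.extend (r - δ) (S.extend δ x) := by
    rw [← S.extend_add_apply (sub_nonneg.2 hr) hδ, sub_add_cancel]
  rw [sub_apply, hsplit t htδ, hsplit t₀ ht₀.le]
  exact (ht _ (subset_closure (mem_image_of_mem _ (by simp [hx])))).le

end C0Semigroup

end Semigroup

section AdjointSemigroup

open ContinuousLinearMap (adjoint)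

variable {𝕜 X Y : Type*} [RCLike 𝕜] [NormedAddCommGroup X] [InnerProductSpace 𝕜 X]
  [CompleteSpace X] [NormedAddCommGroup Y] [InnerProductSpace 𝕜 Y] [CompleteSpace Y]

lemma norm_sq_adjoint_apply_le (A : X →L[𝕜] Y) (y : Y) :
    ‖adjoint A y‖ ^ 2 ≤ ‖A (adjoint A y)‖ * ‖y‖ := by
  calc ‖adjoint A y‖ ^ 2 = RCLike.re (inner 𝕜 (A (adjoint A y)) y) := by
        rw [← ContinuousLinearMap.adjoint_inner_right, inner_self_eq_norm_sq]
    _ ≤ ‖A (adjoint A y)‖ * ‖y‖ := re_inner_le_norm _ _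

lemma isCompactOperator_adjoint {A : X →L[𝕜] Y} (hA : IsCompactOperator A) :
    IsCompactOperator (adjoint A) := by
  refine (isCompactOperator_iff_isCompact_closure_image_closedBall
    (adjoint A : Y →ₗ[𝕜] X) one_pos).2
    (TotallyBounded.isCompact_of_isClosed (TotallyBounded.closure ?_) isClosed_closure)
  have hAA : TotallyBounded ((A ∘L adjoint A) '' Metric.closedBall 0 1) :=
    ((hA.comp_clm (adjoint A)).isCompact_closure_image_closedBall
      (f := ((A ∘L adjoint A : Y →L[𝕜] Y) : Y →ₗ[𝕜] Y)) 1).totallyBounded.subset subset_closure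
  rw [Metric.totallyBounded_iff]
  intro ε hε
  obtain ⟨t, hts, htfin, ht⟩ := exists_subset_image_finite_and.1
    (Metric.finite_approx_of_totallyBounded hAA (ε ^ 2 / 2) (by positivity))
  refine ⟨adjoint A '' t, htfin.image _, ?_⟩
  rintro _ ⟨x, hx, rfl⟩
  obtain ⟨_, ⟨y, hy, rfl⟩, hxy⟩ := mem_iUnion₂.1 (ht (mem_image_of_mem _ hx))
  refine mem_iUnion₂.2 ⟨_, mem_image_of_mem _ hy, ?_⟩
  rw [Metric.mem_ball, dist_eq_norm, ← map_sub, ContinuousLinearMap.comp_apply] at hxy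
  have hxy2 : ‖x - y‖ ≤ 2 := (norm_sub_le x y).trans <| by
    linarith [mem_closedBall_zero_iff.1 hx, mem_closedBall_zero_iff.1 (hts hy)]
  have hsq : ‖adjoint A (x - y)‖ ^ 2 < ε ^ 2 := by
    calc ‖adjoint A (x - y)‖ ^ 2 ≤ ‖A (adjoint A (x - y))‖ * ‖x - y‖ :=
          norm_sq_adjoint_apply_le A _
      _ ≤ ‖A (adjoint A (x - y))‖ * 2 := by gcongr
      _ < ε ^ 2 := by linarith
  rw [Metric.mem_ball, dist_eq_norm, ContinuousLinearMap.coe_coe, ← map_sub]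
  exact lt_of_pow_lt_pow_left₀ 2 hε.le hsq

namespace C0Semigroup

variable {S : C0Semigroup 𝕜 X}

lemma continuousAt_adjoint_extend_of_pos (hS : S.IsCompactSemigroup) {t : ℝ} (ht : 0 < t) :
    ContinuousAt (fun t => adjoint (S.extend t)) t :=
  (adjoint (𝕜 := 𝕜) (E := X) (F := X)).continuous.continuousAt.comp
    (S.continuousAt_extend_of_isCompactOperator (half_pos ht).le (hS _ (half_pos ht))
      (half_lt_self ht))

lemma dense_span_range_adjoint_extend (S : C0Semigroup 𝕜 X) :
    Dense (Submodule.span 𝕜 {x | ∃ δ > 0, ∃ y, adjoint (S.extend δ) y = x} : Set X) := by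
  rw [Submodule.dense_iff_topologicalClosure_eq_top, Submodule.topologicalClosure_eq_top_iff,
    Submodule.eq_bot_iff]
  intro y hy
  have hzero : ∀ δ > 0, S.extend δ y = 0 := fun δ hδ => by
    rw [← inner_self_eq_zero (𝕜 := 𝕜), ← ContinuousLinearMap.adjoint_inner_right]
    exact (Submodule.mem_orthogonal' _ y).1 hy _ (Submodule.subset_span ⟨δ, hδ, _, rfl⟩)
  have hlim : Tendsto (fun δ => S.extend δ y) (𝓝[>] 0) (𝓝 y) := by
    simpa using ((S.continuous_extend_const y).tendsto 0).mono_left nhdsWithin_le_nhds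
  exact tendsto_nhds_unique hlim (tendsto_const_nhds.congr'
    (eventually_mem_nhdsWithin.mono fun δ hδ => (hzero δ hδ).symm))

/- `S(t)* S(δ)* y = S(t + δ)* y → S(δ)* y` by norm continuity at `δ`, and the vectors `S(δ)* y`
span a dense subspace. -/
lemma tendsto_adjoint_extend_zero (hS : S.IsCompactSemigroup) (x : X) :
    Tendsto (fun t => adjoint (S.extend t) x) (𝓝[>] 0) (𝓝 x) := by
  refine tendsto_clm_apply_of_dense (C := S.growthBound 1) (A₀ := ContinuousLinearMap.id 𝕜 X) ?_
    S.dense_span_range_adjoint_extend (fun x hx => ?_) x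
  · filter_upwards [nhdsWithin_le_nhds (Iic_mem_nhds one_pos)] with t ht
    rw [LinearIsometryEquiv.norm_map]
    exact S.norm_extend_le ht
  induction hx using Submodule.span_induction with
  | zero => simp
  | add x y _ _ hx hy => simpa only [map_add] using hx.add hy
  | smul c x _ hx => simpa only [map_smul] using hx.const_smul c
  | mem x hx =>
    obtain ⟨δ, hδ, y, rfl⟩ := hx
    have hcont : ContinuousAt (fun t => adjoint (S.extend (δ + t)) y) 0 := by
      have := (continuousAt_adjoint_extend_of_pos hS hδ).clm_apply (continuousAt_const (y := y))
      exact ContinuousAt.comp (x := (0 : ℝ)) (g := fun t => adjoint (S.extend t) y)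
        (f := fun t => δ + t) (by simpa using this) (by fun_prop)
    have hlim : Tendsto (fun t => adjoint (S.extend (δ + t)) y) (𝓝[>] 0)
        (𝓝 (adjoint (S.extend δ) y)) := by
      simpa using hcont.tendsto.mono_left nhdsWithin_le_nhds
    refine hlim.congr' (eventually_mem_nhdsWithin.mono fun t (ht : 0 < t) => ?_)
    rw [show S.extend (δ + t) = S.extend δ ∘L S.extend t from
      ContinuousLinearMap.ext (S.extend_add_apply hδ.le ht.le), ContinuousLinearMap.adjoint_comp,
      ContinuousLinearMap.comp_apply]

/-- The adjoint semigroup `t ↦ S(t)*`. Its strong continuity is proved here for compact semigroups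
only, where it follows from norm continuity at positive times. -/
def adj (S : C0Semigroup 𝕜 X) (hS : S.IsCompactSemigroup) : C0Semigroup 𝕜 X where
  op t := adjoint (S.op t)
  op_zero := by rw [S.op_zero]; exact ContinuousLinearMap.adjoint_id
  op_add s t hs ht := by
    rw [add_comm, S.op_add t s ht hs, ContinuousLinearMap.adjoint_comp]
  continuousOn_op x := by
    suffices ContinuousOn (fun t => adjoint (S.extend t) x) (Ici 0) from
      this.congr fun t ht => by simp only [S.extend_of_nonneg (mem_Ici.1 ht)]
    intro t ht
    rcases (show (0 : ℝ) ≤ t from ht).eq_or_lt with rfl | h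
    · rw [← continuousWithinAt_Ioi_iff_Ici]
      simpa [ContinuousWithinAt, ContinuousLinearMap.adjoint_id] using
        tendsto_adjoint_extend_zero hS x
    · exact ((continuousAt_adjoint_extend_of_pos hS h).clm_apply
        continuousAt_const).continuousWithinAt

lemma adj_isCompactSemigroup (hS : S.IsCompactSemigroup) : (S.adj hS).IsCompactSemigroup :=
  fun t ht => isCompactOperator_adjoint (hS t ht)

lemma adj_extend (hS : S.IsCompactSemigroup) (t : ℝ) :
    (S.adj hS).extend t = adjoint (S.extend t) := rfl

end C0Semigroup

end AdjointSemigroup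

section Neumann

variable {𝕜 F : Type*} [NontriviallyNormedField 𝕜] [NormedAddCommGroup F] [NormedSpace 𝕜 F]
  [CompleteSpace F] {V : F →L[𝕜] F} {a : ℝ}

lemma summable_pow_of_norm_pow_le (hV : ∀ n : ℕ, ‖V ^ n‖ ≤ a ^ n / n.factorial) :
    Summable (V ^ ·) :=
  .of_norm_bounded (Real.summable_pow_div_factorial a) hV

lemma isUnit_one_sub_of_norm_pow_le (hV : ∀ n : ℕ, ‖V ^ n‖ ≤ a ^ n / n.factorial) :
    IsUnit (1 - V) :=
  ⟨⟨_, _, (summable_pow_of_norm_pow_le hV).one_sub_mul_tsum_pow,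
    (summable_pow_of_norm_pow_le hV).tsum_pow_mul_one_sub⟩, rfl⟩

lemma norm_inverse_one_sub_le (hV : ∀ n : ℕ, ‖V ^ n‖ ≤ a ^ n / n.factorial) :
    ‖Ring.inverse (1 - V)‖ ≤ Real.exp a := by
  have hunit := isUnit_one_sub_of_norm_pow_le hV
  have hinv : Ring.inverse (1 - V) = ∑' n, V ^ n := by
    refine hunit.mul_left_cancel ?_
    rw [Ring.mul_inverse_cancel _ hunit, (summable_pow_of_norm_pow_le hV).one_sub_mul_tsum_pow]
  rw [hinv, Real.exp_eq_exp_ℝ, NormedSpace.exp_eq_tsum_div]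
  exact tsum_of_norm_bounded (Real.summable_pow_div_factorial a).hasSum hV

lemma continuousAt_inverse_of_isUnit (hV : IsUnit V) : ContinuousAt Ring.inverse V := by
  obtain ⟨u, rfl⟩ := hV
  exact NormedRing.inverse_continuousAt u

end Neumann

section Volterra

variable {𝕜 X : Type*} [RCLike 𝕜] [NormedAddCommGroup X] [NormedSpace 𝕜 X]
  {T : ℝ}

/-- The integrand `S(t - r) G(r) e(r, s)` of the Volterra operator at `(t, s)`, made total in `r` by
projecting onto `[0, T]`. -/
def volterraIntegrand (S : C0Semigroup 𝕜 X) (hT : 0 ≤ T) (G : C(Icc 0 T, X →L[𝕜] X))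
    (e : C(Icc 0 T × Icc 0 T, X)) (p : Icc 0 T × Icc 0 T) (r : ℝ) : X :=
  S.extend (p.1 - r) (G (projIcc 0 T hT r) (e (projIcc 0 T hT r, p.2)))

variable [CompleteSpace X]

lemma continuous_volterraIntegrand (S : C0Semigroup 𝕜 X) (hT : 0 ≤ T) (G : C(Icc 0 T, X →L[𝕜] X))
    (e : C(Icc 0 T × Icc 0 T, X)) :
    Continuous (Function.uncurry (volterraIntegrand S hT G e)) := by
  have hproj : Continuous fun q : (Icc 0 T × Icc 0 T) × ℝ => projIcc 0 T hT q.2 :=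
    continuous_projIcc.comp continuous_snd
  exact S.continuous_extend_apply (by fun_prop) ((G.continuous.comp hproj).clm_apply
    (e.continuous.comp (hproj.prodMk (continuous_snd.comp continuous_fst))))

lemma intervalIntegrable_volterraIntegrand (S : C0Semigroup 𝕜 X) (hT : 0 ≤ T)
    (G : C(Icc 0 T, X →L[𝕜] X)) (e : C(Icc 0 T × Icc 0 T, X)) (p : Icc 0 T × Icc 0 T) (a b : ℝ) :
    IntervalIntegrable (volterraIntegrand S hT G e p) volume a b :=
  ((continuous_volterraIntegrand S hT G e).comp (Continuous.prodMk_right p)).intervalIntegrable a b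

lemma norm_volterraIntegrand_le (S : C0Semigroup 𝕜 X) (hT : 0 ≤ T) (G : C(Icc 0 T, X →L[𝕜] X))
    (e : C(Icc 0 T × Icc 0 T, X)) (p : Icc 0 T × Icc 0 T) {r : ℝ}
    (hr : 0 ≤ r) :
    ‖volterraIntegrand S hT G e p r‖
      ≤ S.growthBound T * ‖G‖ * ‖e (projIcc 0 T hT r, p.2)‖ := by
  have := S.growthBound_pos T
  have htT : p.1 - r ≤ T := by linarith [p.1.2.2]
  refine (S.norm_extend_apply_le htT _).trans ?_
  rw [mul_assoc]
  gcongr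
  exact (G _).le_of_opNorm_le (G.norm_coe_le_norm _) _

/-- The map `x ↦ ((t, s) ↦ S(t - s) x)`. -/
def propagator (S : C0Semigroup 𝕜 X) (T : ℝ) : X →L[𝕜] C(Icc 0 T × Icc 0 T, X) :=
  LinearMap.mkContinuous
    { toFun := fun x => ⟨fun p => S.extend (p.1 - p.2) x,
        S.continuous_extend_apply (by fun_prop) continuous_const⟩
      map_add' := fun x y => by ext; simp
      map_smul' := fun c x => by ext; simp }
    (S.growthBound T) fun x => by
      have := S.growthBound_pos T
      refine (ContinuousMap.norm_le _ (by positivity)).2 fun p => S.norm_extend_apply_le ?_ x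
      linarith [p.1.2.2, p.2.2.1]

lemma propagator_apply (S : C0Semigroup 𝕜 X) (x : X) (p : Icc 0 T × Icc 0 T) :
    propagator S T x p = S.extend (p.1 - p.2) x := rfl

lemma norm_propagator_le (S : C0Semigroup 𝕜 X) : ‖propagator S T‖ ≤ S.growthBound T :=
  LinearMap.mkContinuous_norm_le _ (S.growthBound_pos T).le _

/-- A bound for the norms of the evolution operators generated by `A + G(·)` with `‖G‖ ≤ L`. -/
def evolutionBound (S : C0Semigroup 𝕜 X) (T L : ℝ) : ℝ :=
  Real.exp (S.growthBound T * L * T) * S.growthBound T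

lemma evolutionBound_pos (S : C0Semigroup 𝕜 X) (T L : ℝ) : 0 < evolutionBound S T L :=
  mul_pos (Real.exp_pos _) (S.growthBound_pos T)

variable [NormedSpace ℝ X] (S : C0Semigroup 𝕜 X) (hT : 0 ≤ T) (G : C(Icc 0 T, X →L[𝕜] X))
  (e : C(Icc 0 T × Icc 0 T, X))

/-- The function `(t, s) ↦ ∫ₛᵗ S(t - r) G(r) e(r, s) dr`, extended by zero to `t < s`. -/
def volterraFun : C(Icc 0 T × Icc 0 T, X) where
  toFun p := ∫ r in (p.2 : ℝ)..max p.2 p.1, volterraIntegrand S hT G e p r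
  continuous_toFun := by
    have hint := intervalIntegrable_volterraIntegrand S hT G e
    have hcont := continuous_volterraIntegrand S hT G e
    simp_rw [← fun p : Icc 0 T × Icc 0 T => intervalIntegral.integral_interval_sub_left
      (hint p 0 (max p.2 p.1)) (hint p 0 p.2)]
    exact (intervalIntegral.continuous_parametric_intervalIntegral_of_continuous hcont
      (by fun_prop)).sub
      (intervalIntegral.continuous_parametric_intervalIntegral_of_continuous hcont (by fun_prop))

lemma volterraFun_apply (p : Icc 0 T × Icc 0 T) :
    volterraFun S hT G e p = ∫ r in (p.2 : ℝ)..max p.2 p.1, volterraIntegrand S hT G e p r := rfl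

lemma norm_volterraFun_apply_le {n : ℕ} {C : ℝ} {p : Icc 0 T × Icc 0 T}
    (he : ∀ t, p.2 ≤ t → ‖e (t, p.2)‖ ≤ C * ((t : ℝ) - p.2) ^ n) :
    ‖volterraFun S hT G e p‖
      ≤ S.growthBound T * ‖G‖ * (C * ((max p.2 p.1 : ℝ) - p.2) ^ (n + 1) / (n + 1)) := by
  have hK := S.growthBound_pos T
  have hbound : ∀ r ∈ Ioc (p.2 : ℝ) (max p.2 p.1), ‖volterraIntegrand S hT G e p r‖
      ≤ S.growthBound T * ‖G‖ * (C * (r - p.2) ^ n) := fun r hr => by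
    have hr0 : 0 ≤ r := p.2.2.1.trans hr.1.le
    refine (norm_volterraIntegrand_le S hT G e p hr0).trans ?_
    have hrT : r ∈ Icc 0 T := ⟨hr0, hr.2.trans (max_le p.2.2.2 p.1.2.2)⟩
    gcongr
    rw [projIcc_of_mem hT hrT]
    exact he ⟨r, hrT⟩ hr.1.le
  refine (intervalIntegral.norm_integral_le_of_norm_le (le_max_left _ _)
    (Eventually.of_forall hbound) (Continuous.intervalIntegrable (by fun_prop) _ _)).trans_eq ?_
  rw [intervalIntegral.integral_const_mul, intervalIntegral.integral_const_mul,
    intervalIntegral.integral_comp_sub_right fun r => r ^ n]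
  simp [mul_div_assoc]

lemma norm_volterraFun_le : ‖volterraFun S hT G e‖ ≤ S.growthBound T * T * ‖G‖ * ‖e‖ := by
  have hK := S.growthBound_pos T
  refine (ContinuousMap.norm_le _ (by positivity)).2 fun p => ?_
  refine (norm_volterraFun_apply_le S hT G e (n := 0) (C := ‖e‖) fun t _ => by
    simpa using e.norm_coe_le_norm _).trans ?_
  have hlen : (max p.2 p.1 : ℝ) - p.2 ≤ T := by
    linarith [max_le p.2.2.2 p.1.2.2, p.2.2.1]
  calc S.growthBound T * ‖G‖ * (‖e‖ * ((max p.2 p.1 : ℝ) - p.2) ^ (0 + 1) / ((0 : ℕ) + 1))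
      = S.growthBound T * ‖G‖ * (‖e‖ * ((max p.2 p.1 : ℝ) - p.2)) := by simp
    _ ≤ S.growthBound T * ‖G‖ * (‖e‖ * T) := by gcongr
    _ = S.growthBound T * T * ‖G‖ * ‖e‖ := by ring

variable [IsScalarTower ℝ 𝕜 X]

/-- The Volterra operator `volterraFun`, as a bounded bilinear map of `G` and `e`. -/
def volterra (S : C0Semigroup 𝕜 X) (hT : 0 ≤ T) :
    C(Icc 0 T, X →L[𝕜] X) →L[𝕜] C(Icc 0 T × Icc 0 T, X) →L[𝕜] C(Icc 0 T × Icc 0 T, X) :=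
  LinearMap.mkContinuous₂
    (LinearMap.mk₂ 𝕜 (volterraFun S hT)
      (fun G₁ G₂ e => by
        ext p
        simp only [ContinuousMap.add_apply, volterraFun_apply]
        rw [← intervalIntegral.integral_add (intervalIntegrable_volterraIntegrand ..)
          (intervalIntegrable_volterraIntegrand ..)]
        simp [volterraIntegrand])
      (fun c G e => by
        ext p
        simp only [ContinuousMap.smul_apply, volterraFun_apply]
        rw [← intervalIntegral.integral_smul]
        simp [volterraIntegrand])
      (fun G e₁ e₂ => by
        ext p
        simp only [ContinuousMap.add_apply, volterraFun_apply]
        rw [← intervalIntegral.integral_add (intervalIntegrable_volterraIntegrand ..)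
          (intervalIntegrable_volterraIntegrand ..)]
        simp [volterraIntegrand])
      (fun c G e => by
        ext p
        simp only [ContinuousMap.smul_apply, volterraFun_apply]
        rw [← intervalIntegral.integral_smul]
        simp [volterraIntegrand]))
    (S.growthBound T * T) (norm_volterraFun_le S hT)

lemma volterra_apply : volterra S hT G e = volterraFun S hT G e := rfl

lemma norm_volterra_pow_apply_le (n : ℕ) (p : Icc 0 T × Icc 0 T) :
    ‖(volterra S hT G ^ n) e p‖ ≤
      (S.growthBound T * ‖G‖) ^ n / n.factorial * ‖e‖ * ((max p.2 p.1 : ℝ) - p.2) ^ n := by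
  induction n generalizing p with
  | zero => simpa using e.norm_coe_le_norm p
  | succ n ih =>
    rw [pow_succ', mul_apply_eq_comp, volterra_apply]
    refine (norm_volterraFun_apply_le S hT G _ (n := n)
      (C := (S.growthBound T * ‖G‖) ^ n / n.factorial * ‖e‖) fun t ht => ?_).trans_eq ?_
    · exact (ih (t, p.2)).trans_eq (by rw [max_eq_right (Subtype.coe_le_coe.2 ht)])
    · rw [Nat.factorial_succ]
      push_cast
      field_simp
      ring

lemma norm_volterra_pow_le (n : ℕ) :
    ‖volterra S hT G ^ n‖ ≤ (S.growthBound T * ‖G‖ * T) ^ n / n.factorial := by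
  have hK := S.growthBound_pos T
  refine ContinuousLinearMap.opNorm_le_bound _ (by positivity) fun e => ?_
  refine (ContinuousMap.norm_le _ (by positivity)).2 fun p =>
    (norm_volterra_pow_apply_le S hT G e n p).trans ?_
  have hlen : (max p.2 p.1 : ℝ) - p.2 ≤ T := by
    linarith [max_le p.2.2.2 p.1.2.2, p.2.2.1]
  have hlen0 : 0 ≤ (max p.2 p.1 : ℝ) - p.2 := sub_nonneg.2 (le_max_left _ _)
  calc (S.growthBound T * ‖G‖) ^ n / n.factorial * ‖e‖ * ((max p.2 p.1 : ℝ) - p.2) ^ n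
      ≤ (S.growthBound T * ‖G‖) ^ n / n.factorial * ‖e‖ * T ^ n := by gcongr
    _ = (S.growthBound T * ‖G‖ * T) ^ n / n.factorial * ‖e‖ := by rw [mul_pow _ T]; ring

lemma isUnit_one_sub_volterra : IsUnit (1 - volterra S hT G) :=
  isUnit_one_sub_of_norm_pow_le (norm_volterra_pow_le S hT G)

lemma norm_inverse_one_sub_volterra_le :
    ‖Ring.inverse (1 - volterra S hT G)‖ ≤ Real.exp (S.growthBound T * ‖G‖ * T) :=
  norm_inverse_one_sub_le (norm_volterra_pow_le S hT G)

/-- The map `x ↦ ((t, s) ↦ 𝔗(t, s) x)`, where `𝔗` is the evolution operator generated by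
`A + G(·)`: the solution of `e = S(t - s) x + ∫ₛᵗ S(t - r) G(r) e(r, s) dr`. -/
def evolutionMap (S : C0Semigroup 𝕜 X) (hT : 0 ≤ T) (G : C(Icc 0 T, X →L[𝕜] X)) :
    X →L[𝕜] C(Icc 0 T × Icc 0 T, X) :=
  Ring.inverse (1 - volterra S hT G) ∘L propagator S T

lemma eq_evolutionMap_iff (x : X) :
    e = evolutionMap S hT G x ↔ e = propagator S T x + volterra S hT G e := by
  have hunit := isUnit_one_sub_volterra S hT G
  have hleft (e') : Ring.inverse (1 - volterra S hT G) ((1 - volterra S hT G) e') = e' :=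
    DFunLike.congr_fun (Ring.inverse_mul_cancel _ hunit) e'
  have hright (e') : (1 - volterra S hT G) (Ring.inverse (1 - volterra S hT G) e') = e' :=
    DFunLike.congr_fun (Ring.mul_inverse_cancel _ hunit) e'
  rw [← sub_eq_iff_eq_add]
  constructor
  · rintro rfl
    exact hright _
  · intro h
    rw [evolutionMap, ContinuousLinearMap.comp_apply, ← h]
    exact (hleft e).symm

lemma continuous_evolutionMap : Continuous (evolutionMap S hT) := by
  refine Continuous.clm_comp (continuous_iff_continuousAt.2 fun G => ?_) continuous_const
  refine ContinuousAt.comp (g := Ring.inverse) ?_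
    (continuous_const.sub (volterra S hT).continuous).continuousAt
  exact continuousAt_inverse_of_isUnit (isUnit_one_sub_volterra S hT G)

/-- The evolution operator `𝔗(t, s)` generated by `A + G(·)`, where the times `t` and `s` are
projected onto `[0, T]`; it is the identity for `t ≤ s`. -/
def evolution (S : C0Semigroup 𝕜 X) (hT : 0 ≤ T) (G : C(Icc 0 T, X →L[𝕜] X)) (t s : ℝ) :
    X →L[𝕜] X :=
  ContinuousMap.evalCLM 𝕜 (projIcc 0 T hT t, projIcc 0 T hT s) ∘L evolutionMap S hT G

lemma evolution_apply (t s : ℝ) (x : X) :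
    evolution S hT G t s x = evolutionMap S hT G x (projIcc 0 T hT t, projIcc 0 T hT s) := rfl

lemma continuous_evolution_apply {Z : Type*} [TopologicalSpace Z] {G : Z → C(Icc 0 T, X →L[𝕜] X)}
    (hG : Continuous G) {t s : Z → ℝ} (ht : Continuous t) (hs : Continuous s) {x : Z → X}
    (hx : Continuous x) : Continuous fun z => evolution S hT (G z) (t z) (s z) (x z) :=
  (((continuous_evolutionMap S hT).comp hG).clm_apply hx).eval
    ((continuous_projIcc.comp ht).prodMk (continuous_projIcc.comp hs))

variable {G} in
lemma norm_evolution_le {L : ℝ} (hG : ‖G‖ ≤ L) (t s : ℝ) :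
    ‖evolution S hT G t s‖ ≤ evolutionBound S T L := by
  have hK := S.growthBound_pos T
  have hmap : ‖evolutionMap S hT G‖ ≤ evolutionBound S T L := by
    refine (ContinuousLinearMap.opNorm_comp_le _ _).trans
      (mul_le_mul ?_ (norm_propagator_le S) (norm_nonneg _) (Real.exp_nonneg _))
    exact (norm_inverse_one_sub_volterra_le S hT G).trans (by gcongr)
  refine ContinuousLinearMap.opNorm_le_bound _ (evolutionBound_pos S T L).le fun x => ?_
  exact ((evolutionMap S hT G x).norm_coe_le_norm _).trans
    ((evolutionMap S hT G).le_of_opNorm_le hmap x)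

variable {G} in
lemma norm_evolution_apply_le {L : ℝ} (hG : ‖G‖ ≤ L) (t s : ℝ) (x : X) :
    ‖evolution S hT G t s x‖ ≤ evolutionBound S T L * ‖x‖ :=
  (evolution S hT G t s).le_of_opNorm_le (norm_evolution_le S hT hG t s) x

lemma evolution_eq_integral (x : X) {s t : ℝ} (hs : 0 ≤ s) (hst : s ≤ t) (ht : t ≤ T) :
    evolution S hT G t s x = S.extend (t - s) x
      + ∫ r in s..t, S.extend (t - r) (G (projIcc 0 T hT r) (evolution S hT G r s x)) := by
  have hsT : s ∈ Icc 0 T := ⟨hs, hst.trans ht⟩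
  have htT : t ∈ Icc 0 T := ⟨hs.trans hst, ht⟩
  have heq := DFunLike.congr_fun ((eq_evolutionMap_iff S hT G _ x).1 rfl) (⟨t, htT⟩, ⟨s, hsT⟩)
  simp only [ContinuousMap.add_apply, propagator_apply, volterra_apply, volterraFun_apply,
    max_eq_right hst] at heq
  simp only [evolution_apply, projIcc_of_mem hT htT, projIcc_of_mem hT hsT]
  exact heq

end Volterra

section EvolutionOperator

variable {𝕜 X : Type*} [RCLike 𝕜] [NormedAddCommGroup X] [InnerProductSpace 𝕜 X] [NormedSpace ℝ X]
  [IsScalarTower ℝ 𝕜 X] [CompleteSpace X] {S : C0Semigroup 𝕜 X} {T : ℝ}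
  {G : C(Icc 0 T, X →L[𝕜] X)} {G' : ℝ → X →L[𝕜] X}

lemma isEvolutionOperator_evolution (hT : 0 ≤ T) (hG' : ∀ t : Icc 0 T, G' t = G t) :
    IsEvolutionOperator S T G' (evolution S hT G) where
  continuousOn x := (continuous_evolution_apply S hT (Z := ℝ × ℝ) (G := fun _ => G)
    continuous_const continuous_fst continuous_snd (continuous_const (y := x))).continuousOn
  eq_integral x s t hs hst ht := by
    rw [evolution_eq_integral S hT G x hs hst ht, S.extend_of_nonneg (sub_nonneg.2 hst)]
    congr 1
    refine intervalIntegral.integral_congr fun r hr => ?_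
    rw [uIcc_of_le hst] at hr
    have hrT : r ∈ Icc 0 T := ⟨hs.trans hr.1, hr.2.trans ht⟩
    simp only [hG' ⟨r, hrT⟩, projIcc_of_mem hT hrT, S.extend_of_nonneg (sub_nonneg.2 hr.2)]

lemma IsEvolutionOperator.eq_evolution (hT : 0 ≤ T) (hG' : ∀ t : Icc 0 T, G' t = G t)
    {E : ℝ → ℝ → X →L[𝕜] X} (hE : IsEvolutionOperator S T G' E) {s t : ℝ} (hs : 0 ≤ s)
    (hst : s ≤ t) (ht : t ≤ T) : E t s = evolution S hT G t s := by
  ext x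
  let e : C(Icc 0 T × Icc 0 T, X) := ⟨fun p => E (max p.1 p.2) p.2 x,
    (hE.continuousOn x).comp_continuous
      (f := fun p : Icc 0 T × Icc 0 T => (max (p.1 : ℝ) p.2, (p.2 : ℝ))) (by fun_prop)
      fun p => ⟨p.2.2.1, le_max_right _ _, max_le p.1.2.2 p.2.2.2⟩⟩
  have he : e = evolutionMap S hT G x := by
    rw [eq_evolutionMap_iff]
    ext ⟨t, s⟩
    rw [ContinuousMap.add_apply, propagator_apply, volterra_apply, volterraFun_apply]
    change E (max (t : ℝ) s) s x = _
    rcases le_total (t : ℝ) s with h | h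
    · rw [max_eq_right h, max_eq_left h, hE.eq_integral x s s s.2.1 le_rfl s.2.2,
        C0Semigroup.extend, max_eq_right (sub_nonpos.2 h)]
      simp [S.op_zero]
    · rw [max_eq_left h, max_eq_right h, hE.eq_integral x s t s.2.1 h t.2.2,
        S.extend_of_nonneg (sub_nonneg.2 h)]
      congr 1
      refine intervalIntegral.integral_congr fun r hr => ?_
      rw [uIcc_of_le h] at hr
      have hrT : r ∈ Icc 0 T := ⟨s.2.1.trans hr.1, hr.2.trans t.2.2⟩
      simp only [volterraIntegrand, projIcc_of_mem hT hrT, S.extend_of_nonneg (sub_nonneg.2 hr.2)]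
      change _ = S.op (t - r) (G ⟨r, hrT⟩ (E (max r s) s x))
      rw [max_eq_left hr.1, ← hG' ⟨r, hrT⟩]
  have hsT : s ∈ Icc 0 T := ⟨hs, hst.trans ht⟩
  have htT : t ∈ Icc 0 T := ⟨hs.trans hst, ht⟩
  rw [evolution_apply, ← he, projIcc_of_mem hT htT, projIcc_of_mem hT hsT]
  change E t s x = E (max t s) s x
  rw [max_eq_left hst]

lemma isEvolutionOperator_evolutionOperator (hT : 0 ≤ T) (hG' : ∀ t : Icc 0 T, G' t = G t) :
    IsEvolutionOperator S T G' (evolutionOperator S T G') :=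
  Classical.epsilon_spec ⟨_, isEvolutionOperator_evolution hT hG'⟩

end EvolutionOperator

section Fubini

variable {F : Type*} [NormedAddCommGroup F]

lemma integrable_prod_of_continuous {H : ℝ × ℝ → F} (hH : Continuous H) (a b : ℝ) :
    Integrable H ((volume.restrict (Ioc a b)).prod (volume.restrict (Ioc a b))) := by
  rw [Measure.prod_restrict]
  have h : IntegrableOn H (Icc a b ×ˢ Icc a b) (volume.prod volume) :=
    hH.continuousOn.integrableOn_compact (isCompact_Icc.prod isCompact_Icc)
  exact h.mono_set (prod_mono Ioc_subset_Icc_self Ioc_subset_Icc_self)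

variable [NormedSpace ℝ F] {a b : ℝ} {H : ℝ → ℝ → F}

lemma intervalIntegral_eq_setIntegral_indicator_left {r : ℝ} (hr : r ∈ Ioc a b) :
    ∫ s in a..r, H r s
      = ∫ s in Ioc a b, {p : ℝ × ℝ | p.2 ≤ p.1}.indicator (Function.uncurry H) (r, s) := by
  change _ = ∫ s in Ioc a b, (Iic r).indicator (H r) s
  rw [setIntegral_indicator measurableSet_Iic, intervalIntegral.integral_of_le hr.1.le,
    Ioc_inter_Iic, min_eq_right hr.2]

lemma intervalIntegral_eq_setIntegral_indicator_right {s : ℝ} (hs : s ∈ Ioc a b) :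
    ∫ r in s..b, H r s
      = ∫ r in Ioc a b, {p : ℝ × ℝ | p.2 ≤ p.1}.indicator (Function.uncurry H) (r, s) := by
  change _ = ∫ r in Ioc a b, (Ici s).indicator (fun r => H r s) r
  have hinter : Ioc a b ∩ Ici s = Icc s b :=
    Subset.antisymm (fun r hr => ⟨hr.2, hr.1.2⟩) fun r hr => ⟨⟨hs.1.trans_le hr.1, hr.2⟩, hr.1⟩
  rw [setIntegral_indicator measurableSet_Ici, hinter, integral_Icc_eq_integral_Ioc,
    intervalIntegral.integral_of_le hs.2]

lemma intervalIntegral_triangle_swap (hab : a ≤ b) (hH : Integrable (Function.uncurry H)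
      ((volume.restrict (Ioc a b)).prod (volume.restrict (Ioc a b)))) :
    IntervalIntegrable (fun r => ∫ s in a..r, H r s) volume a b ∧
      IntervalIntegrable (fun s => ∫ r in s..b, H r s) volume a b ∧
      ∫ r in a..b, ∫ s in a..r, H r s = ∫ s in a..b, ∫ r in s..b, H r s := by
  have hΔ := hH.indicator (measurableSet_le measurable_snd measurable_fst)
  have hleft := fun r => intervalIntegral_eq_setIntegral_indicator_left (H := H) (a := a) (b := b)
    (r := r)
  have hright := fun s => intervalIntegral_eq_setIntegral_indicator_right (H := H) (a := a)
    (b := b) (s := s)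
  refine ⟨(intervalIntegrable_iff_integrableOn_Ioc_of_le hab).2
    ((integrableOn_congr_fun hleft measurableSet_Ioc).2 hΔ.integral_prod_left),
    (intervalIntegrable_iff_integrableOn_Ioc_of_le hab).2
    ((integrableOn_congr_fun hright measurableSet_Ioc).2 hΔ.integral_prod_right), ?_⟩
  rw [intervalIntegral.integral_of_le hab, intervalIntegral.integral_of_le hab,
    setIntegral_congr_fun measurableSet_Ioc hleft, setIntegral_congr_fun measurableSet_Ioc hright]
  exact integral_integral_swap
    (f := fun r s => {p : ℝ × ℝ | p.2 ≤ p.1}.indicator (Function.uncurry H) (r, s)) hΔ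

end Fubini

section SemigroupIntegrability

variable {𝕜 X : Type*} [RCLike 𝕜] [NormedAddCommGroup X] [NormedSpace 𝕜 X] [CompleteSpace X]

namespace C0Semigroup

variable (S : C0Semigroup 𝕜 X)

lemma aestronglyMeasurable_extend_apply {α : Type*} [MeasurableSpace α] {μ : Measure α}
    {a : α → ℝ} {w : α → X} (ha : AEStronglyMeasurable a μ) (hw : AEStronglyMeasurable w μ) :
    AEStronglyMeasurable (fun z => S.extend (a z) (w z)) μ :=
  (S.continuous_extend_apply continuous_fst continuous_snd).comp_aestronglyMeasurable
    (ha.prodMk hw)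

lemma intervalIntegrable_extend_apply {w : ℝ → X} {a b : ℝ}
    (hw : IntervalIntegrable w volume a b) {τ : ℝ → ℝ} (hτ : Continuous τ) :
    IntervalIntegrable (fun r => S.extend (τ r) (w r)) volume a b := by
  obtain ⟨c, hc⟩ := (isCompact_uIcc (a := a) (b := b)).bddAbove_image hτ.continuousOn
  rw [intervalIntegrable_iff] at hw ⊢
  refine (hw.norm.const_mul (S.growthBound c)).mono'
    (S.aestronglyMeasurable_extend_apply hτ.aestronglyMeasurable hw.aestronglyMeasurable) ?_
  filter_upwards [ae_restrict_mem measurableSet_uIoc] with r hr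
  exact S.norm_extend_apply_le (hc (mem_image_of_mem τ (uIoc_subset_uIcc hr))) _

end C0Semigroup

end SemigroupIntegrability

section Duality

open ContinuousLinearMap (adjoint)

variable {𝕜 X : Type*} [RCLike 𝕜] [NormedAddCommGroup X] [InnerProductSpace 𝕜 X]

lemma intervalIntegrable_inner_of_continuous {f g : ℝ → X} {a b : ℝ}
    (hf : IntervalIntegrable f volume a b) (hg : Continuous g) :
    IntervalIntegrable (fun r => inner 𝕜 (f r) (g r)) volume a b := by
  obtain ⟨C, hC⟩ := (isCompact_uIcc (a := a) (b := b)).exists_bound_of_continuousOn hg.continuousOn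
  rw [intervalIntegrable_iff] at hf ⊢
  refine (hf.norm.mul_const C).mono' (hf.aestronglyMeasurable.inner hg.aestronglyMeasurable) ?_
  filter_upwards [ae_restrict_mem measurableSet_uIoc] with r hr
  exact (norm_inner_le_norm _ _).trans (by gcongr; exact hC r (uIoc_subset_uIcc hr))

variable [CompleteSpace X]

lemma C0Semigroup.integrable_inner_extend_sub (S : C0Semigroup 𝕜 X) {w Q : ℝ → X} {a b : ℝ}
    (hQ : IntegrableOn Q (Ioc a b)) (hw : IntegrableOn w (Ioc a b)) :
    Integrable (Function.uncurry fun r s => inner 𝕜 (Q r) (S.extend (r - s) (w s)))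
      ((volume.restrict (Ioc a b)).prod (volume.restrict (Ioc a b))) := by
  refine ((hQ.norm.mul_prod hw.norm).const_mul (S.growthBound (b - a))).mono' ?_ ?_
  · exact hQ.aestronglyMeasurable.comp_fst.inner
      (S.aestronglyMeasurable_extend_apply (by fun_prop) hw.aestronglyMeasurable.comp_snd)
  rw [Measure.prod_restrict]
  filter_upwards [ae_restrict_mem (measurableSet_Ioc.prod measurableSet_Ioc)] with p hp
  calc ‖inner 𝕜 (Q p.1) (S.extend (p.1 - p.2) (w p.2))‖
      ≤ ‖Q p.1‖ * ‖S.extend (p.1 - p.2) (w p.2)‖ := norm_inner_le_norm _ _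
    _ ≤ ‖Q p.1‖ * (S.growthBound (b - a) * ‖w p.2‖) := by
      gcongr
      exact S.norm_extend_apply_le (by linarith [hp.1.2, hp.2.1]) _
    _ = S.growthBound (b - a) * (‖Q p.1‖ * ‖w p.2‖) := by ring

variable [NormedSpace ℝ X]

lemma inner_intervalIntegral_right {f : ℝ → X} {a b : ℝ} (hf : IntervalIntegrable f volume a b)
    (c : X) : inner 𝕜 c (∫ s in a..b, f s) = ∫ s in a..b, inner 𝕜 c (f s) :=
  ((innerSL 𝕜 c).intervalIntegral_comp_comm hf).symm

lemma inner_intervalIntegral_left {f : ℝ → X} {a b : ℝ} (hf : IntervalIntegrable f volume a b)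
    (c : X) : inner 𝕜 (∫ s in a..b, f s) c = ∫ s in a..b, inner 𝕜 (f s) c := by
  rw [← inner_conj_symm, inner_intervalIntegral_right hf,
    intervalIntegral.intervalIntegral_eq_integral_uIoc,
    intervalIntegral.intervalIntegral_eq_integral_uIoc]
  simp only [RCLike.real_smul_eq_coe_mul, map_mul, RCLike.conj_ofReal, ← integral_conj,
    inner_conj_symm]

lemma C0Semigroup.inner_mild_right (S : C0Semigroup 𝕜 X) {w : ℝ → X} {a r : ℝ}
    (hw : IntervalIntegrable w volume a r) (c v : X) :
    inner 𝕜 c (S.extend (r - a) v + ∫ q in a..r, S.extend (r - q) (w q))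
      = inner 𝕜 c (S.extend (r - a) v) + ∫ q in a..r, inner 𝕜 c (S.extend (r - q) (w q)) := by
  rw [inner_add_right,
    inner_intervalIntegral_right (S.intervalIntegrable_extend_apply hw (by fun_prop))]

lemma C0Semigroup.inner_adj_mild_left {S : C0Semigroup 𝕜 X} (hS : S.IsCompactSemigroup)
    {Q : ℝ → X} {r b : ℝ} (hQ : IntervalIntegrable Q volume r b) (c x : X) :
    inner 𝕜 ((S.adj hS).extend (b - r) x + ∫ q in r..b, (S.adj hS).extend (q - r) (Q q)) c
      = inner 𝕜 x (S.extend (b - r) c) + ∫ q in r..b, inner 𝕜 (Q q) (S.extend (q - r) c) := by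
  rw [inner_add_left, inner_intervalIntegral_left
    ((S.adj hS).intervalIntegrable_extend_apply hQ (by fun_prop))]
  simp only [adj_extend, ContinuousLinearMap.adjoint_inner_left]

/- Insert both variation of constants formulas: the double integrals that arise are equal by the
Fubini theorem on the triangle `s ≤ r`. -/
lemma inner_add_integral_inner_mild_eq {S : C0Semigroup 𝕜 X} (hS : S.IsCompactSemigroup) {a b : ℝ}
    (hab : a ≤ b) {w Q y P : ℝ → X} {v x : X} (hw : IntervalIntegrable w volume a b)
    (hQ : IntervalIntegrable Q volume a b)
    (hy : ∀ r ∈ Icc a b, y r = S.extend (r - a) v + ∫ q in a..r, S.extend (r - q) (w q))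
    (hP : ∀ r ∈ Icc a b, P r = (S.adj hS).extend (b - r) x
      + ∫ q in r..b, (S.adj hS).extend (q - r) (Q q)) :
    inner 𝕜 x (y b) + ∫ r in a..b, inner 𝕜 (Q r) (y r)
      = inner 𝕜 (P a) v + ∫ r in a..b, inner 𝕜 (P r) (w r) := by
  obtain ⟨hint_left, hint_right, hswap⟩ := intervalIntegral_triangle_swap hab
    (S.integrable_inner_extend_sub ((intervalIntegrable_iff_integrableOn_Ioc_of_le hab).1 hQ)
      ((intervalIntegrable_iff_integrableOn_Ioc_of_le hab).1 hw))
  have hQv : IntervalIntegrable (fun r => inner 𝕜 (Q r) (S.extend (r - a) v)) volume a b :=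
    intervalIntegrable_inner_of_continuous hQ
      (S.continuous_extend_apply (by fun_prop) continuous_const)
  have hxw : IntervalIntegrable (fun r => inner 𝕜 x (S.extend (b - r) (w r))) volume a b := by
    have h := S.intervalIntegrable_extend_apply hw (τ := fun r => b - r) (by fun_prop)
    rw [intervalIntegrable_iff] at h ⊢
    exact h.const_inner x
  have eqQ : ∫ r in a..b, inner 𝕜 (Q r) (y r) = (∫ r in a..b, inner 𝕜 (Q r) (S.extend (r - a) v))
      + ∫ r in a..b, ∫ s in a..r, inner 𝕜 (Q r) (S.extend (r - s) (w s)) := by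
    rw [← intervalIntegral.integral_add hQv hint_left]
    refine intervalIntegral.integral_congr fun r hr => ?_
    have hsub := uIcc_subset_uIcc left_mem_uIcc hr
    rw [uIcc_of_le hab] at hr
    rw [hy r hr, S.inner_mild_right (hw.mono_set hsub)]
  have eqP : ∫ r in a..b, inner 𝕜 (P r) (w r)
      = (∫ r in a..b, inner 𝕜 x (S.extend (b - r) (w r)))
        + ∫ s in a..b, ∫ r in s..b, inner 𝕜 (Q r) (S.extend (r - s) (w s)) := by
    rw [← intervalIntegral.integral_add hxw hint_right]
    refine intervalIntegral.integral_congr fun r hr => ?_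
    have hsub := uIcc_subset_uIcc hr right_mem_uIcc
    rw [uIcc_of_le hab] at hr
    rw [hP r hr, C0Semigroup.inner_adj_mild_left hS (hQ.mono_set hsub)]
  rw [eqQ, eqP, hy b (right_mem_Icc.2 hab), hP a (left_mem_Icc.2 hab), S.inner_mild_right hw,
    C0Semigroup.inner_adj_mild_left hS hQ, hswap]
  ring

end Duality

section AdjointReversed

open ContinuousLinearMap (adjoint)

/-- The time reversal `τ ↦ T - τ` of `[0, T]`. -/
def reflect {T : ℝ} (τ : Icc (0 : ℝ) T) : Icc (0 : ℝ) T :=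
  ⟨T - τ, sub_nonneg.2 τ.2.2, sub_le_self _ τ.2.1⟩

lemma continuous_reflect {T : ℝ} : Continuous (reflect : Icc (0 : ℝ) T → Icc (0 : ℝ) T) := by
  unfold reflect
  fun_prop

variable {𝕜 X : Type*} [RCLike 𝕜] [NormedAddCommGroup X] [InnerProductSpace 𝕜 X] [CompleteSpace X]
  {T : ℝ}

/-- The operator family `τ ↦ G(T - τ)*` of the adjoint equation run backwards in time. -/
def adjointReversed (G : C(Icc 0 T, X →L[𝕜] X)) : C(Icc 0 T, X →L[𝕜] X) where
  toFun τ := adjoint (G (reflect τ))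
  continuous_toFun := (adjoint (𝕜 := 𝕜) (E := X) (F := X)).continuous.comp
    (G.continuous.comp continuous_reflect)

lemma adjointReversed_apply (G : C(Icc 0 T, X →L[𝕜] X)) (τ : Icc 0 T) :
    adjointReversed G τ = adjoint (G (reflect τ)) := rfl

lemma adjointReversed_projIcc (G : C(Icc 0 T, X →L[𝕜] X)) (hT : 0 ≤ T) {r : ℝ}
    (hr : r ∈ Icc 0 T) :
    adjointReversed G (projIcc 0 T hT (T - r)) = adjoint (G (projIcc 0 T hT r)) := by
  rw [projIcc_of_mem hT hr, projIcc_of_mem hT ⟨sub_nonneg.2 hr.2, sub_le_self _ hr.1⟩,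
    adjointReversed_apply]
  congr 2
  exact Subtype.ext (sub_sub_cancel T r)

lemma norm_adjointReversed_le {G : C(Icc 0 T, X →L[𝕜] X)} {L : ℝ} (hG : ‖G‖ ≤ L) :
    ‖adjointReversed G‖ ≤ L := by
  refine (ContinuousMap.norm_le _ ((norm_nonneg G).trans hG)).2 fun τ => ?_
  rw [adjointReversed_apply, LinearIsometryEquiv.norm_map]
  exact (G.norm_coe_le_norm _).trans hG

lemma continuous_adjointReversed {Z : Type*} [TopologicalSpace Z]
    {G : Z → C(Icc 0 T, X →L[𝕜] X)} (hG : Continuous G) :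
    Continuous fun z => adjointReversed (G z) := by
  refine ContinuousMap.continuous_of_continuous_uncurry _ ?_
  refine (adjoint (𝕜 := 𝕜) (E := X) (F := X)).continuous.comp ?_
  exact (hG.comp continuous_fst).eval (continuous_reflect.comp continuous_snd)

variable [NormedSpace ℝ X] [IsScalarTower ℝ 𝕜 X]

lemma evolution_adjointReversed_eq_integral {S : C0Semigroup 𝕜 X} (hS : S.IsCompactSemigroup)
    (hT : 0 ≤ T) (G : C(Icc 0 T, X →L[𝕜] X)) (x : X) {r t : ℝ} (hr : 0 ≤ r) (hrt : r ≤ t)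
    (ht : t ≤ T) :
    evolution (S.adj hS) hT (adjointReversed G) (T - r) (T - t) x
      = (S.adj hS).extend (t - r) x + ∫ q in r..t, (S.adj hS).extend (q - r)
        (adjoint (G (projIcc 0 T hT q))
          (evolution (S.adj hS) hT (adjointReversed G) (T - q) (T - t) x)) := by
  rw [evolution_eq_integral (S.adj hS) hT _ x (by linarith) (by linarith) (by linarith),
    show T - r - (T - t) = t - r by ring, ← intervalIntegral.integral_comp_sub_left]
  congr 1
  refine intervalIntegral.integral_congr fun q hq => ?_
  rw [uIcc_of_le hrt] at hq
  rw [adjointReversed_projIcc G hT ⟨hr.trans hq.1, hq.2.trans ht⟩,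
    show T - r - (T - q) = q - r by ring]

theorem adjoint_evolution {S : C0Semigroup 𝕜 X} (hS : S.IsCompactSemigroup) (hT : 0 ≤ T)
    (G : C(Icc 0 T, X →L[𝕜] X)) {s t : ℝ} (hs : 0 ≤ s) (hst : s ≤ t) (ht : t ≤ T) (x : X) :
    adjoint (evolution S hT G t s) x
      = evolution (S.adj hS) hT (adjointReversed G) (T - s) (T - t) x := by
  refine ext_inner_right 𝕜 fun v => ?_
  rw [ContinuousLinearMap.adjoint_inner_left]
  have hG : Continuous fun r => G (projIcc 0 T hT r) := G.continuous.comp continuous_projIcc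
  have hy : Continuous fun r => evolution S hT G r s v :=
    continuous_evolution_apply S hT continuous_const continuous_id continuous_const
      continuous_const
  have hP : Continuous fun r =>
      evolution (S.adj hS) hT (adjointReversed G) (T - r) (T - t) x :=
    continuous_evolution_apply (S.adj hS) hT continuous_const (by fun_prop) continuous_const
      continuous_const
  have hQ := ((adjoint (𝕜 := 𝕜) (E := X) (F := X)).continuous.comp hG).clm_apply hP
  have hdual := inner_add_integral_inner_mild_eq hS hst ((hG.clm_apply hy).intervalIntegrable s t)
    (hQ.intervalIntegrable s t)
    (fun r hr => evolution_eq_integral S hT G v hs hr.1 (hr.2.trans ht))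
    (fun r hr => evolution_adjointReversed_eq_integral hS hT G x (hs.trans hr.1) hr.2 ht)
  simp only [Function.comp_apply, ContinuousLinearMap.adjoint_inner_left] at hdual
  exact add_right_cancel hdual

end AdjointReversed

section VariationOfConstants

variable {𝕜 X : Type*} [RCLike 𝕜] [NormedAddCommGroup X] [NormedSpace 𝕜 X] [CompleteSpace X]
  [NormedSpace ℝ X] [IsScalarTower ℝ 𝕜 X] {T : ℝ}

lemma integral_integral_extend_evolution (S : C0Semigroup 𝕜 X) (hT : 0 ≤ T)
    (G : C(Icc 0 T, X →L[𝕜] X)) {w : ℝ → X} (hw : Continuous w) {t : ℝ} (ht : t ∈ Icc 0 T) :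
    IntervalIntegrable (fun r => S.extend (t - r) (G (projIcc 0 T hT r)
      (∫ s in (0 : ℝ)..r, evolution S hT G r s (w s)))) volume 0 t ∧
    ∫ r in (0 : ℝ)..t, S.extend (t - r) (G (projIcc 0 T hT r)
        (∫ s in (0 : ℝ)..r, evolution S hT G r s (w s)))
      = (∫ s in (0 : ℝ)..t, evolution S hT G t s (w s))
        - ∫ s in (0 : ℝ)..t, S.extend (t - s) (w s) := by
  have hG : Continuous fun r => G (projIcc 0 T hT r) := G.continuous.comp continuous_projIcc
  have hE : Continuous fun p : ℝ × ℝ => evolution S hT G p.1 p.2 (w p.2) :=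
    continuous_evolution_apply S hT continuous_const continuous_fst continuous_snd
      (hw.comp continuous_snd)
  have hH : Continuous (Function.uncurry fun r s =>
      S.extend (t - r) (G (projIcc 0 T hT r) (evolution S hT G r s (w s)))) :=
    S.continuous_extend_apply (by fun_prop) ((hG.comp continuous_fst).clm_apply hE)
  have hinner (r : ℝ) : S.extend (t - r) (G (projIcc 0 T hT r)
      (∫ s in (0 : ℝ)..r, evolution S hT G r s (w s)))
      = ∫ s in (0 : ℝ)..r,
        S.extend (t - r) (G (projIcc 0 T hT r) (evolution S hT G r s (w s))) :=
    ((S.extend (t - r) ∘L G (projIcc 0 T hT r)).intervalIntegral_comp_comm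
      ((hE.comp (Continuous.prodMk_right r)).intervalIntegrable 0 r)).symm
  have houter : ∀ s ∈ uIcc 0 t,
      ∫ r in s..t, S.extend (t - r) (G (projIcc 0 T hT r) (evolution S hT G r s (w s)))
        = evolution S hT G t s (w s) - S.extend (t - s) (w s) := fun s hs => by
    rw [uIcc_of_le ht.1] at hs
    rw [evolution_eq_integral S hT G (w s) hs.1 hs.2 ht.2, add_sub_cancel_left]
  obtain ⟨hint, -, hswap⟩ := intervalIntegral_triangle_swap ht.1
    (integrable_prod_of_continuous hH 0 t)
  simp only [hinner]
  refine ⟨hint, ?_⟩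
  rw [hswap, intervalIntegral.integral_congr houter]
  exact intervalIntegral.integral_sub
    ((hE.comp (Continuous.prodMk_right t)).intervalIntegrable 0 t)
    ((S.continuous_extend_apply (by fun_prop) hw).intervalIntegrable 0 t)

theorem eq_integral_of_eq_evolution (S : C0Semigroup 𝕜 X) (hT : 0 ≤ T)
    (G : C(Icc 0 T, X →L[𝕜] X)) (x₀ : X) {w : ℝ → X} (hw : Continuous w) {y : ℝ → X}
    (hy : ∀ t ∈ Icc 0 T, y t = evolution S hT G t 0 x₀
      + ∫ s in (0 : ℝ)..t, evolution S hT G t s (w s)) {t : ℝ} (ht : t ∈ Icc 0 T) :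
    y t = S.extend t x₀
      + ∫ r in (0 : ℝ)..t, S.extend (t - r) (w r + G (projIcc 0 T hT r) (y r)) := by
  have hGE : Continuous fun r => G (projIcc 0 T hT r) (evolution S hT G r 0 x₀) :=
    (G.continuous.comp continuous_projIcc).clm_apply
      (continuous_evolution_apply S hT continuous_const continuous_id continuous_const
        continuous_const)
  have hw_int := S.intervalIntegrable_extend_apply (hw.intervalIntegrable 0 t)
    (τ := fun r => t - r) (by fun_prop)
  have hGE_int := S.intervalIntegrable_extend_apply (hGE.intervalIntegrable 0 t)
    (τ := fun r => t - r) (by fun_prop)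
  obtain ⟨hint, hfubini⟩ := integral_integral_extend_evolution S hT G hw ht
  have hsplit : ∀ r ∈ uIcc 0 t, S.extend (t - r) (w r + G (projIcc 0 T hT r) (y r))
      = S.extend (t - r) (w r)
        + (S.extend (t - r) (G (projIcc 0 T hT r) (evolution S hT G r 0 x₀))
          + S.extend (t - r) (G (projIcc 0 T hT r)
            (∫ s in (0 : ℝ)..r, evolution S hT G r s (w s)))) := fun r hr => by
    rw [uIcc_of_le ht.1] at hr
    rw [hy r ⟨hr.1, hr.2.trans ht.2⟩]
    simp only [map_add]
  have hhom := evolution_eq_integral S hT G x₀ le_rfl ht.1 ht.2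
  rw [sub_zero] at hhom
  rw [intervalIntegral.integral_congr hsplit, intervalIntegral.integral_add hw_int
    (hGE_int.add hint), intervalIntegral.integral_add hGE_int hint, hfubini, hy t ht, hhom]
  abel

end VariationOfConstants

section Duhamel

variable {𝕜 X : Type*} [RCLike 𝕜] [NormedAddCommGroup X] [NormedSpace 𝕜 X] [NormedSpace ℝ X]
  {w : ℝ → X} {T R : ℝ}

/-- The mild solution `∫₀ᵗ S(t - s) w(s) ds` of `y' = A y + w`, `y(0) = 0`. -/
def duhamel (S : C0Semigroup 𝕜 X) (w : ℝ → X) (t : ℝ) : X :=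
  ∫ s in (0 : ℝ)..t, S.extend (t - s) (w s)

/-- The continuous functions on the line whose values on `[0, T]` have norm at most `R`: the
inhomogeneities of a uniformly bounded family of mild solutions. -/
def boundedForcing (X : Type*) [NormedAddCommGroup X] (T R : ℝ) : Set (ℝ → X) :=
  {w | Continuous w ∧ ∀ s ∈ Icc 0 T, ‖w s‖ ≤ R}

variable [CompleteSpace X] {S : C0Semigroup 𝕜 X}

lemma norm_integral_extend_sub_le (hw : ∀ s ∈ Icc 0 T, ‖w s‖ ≤ R) {a t : ℝ} (ha : 0 ≤ a)
    (hat : a ≤ t) (ht : t ≤ T) :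
    ‖∫ s in a..t, S.extend (t - s) (w s)‖ ≤ S.growthBound T * R * (t - a) := by
  have hK := S.growthBound_pos T
  have h := intervalIntegral.norm_integral_le_of_norm_le_const (a := a) (b := t)
    (f := fun s => S.extend (t - s) (w s)) (C := S.growthBound T * R) fun s hs => by
      rw [uIoc_of_le hat] at hs
      refine (S.norm_extend_apply_le (T := T) (by linarith [hs.1]) _).trans ?_
      gcongr
      exact hw s ⟨ha.trans hs.1.le, hs.2.trans ht⟩
  rwa [abs_of_nonneg (sub_nonneg.2 hat)] at h

lemma norm_duhamel_le (hw : ∀ s ∈ Icc 0 T, ‖w s‖ ≤ R) {t : ℝ} (ht : t ∈ Icc 0 T) :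
    ‖duhamel S w t‖ ≤ S.growthBound T * R * t := by
  simpa only [duhamel, sub_zero] using norm_integral_extend_sub_le (S := S) hw le_rfl ht.1 ht.2

lemma duhamel_eq_extend_sub_add_integral (hw : Continuous w) {s t : ℝ} (hs : 0 ≤ s)
    (hst : s ≤ t) :
    duhamel S w t = S.extend (t - s) (duhamel S w s) + ∫ r in s..t, S.extend (t - r) (w r) := by
  have hint (t a b : ℝ) : IntervalIntegrable (fun r => S.extend (t - r) (w r)) volume a b :=
    S.intervalIntegrable_extend_apply (hw.intervalIntegrable a b) (by fun_prop)
  rw [duhamel, ← intervalIntegral.integral_add_adjacent_intervals (hint t 0 s) (hint t s t),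
    duhamel, ← ContinuousLinearMap.intervalIntegral_comp_comm _ (hint s 0 s)]
  congr 1
  refine intervalIntegral.integral_congr fun r hr => ?_
  rw [uIcc_of_le hs] at hr
  rw [← S.extend_add_apply (sub_nonneg.2 hst) (sub_nonneg.2 hr.2), sub_add_sub_cancel]

/- For `t ≥ δ` the vector `b` is the solution at time `t - δ`; for `t ≤ δ` take `b = 0`. -/
lemma exists_norm_duhamel_sub_extend_le (hT : 0 ≤ T) (hw : w ∈ boundedForcing X T R) {δ t : ℝ}
    (hδ : 0 ≤ δ) (ht : t ∈ Icc 0 T) :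
    ∃ b ∈ Metric.closedBall 0 (S.growthBound T * R * T),
      ‖duhamel S w t - S.extend δ b‖ ≤ S.growthBound T * R * δ := by
  have hK := S.growthBound_pos T
  have hR : 0 ≤ R := (norm_nonneg _).trans (hw.2 t ht)
  rcases le_total t δ with h | h
  · refine ⟨0, Metric.mem_closedBall_self (by positivity), ?_⟩
    rw [map_zero, sub_zero]
    exact (norm_duhamel_le hw.2 ht).trans (by gcongr)
  · have ht' : t - δ ∈ Icc 0 T := ⟨sub_nonneg.2 h, by linarith [ht.2]⟩
    refine ⟨duhamel S w (t - δ), mem_closedBall_zero_iff.2 ?_, ?_⟩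
    · refine (norm_duhamel_le hw.2 ht').trans ?_
      gcongr
      exact ht'.2
    · rw [duhamel_eq_extend_sub_add_integral hw.1 ht'.1 (sub_le_self t hδ), sub_sub_cancel,
        add_sub_cancel_left]
      simpa only [sub_sub_cancel] using
        norm_integral_extend_sub_le (S := S) hw.2 ht'.1 (sub_le_self t hδ) ht.2

variable (hS : ∀ t > 0, IsCompactOperator (S.op t)) (hT : 0 ≤ T)

include hS hT

lemma totallyBounded_image2_duhamel :
    TotallyBounded (image2 (duhamel S) (boundedForcing X T R) (Icc 0 T)) := by
  have := S.growthBound_pos T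
  rw [Metric.totallyBounded_iff]
  intro ε hε
  obtain ⟨δ, hδ, hδε⟩ := exists_pos_mul_lt (half_pos hε) (S.growthBound T * R)
  have hball : TotallyBounded
      (S.extend δ '' Metric.closedBall (0 : X) (S.growthBound T * R * T)) := by
    rw [S.extend_of_nonneg hδ.le]
    exact ((hS δ hδ).isCompact_closure_image_closedBall (f := (S.op δ : X →ₗ[𝕜] X))
      _).totallyBounded.subset subset_closure
  obtain ⟨N, hN, hcover⟩ := Metric.totallyBounded_iff.1 hball (ε / 2) (half_pos hε)
  refine ⟨N, hN, ?_⟩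
  rintro _ ⟨w, hw, t, ht, rfl⟩
  obtain ⟨b, hb, hbt⟩ := exists_norm_duhamel_sub_extend_le (S := S) hT hw hδ.le ht
  obtain ⟨c, hc, hbc⟩ := mem_iUnion₂.1 (hcover (mem_image_of_mem _ hb))
  refine mem_iUnion₂.2 ⟨c, hc, ?_⟩
  rw [Metric.mem_ball, dist_eq_norm] at hbc ⊢
  linarith [norm_sub_le_norm_sub_add_norm_sub (duhamel S w t) (S.extend δ b) c]

/- `duhamel S w t - duhamel S w s` is `(S(t - s) - 1) (duhamel S w s)` plus an integral over
`[s, t]`, and `S(t - s) → 1` uniformly on the relatively compact set of values of `duhamel`. -/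
lemma exists_forall_norm_duhamel_sub_lt {ε : ℝ} (hε : 0 < ε) :
    ∃ η > 0, ∀ w ∈ boundedForcing X T R, ∀ s ∈ Icc 0 T, ∀ t ∈ Icc 0 T, s ≤ t → t - s < η →
      ‖duhamel S w t - duhamel S w s‖ < ε := by
  have hK := S.growthBound_pos T
  obtain ⟨η₁, hη₁, hsemigroup⟩ := Metric.eventually_nhds_iff.1
    (S.eventually_forall_norm_extend_sub_lt ((totallyBounded_image2_duhamel hS
      hT).closure.isCompact_of_isClosed isClosed_closure) 0 (half_pos hε))
  obtain ⟨η₂, hη₂, hη₂ε⟩ := exists_pos_mul_lt (half_pos hε) (S.growthBound T * R)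
  refine ⟨min η₁ η₂, lt_min hη₁ hη₂, fun w hw s hs t ht hst hlt => ?_⟩
  have hfirst : ‖S.extend (t - s) (duhamel S w s) - duhamel S w s‖ < ε / 2 := by
    have h := hsemigroup (y := t - s) (by
      rw [dist_zero_right, Real.norm_of_nonneg (sub_nonneg.2 hst)]
      exact hlt.trans_le (min_le_left _ _)) _ (subset_closure (mem_image2_of_mem hw hs))
    simpa using h
  have hR : 0 ≤ R := (norm_nonneg _).trans (hw.2 s hs)
  have hsecond : ‖∫ r in s..t, S.extend (t - r) (w r)‖ < ε / 2 :=
    calc ‖∫ r in s..t, S.extend (t - r) (w r)‖ ≤ S.growthBound T * R * (t - s) :=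
          norm_integral_extend_sub_le hw.2 hs.1 hst ht.2
      _ ≤ S.growthBound T * R * η₂ := by gcongr; exact hlt.le.trans (min_le_right _ _)
      _ < ε / 2 := hη₂ε
  rw [duhamel_eq_extend_sub_add_integral hw.1 hs.1 hst, add_sub_right_comm]
  linarith [norm_add_le (S.extend (t - s) (duhamel S w s) - duhamel S w s)
    (∫ r in s..t, S.extend (t - r) (w r))]

theorem isCompact_closure_setOf_eq_duhamel :
    IsCompact (closure
      {φ : C(Icc 0 T, X) | ∃ w ∈ boundedForcing X T R, ∀ t, φ t = duhamel S w t}) := by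
  have : T2Space (UniformOnFun (Icc 0 T) X {K | IsCompact K}) :=
    UniformOnFun.t2Space_of_covering (sUnion_eq_univ_iff.2 fun t => ⟨{t}, isCompact_singleton, rfl⟩)
  refine ArzelaAscoli.isCompact_closure_of_isClosedEmbedding (𝔖 := {K | IsCompact K})
    (F := fun φ : C(Icc 0 T, X) => ⇑φ) (fun K hK => hK)
    ContinuousMap.isUniformEmbedding_toUniformOnFunIsCompact.isClosedEmbedding
    (fun K _ => Equicontinuous.equicontinuousOn (UniformEquicontinuous.equicontinuous ?_) K)
    fun K _ t _ => ⟨_, (totallyBounded_image2_duhamel (R := R) hS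
      hT).closure.isCompact_of_isClosed isClosed_closure, ?_⟩
  · rw [Metric.uniformEquicontinuous_iff]
    intro ε hε
    obtain ⟨η, hη, hmod⟩ := exists_forall_norm_duhamel_sub_lt hS hT hε
    refine ⟨η, hη, ?_⟩
    rintro s t hst ⟨φ, w, hw, hφ⟩
    rw [Subtype.dist_eq, Real.dist_eq] at hst
    change dist (φ s) (φ t) < ε
    rw [hφ, hφ]
    rcases le_total (s : ℝ) t with hle | hle
    · rw [dist_comm, dist_eq_norm]
      exact hmod w hw s s.2 t t.2 hle ((le_abs_self _).trans_lt (by rwa [abs_sub_comm]))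
    · rw [dist_eq_norm]
      exact hmod w hw t t.2 s s.2 hle ((le_abs_self _).trans_lt hst)
  · rintro φ ⟨w, hw, hφ⟩
    rw [hφ t]
    exact subset_closure (mem_image2_of_mem hw t.2)

end Duhamel

section WeakLimits

lemma exists_tendsto_hyperfilter {α : Type*} [TopologicalSpace α] {K : Set α} (hK : IsCompact K)
    {u : ℕ → α} (hu : ∀ n, u n ∈ K) : ∃ x ∈ K, Tendsto u (hyperfilter ℕ) (𝓝 x) :=
  hK.ultrafilter_le_nhds ((hyperfilter ℕ).map u)
    (le_principal_iff.2 (mem_map.2 (Eventually.of_forall hu)))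

lemma exists_tendsto_inner_hyperfilter {𝕜 H : Type*} [RCLike 𝕜] [NormedAddCommGroup H]
    [InnerProductSpace 𝕜 H] [CompleteSpace H] {u : ℕ → H} {C : ℝ} (hu : ∀ n, ‖u n‖ ≤ C) :
    ∃ q : H, ∀ φ : H, Tendsto (fun n => inner 𝕜 (u n) φ) (hyperfilter ℕ) (𝓝 (inner 𝕜 q φ)) := by
  obtain ⟨l, -, hl⟩ := exists_tendsto_hyperfilter
    (WeakDual.isCompact_closedBall (𝕜 := 𝕜) (E := H) 0 C)
    (u := fun n => StrongDual.toWeakDual (InnerProductSpace.toDual 𝕜 H (u n))) (fun n => by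
      rw [mem_preimage, mem_closedBall_zero_iff]
      exact ((InnerProductSpace.toDual 𝕜 H).norm_map (u n)).trans_le (hu n))
  refine ⟨(InnerProductSpace.toDual 𝕜 H).symm (WeakDual.toStrongDual l), fun φ => ?_⟩
  rw [InnerProductSpace.toDual_symm_apply]
  exact ((WeakDual.eval_continuous φ).tendsto l).comp hl

variable {𝕜 X : Type*} [RCLike 𝕜] [NormedAddCommGroup X] [InnerProductSpace 𝕜 X]
  {ι α : Type*} {l : Filter ι} [MeasurableSpace α] {μ : Measure α}

variable (𝕜) in
/-- Weak convergence of `Q n` to `q` in `L²(μ; X)`, tested against honest functions so that no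
passage to equivalence classes is needed. -/
def TendstoWeaklyL2 (Q : ι → α → X) (l : Filter ι) (q : α → X) (μ : Measure α) : Prop :=
  ∀ φ : α → X, MemLp φ 2 μ →
    Tendsto (fun n => ∫ s, inner 𝕜 (Q n s) (φ s) ∂μ) l (𝓝 (∫ s, inner 𝕜 (q s) (φ s) ∂μ))

lemma TendstoWeaklyL2.congr_ae {Q : ι → α → X} {q q' : α → X} (h : TendstoWeaklyL2 𝕜 Q l q μ)
    (hq : q =ᵐ[μ] q') : TendstoWeaklyL2 𝕜 Q l q' μ := fun φ hφ => by
  have hcongr : ∫ s, inner 𝕜 (q s) (φ s) ∂μ = ∫ s, inner 𝕜 (q' s) (φ s) ∂μ :=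
    integral_congr_ae (hq.mono fun s hs => congrArg (inner 𝕜 · (φ s)) hs)
  exact hcongr ▸ h φ hφ

lemma TendstoWeaklyL2.ae_norm_le [l.NeBot] [IsFiniteMeasure μ] {Q : ι → α → X} {q : α → X}
    (h : TendstoWeaklyL2 𝕜 Q l q μ) (hq : MemLp q 2 μ) {m : α → ℝ} (hm : MemLp m 2 μ)
    (hm0 : ∀ s, 0 ≤ m s) {d : ι → ℝ} (hd : Tendsto d l (𝓝 0))
    (hQ : ∀ n, ∀ᵐ s ∂μ, ‖Q n s‖ ≤ m s + d n) : ∀ᵐ s ∂μ, ‖q s‖ ≤ m s := by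
  have hmq : Integrable (fun s => m s * ‖q s‖) μ := hm.integrable_mul hq.norm
  have hqI : Integrable (fun s => ‖q s‖) μ := (hq.integrable one_le_two).norm
  have hqq : Integrable (fun s => ‖q s‖ ^ 2) μ := hq.integrable_norm_pow two_ne_zero
  suffices hsq : (fun s => ‖q s‖ ^ 2) ≤ᵐ[μ] fun s => m s * ‖q s‖ by
    filter_upwards [hsq] with s hs
    rcases (norm_nonneg (q s)).eq_or_lt with h0 | h0
    · exact h0 ▸ hm0 s
    · exact le_of_mul_le_mul_right (by rwa [← sq]) h0
  refine ae_le_of_forall_setIntegral_le hqq hmq fun A hA _ => ?_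
  have hpair (k : α → X) : ∫ s, inner 𝕜 (k s) (A.indicator q s) ∂μ
      = ∫ s in A, inner 𝕜 (k s) (q s) ∂μ := by
    rw [← integral_indicator hA]
    congr 1 with s
    by_cases hs : s ∈ A <;> simp [hs]
  have hbound (n : ι) : ‖∫ s in A, inner 𝕜 (Q n s) (q s) ∂μ‖
      ≤ ∫ s in A, m s * ‖q s‖ ∂μ + d n * ∫ s in A, ‖q s‖ ∂μ := by
    rw [← integral_const_mul, ← integral_add hmq.integrableOn (hqI.integrableOn.const_mul _)]
    refine norm_integral_le_of_norm_le (hmq.integrableOn.add (hqI.integrableOn.const_mul _)) ?_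
    filter_upwards [ae_restrict_of_ae (hQ n)] with s hs
    rw [← add_mul]
    exact (norm_inner_le_norm _ _).trans (by gcongr)
  have hlim := (h _ (hq.indicator hA)).norm
  simp only [hpair, inner_self_eq_norm_sq_to_K] at hlim
  norm_cast at hlim
  rw [abs_of_nonneg (integral_nonneg fun _ => by positivity)] at hlim
  refine le_of_tendsto_of_tendsto hlim ?_ (Eventually.of_forall hbound)
  simpa using (hd.mul_const (∫ s in A, ‖q s‖ ∂μ)).const_add (∫ s in A, m s * ‖q s‖ ∂μ)

variable [CompleteSpace X]

lemma exists_tendstoWeaklyL2 [IsFiniteMeasure μ] {Q : ℕ → α → X} {R : ℝ}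
    (hQ : ∀ n, AEStronglyMeasurable (Q n) μ) (hQR : ∀ n, ∀ᵐ s ∂μ, ‖Q n s‖ ≤ R) :
    ∃ q : α → X, StronglyMeasurable q ∧ MemLp q 2 μ ∧ TendstoWeaklyL2 𝕜 Q (hyperfilter ℕ) q μ := by
  have hQL (n : ℕ) : MemLp (Q n) 2 μ := MemLp.of_bound (hQ n) R (hQR n)
  have hbound (n : ℕ) : ‖(hQL n).toLp (Q n)‖
      ≤ (measureUnivNNReal μ : ℝ) ^ (2 : ENNReal).toReal⁻¹ * |R| := by
    refine Lp.norm_le_of_ae_bound (abs_nonneg R) ?_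
    filter_upwards [(hQL n).coeFn_toLp, hQR n] with s hs hsR
    exact hs ▸ hsR.trans (le_abs_self R)
  obtain ⟨q, hq⟩ := exists_tendsto_inner_hyperfilter (𝕜 := 𝕜) hbound
  refine ⟨q, Lp.stronglyMeasurable q, Lp.memLp q, fun φ hφ => ?_⟩
  have hpair {k : α → X} (hk : MemLp k 2 μ) :
      inner 𝕜 (hk.toLp k) (hφ.toLp φ) = ∫ s, inner 𝕜 (k s) (φ s) ∂μ := by
    rw [L2.inner_def]
    refine integral_congr_ae ?_
    filter_upwards [hk.coeFn_toLp, hφ.coeFn_toLp] with s hks hφs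
    rw [hks, hφs]
  simpa only [hpair, Lp.toLp_coeFn, ← hpair (Lp.memLp q)] using hq (hφ.toLp φ)

/- The almost everywhere bound on the weak limit is made to hold everywhere by changing the limit
on a null set. -/
lemma exists_tendstoWeaklyL2_norm_le [IsFiniteMeasure μ] {Q : ℕ → α → X} {R : ℝ}
    (hQ : ∀ n, AEStronglyMeasurable (Q n) μ) (hQR : ∀ n, ∀ᵐ s ∂μ, ‖Q n s‖ ≤ R)
    {m : α → ℝ} (hm : Measurable m) (hmL : MemLp m 2 μ) (hm0 : ∀ s, 0 ≤ m s) {d : ℕ → ℝ}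
    (hd : Tendsto d (hyperfilter ℕ) (𝓝 0)) (hQm : ∀ n, ∀ᵐ s ∂μ, ‖Q n s‖ ≤ m s + d n) :
    ∃ q : α → X, StronglyMeasurable q ∧ (∀ s, ‖q s‖ ≤ m s) ∧
      TendstoWeaklyL2 𝕜 Q (hyperfilter ℕ) q μ := by
  obtain ⟨q, hq, hqL, hlim⟩ := exists_tendstoWeaklyL2 (𝕜 := 𝕜) hQ hQR
  set A : Set α := {s | ‖q s‖ ≤ m s}
  have hAm : MeasurableSet A := measurableSet_le hq.norm.measurable hm
  refine ⟨A.indicator q, hq.indicator hAm, fun s => ?_, hlim.congr_ae ?_⟩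
  · by_cases hs : s ∈ A
    · rwa [indicator_of_mem hs]
    · rw [indicator_of_notMem hs, norm_zero]
      exact hm0 s
  · filter_upwards [hlim.ae_norm_le hqL hmL hm0 hd hQm] with s hs
    exact (indicator_of_mem (show s ∈ A from hs) q).symm

end WeakLimits

section WeakLimitsOfMildSolutions

variable {𝕜 X : Type*} [RCLike 𝕜] [NormedAddCommGroup X] [InnerProductSpace 𝕜 X] [CompleteSpace X]
  [NormedSpace ℝ X] {S : C0Semigroup 𝕜 X} {T : ℝ}

lemma integral_inner_indicator_adj_extend (hS : S.IsCompactSemigroup) {k : ℝ → X}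
    (hk : IntegrableOn k (Ioc 0 T)) {t : ℝ} (ht : t ∈ Icc 0 T) (v : X) :
    ∫ s in Ioc 0 T, inner 𝕜 (k s) ((Ioc 0 t).indicator (fun s => (S.adj hS).extend (t - s) v) s)
      = inner 𝕜 (duhamel S k t) v := by
  have hk' : IntervalIntegrable k volume 0 t :=
    (intervalIntegrable_iff_integrableOn_Ioc_of_le ht.1).2
      (hk.mono_set (Ioc_subset_Ioc_right ht.2))
  have hind : (fun s => inner 𝕜 (k s) ((Ioc 0 t).indicator
        (fun s => (S.adj hS).extend (t - s) v) s))
      = (Ioc 0 t).indicator fun s => inner 𝕜 (S.extend (t - s) (k s)) v := by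
    funext s
    by_cases hs : s ∈ Ioc 0 t
    · rw [indicator_of_mem hs, indicator_of_mem hs, S.adj_extend hS,
        ContinuousLinearMap.adjoint_inner_right]
    · rw [indicator_of_notMem hs, indicator_of_notMem hs, inner_zero_right]
  rw [hind, setIntegral_indicator measurableSet_Ioc, inter_eq_right.2 (Ioc_subset_Ioc_right ht.2),
    duhamel, inner_intervalIntegral_left (S.intervalIntegrable_extend_apply hk' (by fun_prop)),
    intervalIntegral.integral_of_le ht.1]

lemma TendstoWeaklyL2.tendsto_inner_duhamel (hS : S.IsCompactSemigroup) {ι : Type*} {l : Filter ι}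
    {Q : ι → ℝ → X} {q : ℝ → X} (h : TendstoWeaklyL2 𝕜 Q l q (volume.restrict (Ioc 0 T)))
    (hQ : ∀ n, IntegrableOn (Q n) (Ioc 0 T)) (hq : IntegrableOn q (Ioc 0 T)) {t : ℝ}
    (ht : t ∈ Icc 0 T) (v : X) :
    Tendsto (fun n => inner 𝕜 (duhamel S (Q n) t) v) l (𝓝 (inner 𝕜 (duhamel S q t) v)) := by
  have hφ : MemLp ((Ioc 0 t).indicator fun s => (S.adj hS).extend (t - s) v) 2
      (volume.restrict (Ioc 0 T)) := by
    refine MemLp.indicator measurableSet_Ioc (MemLp.of_bound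
      ((S.adj hS).continuous_extend_apply (by fun_prop) continuous_const).aestronglyMeasurable
      ((S.adj hS).growthBound T * ‖v‖) ?_)
    filter_upwards [ae_restrict_mem measurableSet_Ioc] with s hs
    exact (S.adj hS).norm_extend_apply_le (by linarith [hs.1, ht.2]) v
  simpa only [integral_inner_indicator_adj_extend hS (hQ _) ht,
    integral_inner_indicator_adj_extend hS hq ht] using h _ hφ

end WeakLimitsOfMildSolutions

section Transfer

open InnerProductSpace

variable {𝕜 X : Type*} [RCLike 𝕜] [NormedAddCommGroup X] [InnerProductSpace 𝕜 X] {p q : X}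

variable (𝕜) in
/-- The rank-one operator of norm `‖q‖ / ‖p‖` that sends `p` to `q`. It exhibits a forcing term
dominated by a trajectory as a bounded perturbation of that trajectory. -/
def transferOperator (p q : X) : X →L[𝕜] X :=
  ((‖p‖ : 𝕜) ^ 2)⁻¹ • rankOne 𝕜 q p

lemma transferOperator_apply_self (h : p = 0 → q = 0) : transferOperator 𝕜 p q p = q := by
  rcases eq_or_ne p 0 with hp | hp
  · rw [hp, h hp, map_zero]
  · have hp' : ((‖p‖ : 𝕜) ^ 2) ≠ 0 := by simpa using hp
    rw [transferOperator, smul_apply, rankOne_apply, inner_self_eq_norm_sq_to_K,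
      inv_smul_smul₀ hp']

lemma norm_transferOperator_le {L : ℝ} (hL : 0 ≤ L) (h : ‖q‖ ≤ L * ‖p‖) :
    ‖transferOperator 𝕜 p q‖ ≤ L := by
  rw [transferOperator, norm_smul, norm_rankOne, norm_inv, norm_pow, RCLike.norm_ofReal, abs_norm]
  refine inv_mul_le_of_le_mul₀ (sq_nonneg _) hL ?_
  calc ‖q‖ * ‖p‖ ≤ L * ‖p‖ * ‖p‖ := by gcongr
    _ = ‖p‖ ^ 2 * L := by ring

lemma stronglyMeasurable_transferOperator {α : Type*} [MeasurableSpace α] {p q : α → X}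
    (hp : StronglyMeasurable p) (hq : StronglyMeasurable q) :
    StronglyMeasurable fun s => transferOperator 𝕜 (p s) (q s) := by
  have hnorm : StronglyMeasurable fun s => ((‖p s‖ : 𝕜) ^ 2)⁻¹ :=
    (((RCLike.continuous_ofReal.measurable.comp hp.norm.measurable).pow_const 2).inv
      ).stronglyMeasurable
  have hrank : Continuous fun r : X × X => rankOne 𝕜 r.2 r.1 := by
    simp only [rankOne_def]
    fun_prop
  exact hnorm.smul (hrank.comp_stronglyMeasurable (hp.prodMk hq))

end Transfer

section Trajectories

variable {𝕜 X : Type*} [RCLike 𝕜] [NormedAddCommGroup X] [NormedSpace 𝕜 X]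

lemma intervalIntegrable_clm_apply {G : ℝ → X →L[𝕜] X} {T L : ℝ}
    (hG : StronglyMeasurable G) (hGL : ∀ s, ‖G s‖ ≤ L) {z : ℝ → X} (hT : 0 ≤ T)
    (hz : ContinuousOn z (Icc 0 T)) :
    IntervalIntegrable (fun s => G s (z s)) volume 0 T := by
  rw [intervalIntegrable_iff_integrableOn_Icc_of_le hT]
  have happ : Continuous fun r : (X →L[𝕜] X) × X => r.1 r.2 := by fun_prop
  obtain ⟨C, hC⟩ := isCompact_Icc.exists_bound_of_continuousOn hz
  refine Integrable.of_bound (happ.comp_aestronglyMeasurable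
    (hG.aestronglyMeasurable.prodMk (hz.aestronglyMeasurable measurableSet_Icc))) (L * C) ?_
  filter_upwards [ae_restrict_mem measurableSet_Icc] with s hs
  exact (G s).le_of_opNorm_le_of_le (hGL s) (hC s hs)

lemma duhamel_sub_eq_integral [NormedSpace ℝ X] (S : C0Semigroup 𝕜 X) (q : ℝ → X)
    (T r : ℝ) :
    duhamel S q (T - r) = ∫ s in r..T, S.extend (s - r) (q (T - s)) := by
  have h := intervalIntegral.integral_comp_sub_left
    (f := fun σ => S.extend (T - r - σ) (q σ)) (a := r) (b := T) T
  rw [sub_self] at h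
  rw [duhamel, ← h]
  refine intervalIntegral.integral_congr fun s _ => ?_
  simp only [show T - r - (T - s) = s - r by ring]

end Trajectories

section Unobservability

open ContinuousLinearMap

variable {𝕜 X W : Type*} [RCLike 𝕜]
  [NormedAddCommGroup X] [InnerProductSpace 𝕜 X] [NormedSpace ℝ X] [CompleteSpace X]
  [NormedAddCommGroup W] [InnerProductSpace 𝕜 W] [CompleteSpace W]
  {S : C0Semigroup 𝕜 X} {B : W →L[𝕜] X} {G : ℝ → X →L[𝕜] X} {T L : ℝ} {p : ℝ → X} {x : X}

lemma inner_eq_zero_of_isLinearMildSolution (hS : S.IsCompactSemigroup) (hT : 0 ≤ T)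
    (hG : StronglyMeasurable G) (hGL : ∀ s, ‖G s‖ ≤ L) (hp : Continuous p)
    (hpx : ∀ r ∈ Icc 0 T, p r = (S.adj hS).extend (T - r) x
      + ∫ s in r..T, (S.adj hS).extend (s - r) (adjoint (G s) (p s)))
    (hB : ∀ s ∈ Icc 0 T, adjoint B (p s) = 0) {u : ℝ → W}
    (hu : MemLp u 2 (volume.restrict (Icc 0 T))) {y : ℝ → X}
    (hy : IsLinearMildSolution S B T G 0 u y) : inner 𝕜 x (y T) = 0 := by
  have hBu : IntervalIntegrable (fun s => B (u s)) volume 0 T :=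
    (intervalIntegrable_iff_integrableOn_Icc_of_le hT).2
      (B.integrable_comp (hu.integrable one_le_two))
  have hGp : IntervalIntegrable (fun s => adjoint (G s) (p s)) volume 0 T :=
    intervalIntegrable_clm_apply
      ((adjoint (𝕜 := 𝕜) (E := X) (F := X)).continuous.comp_stronglyMeasurable hG)
      (fun s => ((adjoint (𝕜 := 𝕜) (E := X) (F := X)).norm_map (G s)).trans_le (hGL s)) hT
      hp.continuousOn
  have hdual := inner_add_integral_inner_mild_eq hS hT
    (hBu.add (intervalIntegrable_clm_apply hG hGL hT hy.1)) hGp (y := y) (v := 0) (fun r hr => by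
      rw [hy.2 r hr, map_zero, map_zero]
      congr 1
      refine intervalIntegral.integral_congr fun s hs => ?_
      rw [uIcc_of_le hr.1] at hs
      simp only [S.extend_of_nonneg (sub_nonneg.2 hs.2)]) hpx
  rw [inner_zero_right, zero_add] at hdual
  refine add_eq_right.1 (hdual.trans (intervalIntegral.integral_congr fun s hs => ?_))
  rw [uIcc_of_le hT] at hs
  simp only [inner_add_right, adjoint_inner_left]
  rw [← adjoint_inner_left B, hB s hs, inner_zero_left, zero_add]

lemma IsApproxControllable.eq_zero_of_adjoint_eq_zero (hAC : IsApproxControllable S B T G)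
    (hS : S.IsCompactSemigroup) (hT : 0 ≤ T)
    (hG : StronglyMeasurable G) (hGL : ∀ s, ‖G s‖ ≤ L) (hp : Continuous p)
    (hpx : ∀ r ∈ Icc 0 T, p r = (S.adj hS).extend (T - r) x
      + ∫ s in r..T, (S.adj hS).extend (s - r) (adjoint (G s) (p s)))
    (hB : ∀ s ∈ Icc 0 T, adjoint B (p s) = 0) : x = 0 := by
  by_contra hx
  obtain ⟨u, hu, y, hy, hyx⟩ := hAC 0 x ‖x‖ (norm_pos_iff.2 hx)
  have horth := inner_eq_zero_of_isLinearMildSolution hS hT hG hGL hp hpx hB hu hy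
  refine hyx.not_ge (le_of_mul_le_mul_left ?_ (norm_pos_iff.2 hx))
  calc ‖x‖ * ‖x‖ = ‖inner 𝕜 x (y T - x)‖ := by
        rw [inner_sub_right, horth, zero_sub, norm_neg, inner_self_eq_norm_sq_to_K,
          norm_pow, RCLike.norm_ofReal, abs_norm, sq]
    _ ≤ ‖x‖ * ‖y T - x‖ := norm_inner_le_norm _ _

/- Running the trajectory backwards, its forcing term becomes the adjoint of a bounded perturbation,
and controllability of the perturbed system applies. -/
theorem eq_zero_of_unobservable (hS : S.IsCompactSemigroup) (hT : 0 ≤ T) (hL : 0 ≤ L)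
    (hAC : ∀ G : ℝ → X →L[𝕜] X, StronglyMeasurable G → (∀ s, ‖G s‖ ≤ L) →
      IsApproxControllable S B T G)
    {z q : ℝ → X} (hz : Continuous z) (hq : StronglyMeasurable q)
    (hzx : ∀ t ∈ Icc 0 T, z t = (S.adj hS).extend t x + duhamel (S.adj hS) q t)
    (hqz : ∀ s, ‖q s‖ ≤ L * ‖z s‖) (hB : ∀ s ∈ Icc 0 T, adjoint B (z s) = 0) : x = 0 := by
  have hmem {r : ℝ} (hr : r ∈ Icc 0 T) : T - r ∈ Icc 0 T :=
    ⟨sub_nonneg.2 hr.2, sub_le_self _ hr.1⟩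
  have htransfer (s : ℝ) : transferOperator 𝕜 (z s) (q s) (z s) = q s :=
    transferOperator_apply_self fun h => by simpa [h] using hqz s
  set K : ℝ → X →L[𝕜] X := fun s => transferOperator 𝕜 (z (T - s)) (q (T - s))
  have hK : StronglyMeasurable K := (stronglyMeasurable_transferOperator hz.stronglyMeasurable
    hq).comp_measurable (measurable_const.sub measurable_id)
  have hKL (s : ℝ) : ‖K s‖ ≤ L := norm_transferOperator_le hL (hqz _)
  have hK' : StronglyMeasurable fun s => adjoint (K s) :=
    (adjoint (𝕜 := 𝕜) (E := X) (F := X)).continuous.comp_stronglyMeasurable hK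
  have hKL' (s : ℝ) : ‖adjoint (K s)‖ ≤ L :=
    ((adjoint (𝕜 := 𝕜) (E := X) (F := X)).norm_map (K s)).trans_le (hKL s)
  refine (hAC _ hK' hKL').eq_zero_of_adjoint_eq_zero hS hT hK' hKL' (p := fun s => z (T - s))
    (by fun_prop) (fun r hr => ?_) fun s hs => hB _ (hmem hs)
  simp only [adjoint_adjoint, K, htransfer]
  rw [hzx _ (hmem hr), duhamel_sub_eq_integral]

end Unobservability

section LinearTrajectories

variable {𝕜 X : Type*} [RCLike 𝕜] [NormedAddCommGroup X] [NormedSpace 𝕜 X] {T : ℝ}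

/-- The inhomogeneity `τ ↦ G(τ) z(τ)`, extended to the line by its values at `0` and `T`. -/
def perturbation (hT : 0 ≤ T) (G : C(Icc 0 T, X →L[𝕜] X)) (z : C(Icc 0 T, X)) (τ : ℝ) : X :=
  G (projIcc 0 T hT τ) (z (projIcc 0 T hT τ))

lemma continuous_perturbation (hT : 0 ≤ T) (G : C(Icc 0 T, X →L[𝕜] X)) (z : C(Icc 0 T, X)) :
    Continuous (perturbation hT G z) :=
  (G.continuous.comp continuous_projIcc).clm_apply (z.continuous.comp continuous_projIcc)

lemma norm_perturbation_le (hT : 0 ≤ T) {G : C(Icc 0 T, X →L[𝕜] X)} {L : ℝ} (hG : ‖G‖ ≤ L)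
    (z : C(Icc 0 T, X)) (τ : ℝ) :
    ‖perturbation hT G z τ‖ ≤ L * ‖z (projIcc 0 T hT τ)‖ :=
  ContinuousLinearMap.le_of_opNorm_le _ ((G.norm_coe_le_norm _).trans hG) _

variable [CompleteSpace X]

/-- The unperturbed trajectory `t ↦ S(t) x` on `[0, T]`. -/
def orbit (S : C0Semigroup 𝕜 X) (T : ℝ) (x : X) : C(Icc 0 T, X) :=
  ⟨fun t => S.extend t x, S.continuous_extend_apply continuous_subtype_val continuous_const⟩

lemma continuous_orbit (S : C0Semigroup 𝕜 X) (T : ℝ) : Continuous (orbit S T) :=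
  ContinuousMap.continuous_of_continuous_uncurry _
    (S.continuous_extend_apply (continuous_subtype_val.comp continuous_snd) continuous_fst)

variable [NormedSpace ℝ X] [IsScalarTower ℝ 𝕜 X] (S : C0Semigroup 𝕜 X) (hT : 0 ≤ T)
  (G : C(Icc 0 T, X →L[𝕜] X))

/-- The trajectory `t ↦ 𝔗(t, 0; G) x` on `[0, T]`. -/
def trajectory (x : X) : C(Icc 0 T, X) :=
  ⟨fun t => evolution S hT G t 0 x, continuous_evolution_apply S hT continuous_const
    continuous_subtype_val continuous_const continuous_const⟩

lemma trajectory_smul (c : 𝕜) (x : X) : trajectory S hT G (c • x) = c • trajectory S hT G x :=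
  ContinuousMap.ext fun t => map_smul (evolution S hT G t 0) c x

lemma trajectory_apply_eq_extend_add_duhamel (x : X) (t : Icc 0 T) :
    trajectory S hT G x t
      = S.extend t x + duhamel S (perturbation hT G (trajectory S hT G x)) t := by
  have h := evolution_eq_integral S hT G x le_rfl t.2.1 t.2.2
  rw [sub_zero] at h
  refine h.trans (congrArg _ (intervalIntegral.integral_congr fun r hr => ?_))
  rw [uIcc_of_le t.2.1] at hr
  simp only [perturbation, trajectory, ContinuousMap.coe_mk,
    projIcc_of_mem hT ⟨hr.1, hr.2.trans t.2.2⟩]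

lemma norm_trajectory_le {L : ℝ} (hG : ‖G‖ ≤ L) (x : X) :
    ‖trajectory S hT G x‖ ≤ evolutionBound S T L * ‖x‖ :=
  (ContinuousMap.norm_le _ (mul_nonneg (evolutionBound_pos S T L).le (norm_nonneg x))).2 fun t =>
    norm_evolution_apply_le S hT hG t 0 x

end LinearTrajectories

section LimitsOfTrajectories

variable {𝕜 X : Type*} [RCLike 𝕜] [NormedAddCommGroup X] [InnerProductSpace 𝕜 X] [CompleteSpace X]
  {T L R : ℝ}

lemma exists_tendsto_perturbation (hT : 0 ≤ T) (hL : 0 ≤ L) {G : ℕ → C(Icc 0 T, X →L[𝕜] X)}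
    (hG : ∀ n, ‖G n‖ ≤ L) {z : ℕ → C(Icc 0 T, X)} {z₀ : C(Icc 0 T, X)}
    (hz : Tendsto z (hyperfilter ℕ) (𝓝 z₀)) (hzR : ∀ n, ‖z n‖ ≤ R) :
    ∃ q : ℝ → X, StronglyMeasurable q ∧ (∀ s, ‖q s‖ ≤ L * ‖z₀ (projIcc 0 T hT s)‖) ∧
      TendstoWeaklyL2 𝕜 (fun n => perturbation hT (G n) (z n)) (hyperfilter ℕ) q
        (volume.restrict (Ioc 0 T)) := by
  have hm : Continuous fun s => L * ‖z₀ (projIcc 0 T hT s)‖ :=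
    (z₀.continuous.comp continuous_projIcc).norm.const_mul L
  have hd : Tendsto (fun n => L * ‖z n - z₀‖) (hyperfilter ℕ) (𝓝 0) := by
    simpa using (tendsto_iff_norm_sub_tendsto_zero.1 hz).const_mul L
  refine exists_tendstoWeaklyL2_norm_le (R := L * R)
    (fun n => (continuous_perturbation hT (G n) (z n)).aestronglyMeasurable)
    (fun n => Eventually.of_forall fun s => (norm_perturbation_le hT (hG n) (z n) s).trans ?_)
    hm.measurable (MemLp.of_bound hm.aestronglyMeasurable (L * ‖z₀‖) ?_)
    (fun s => by positivity) hd
    fun n => Eventually.of_forall fun s => (norm_perturbation_le hT (hG n) (z n) s).trans ?_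
  · gcongr
    exact ((z n).norm_coe_le_norm _).trans (hzR n)
  · refine Eventually.of_forall fun s => ?_
    rw [Real.norm_of_nonneg (by positivity)]
    gcongr
    exact z₀.norm_coe_le_norm _
  · rw [← mul_add]
    gcongr
    refine (norm_le_norm_add_norm_sub' _ _).trans (add_le_add_right ?_ _)
    exact (z n - z₀).norm_coe_le_norm _

variable [NormedSpace ℝ X] {S : C0Semigroup 𝕜 X}

lemma eq_duhamel_of_tendsto (hS : S.IsCompactSemigroup) {Q : ℕ → ℝ → X} {q : ℝ → X}
    (hQq : TendstoWeaklyL2 𝕜 Q (hyperfilter ℕ) q (volume.restrict (Ioc 0 T)))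
    (hQ : ∀ n, IntegrableOn (Q n) (Ioc 0 T)) (hq : IntegrableOn q (Ioc 0 T)) {t : ℝ}
    (ht : t ∈ Icc 0 T) {y : X}
    (hy : Tendsto (fun n => duhamel S (Q n) t) (hyperfilter ℕ) (𝓝 y)) : y = duhamel S q t :=
  ext_inner_right 𝕜 fun v => tendsto_nhds_unique (hy.inner tendsto_const_nhds)
    (hQq.tendsto_inner_duhamel hS hQ hq ht v)

variable [IsScalarTower ℝ 𝕜 X]

/- The forcing terms converge only weakly, so their limit need not come from a continuous
perturbation, but it is still dominated by the limit trajectory. -/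
theorem exists_tendsto_trajectory (hS : S.IsCompactSemigroup) (hT : 0 ≤ T) (hL : 0 ≤ L)
    {G : ℕ → C(Icc 0 T, X →L[𝕜] X)} (hG : ∀ n, ‖G n‖ ≤ L) {x : ℕ → X} {x₀ : X}
    (hx : Tendsto x (hyperfilter ℕ) (𝓝 x₀)) (hxR : ∀ n, ‖x n‖ ≤ R) :
    ∃ (z : C(Icc 0 T, X)) (q : ℝ → X),
      Tendsto (fun n => trajectory S hT (G n) (x n)) (hyperfilter ℕ) (𝓝 z) ∧
      StronglyMeasurable q ∧ (∀ s, ‖q s‖ ≤ L * ‖z (projIcc 0 T hT s)‖) ∧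
      ∀ t : Icc 0 T, z t = S.extend t x₀ + duhamel S q t := by
  set y : ℕ → C(Icc 0 T, X) := fun n => trajectory S hT (G n) (x n)
  set Q : ℕ → ℝ → X := fun n => perturbation hT (G n) (y n)
  have hyR (n : ℕ) : ‖y n‖ ≤ evolutionBound S T L * R :=
    (norm_trajectory_le S hT (G n) (hG n) (x n)).trans (by
      have := evolutionBound_pos S T L
      gcongr
      exact hxR n)
  have hQR (n : ℕ) : Q n ∈ boundedForcing X T (L * (evolutionBound S T L * R)) := by
    refine ⟨continuous_perturbation hT _ _, fun s _ =>
      (norm_perturbation_le hT (hG n) (y n) s).trans ?_⟩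
    gcongr
    exact ((y n).norm_coe_le_norm _).trans (hyR n)
  obtain ⟨D, -, hD⟩ := exists_tendsto_hyperfilter (isCompact_closure_setOf_eq_duhamel hS hT)
    (u := fun n => y n - orbit S T (x n)) fun n => subset_closure ⟨Q n, hQR n, fun t =>
      sub_eq_of_eq_add' (trajectory_apply_eq_extend_add_duhamel S hT (G n) (x n) t)⟩
  have hz : Tendsto y (hyperfilter ℕ) (𝓝 (orbit S T x₀ + D)) := by
    simpa using (((continuous_orbit S T).tendsto x₀).comp hx).add hD
  obtain ⟨q, hq, hqz, hQq⟩ := exists_tendsto_perturbation (𝕜 := 𝕜) hT hL hG hz hyR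
  refine ⟨orbit S T x₀ + D, q, hz, hq, hqz, fun t => congrArg (S.extend t x₀ + ·) ?_⟩
  refine eq_duhamel_of_tendsto hS hQq
    (fun n => ((continuous_perturbation hT _ _).integrableOn_Icc).mono_set Ioc_subset_Icc_self)
    (Integrable.of_bound hq.aestronglyMeasurable (L * ‖orbit S T x₀ + D‖)
      (Eventually.of_forall fun s => (hqz s).trans ?_)) t.2 ?_
  · gcongr
    exact ContinuousMap.norm_coe_le_norm _ _
  · refine (((continuous_eval_const t).tendsto D).comp hD).congr fun n => ?_
    exact sub_eq_of_eq_add' (trajectory_apply_eq_extend_add_duhamel S hT (G n) (x n) t)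

end LimitsOfTrajectories

section Coercivity

/- By homogeneity it is enough to bound `Φ` from below on the unit sphere. -/
lemma exists_pos_forall_mul_norm_sq_le (𝕜 : Type*) {ι X : Type*} [RCLike 𝕜] [NormedAddCommGroup X]
    [NormedSpace 𝕜 X] {Φ : ι → X → ℝ} (hΦ : ∀ i x, 0 ≤ Φ i x)
    (hsmul : ∀ i (c : 𝕜) x, Φ i (c • x) = ‖c‖ ^ 2 * Φ i x)
    (hseq : ∀ (i : ℕ → ι) (x : ℕ → X), (∀ n, ‖x n‖ = 1) →
      ¬Tendsto (fun n => Φ (i n) (x n)) atTop (𝓝 0)) :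
    ∃ c > 0, ∀ i x, c * ‖x‖ ^ 2 ≤ Φ i x := by
  suffices hsphere : ∃ c > 0, ∀ i x, ‖x‖ = 1 → c ≤ Φ i x by
    obtain ⟨c, hc, hcΦ⟩ := hsphere
    refine ⟨c, hc, fun i x => ?_⟩
    rcases eq_or_ne x 0 with rfl | hx
    · simpa using hΦ i 0
    · have h := hcΦ i _ (norm_smul_inv_norm (𝕜 := 𝕜) hx)
      rwa [hsmul, norm_inv, RCLike.norm_ofReal, abs_norm, inv_pow,
        le_inv_mul_iff₀' (by positivity)] at h
  by_contra! hcon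
  choose i x hx hΦx using fun n : ℕ => hcon (1 / ((n : ℝ) + 1)) (by positivity)
  exact hseq i x hx (squeeze_zero (fun n => hΦ _ _) (fun n => (hΦx n).le)
    tendsto_one_div_add_atTop_nhds_zero_nat)

variable {𝕜 X W : Type*} [RCLike 𝕜]

section OutputEnergy

variable [NormedAddCommGroup X] [NormedSpace 𝕜 X] [NormedAddCommGroup W] [NormedSpace 𝕜 W] {T : ℝ}

/-- The energy `∫₀ᵀ ‖C z(t)‖² dt` of the output `C z` of a trajectory `z`. -/
def outputEnergy (hT : 0 ≤ T) (C : X →L[𝕜] W) (z : C(Icc 0 T, X)) : ℝ :=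
  ∫ t in (0 : ℝ)..T, ‖C (z (projIcc 0 T hT t))‖ ^ 2

lemma outputEnergy_nonneg (hT : 0 ≤ T) (C : X →L[𝕜] W) (z : C(Icc 0 T, X)) :
    0 ≤ outputEnergy hT C z :=
  intervalIntegral.integral_nonneg hT fun _ _ => sq_nonneg _

lemma outputEnergy_smul (hT : 0 ≤ T) (C : X →L[𝕜] W) (c : 𝕜) (z : C(Icc 0 T, X)) :
    outputEnergy hT C (c • z) = ‖c‖ ^ 2 * outputEnergy hT C z := by
  simp only [outputEnergy, ContinuousMap.smul_apply, map_smul, norm_smul, mul_pow,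
    intervalIntegral.integral_const_mul]

lemma continuous_outputEnergy (hT : 0 ≤ T) (C : X →L[𝕜] W) :
    Continuous (outputEnergy hT C) := by
  refine intervalIntegral.continuous_parametric_intervalIntegral_of_continuous'
    (f := fun (z : C(Icc 0 T, X)) t => ‖C (z (projIcc 0 T hT t))‖ ^ 2) ?_ 0 T
  exact (C.continuous.comp
    (continuous_fst.eval (continuous_projIcc.comp continuous_snd))).norm.pow 2

lemma apply_eq_zero_of_outputEnergy_eq_zero (hT : 0 < T) {C : X →L[𝕜] W} {z : C(Icc 0 T, X)}
    (h : outputEnergy hT.le C z = 0) (t : Icc 0 T) : C (z t) = 0 := by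
  by_contra hne
  have hcont : Continuous fun t => ‖C (z (projIcc 0 T hT.le t))‖ ^ 2 :=
    (C.continuous.comp (z.continuous.comp continuous_projIcc)).norm.pow 2
  refine (intervalIntegral.integral_pos hT hcont.continuousOn (fun _ _ => sq_nonneg _)
    ⟨t, t.2, ?_⟩).ne' h
  simpa only [projIcc_val] using pow_pos (norm_pos_iff.2 hne) 2

end OutputEnergy

variable [NormedAddCommGroup X] [InnerProductSpace 𝕜 X]

lemma exists_tendsto_of_tendsto_sub_starProjection {M : Submodule 𝕜 X} [FiniteDimensional 𝕜 M]
    {x : ℕ → X} (hx : ∀ n, ‖x n‖ = 1)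
    (hxM : Tendsto (fun n => x n - M.starProjection (x n)) atTop (𝓝 0)) :
    ∃ y : X, ‖y‖ = 1 ∧ Tendsto x (hyperfilter ℕ) (𝓝 y) := by
  have : ProperSpace M := FiniteDimensional.proper 𝕜 M
  obtain ⟨y, -, hy⟩ := exists_tendsto_hyperfilter
    ((isCompact_closedBall (0 : M) 1).image continuous_subtype_val)
    (u := fun n => M.starProjection (x n)) fun n => by
      refine ⟨M.orthogonalProjectionOnto (x n), ?_, rfl⟩
      rw [mem_closedBall_zero_iff, ← hx n]
      exact M.norm_orthogonalProjectionOnto_apply_le (x n)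
  have hxy : Tendsto x (hyperfilter ℕ) (𝓝 y) := by
    simpa using (hxM.mono_left Nat.hyperfilter_le_atTop).add hy
  exact ⟨y, tendsto_nhds_unique hxy.norm (by simp only [hx, tendsto_const_nhds]), hxy⟩

variable [CompleteSpace X] [NormedSpace ℝ X] [IsScalarTower ℝ 𝕜 X]
  [NormedAddCommGroup W] [InnerProductSpace 𝕜 W] [CompleteSpace W]
  {S : C0Semigroup 𝕜 X} {B : W →L[𝕜] X} {T L ε : ℝ}

/- Along a normalized sequence with vanishing energy the adjoint trajectories converge to one that
`B*` does not see, which controllability excludes unless its initial value, a unit vector, is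
zero. -/
lemma not_tendsto_outputEnergy_trajectory (hS : S.IsCompactSemigroup) (hT : 0 < T) (hL : 0 ≤ L)
    (hAC : ∀ G : ℝ → X →L[𝕜] X, StronglyMeasurable G → (∀ s, ‖G s‖ ≤ L) →
      IsApproxControllable S B T G)
    {G : ℕ → C(Icc 0 T, X →L[𝕜] X)} (hG : ∀ n, ‖G n‖ ≤ L) {x : ℕ → X} {x₀ : X}
    (hx : Tendsto x (hyperfilter ℕ) (𝓝 x₀)) (hx1 : ∀ n, ‖x n‖ = 1) :
    ¬Tendsto (fun n => outputEnergy hT.le B.adjoint (trajectory (S.adj hS) hT.le (G n) (x n)))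
      (hyperfilter ℕ) (𝓝 0) := by
  intro henergy
  obtain ⟨z, q, hz, hq, hqz, hzx⟩ := exists_tendsto_trajectory (S.adj_isCompactSemigroup hS) hT.le
    hL hG hx fun n => (hx1 n).le
  have hz0 : outputEnergy hT.le B.adjoint z = 0 :=
    tendsto_nhds_unique (((continuous_outputEnergy hT.le B.adjoint).tendsto z).comp hz) henergy
  have hx0 : x₀ = 0 := eq_zero_of_unobservable hS hT.le hL hAC
    (z.continuous.comp continuous_projIcc) hq (fun t ht => by
      rw [Function.comp_apply, projIcc_of_mem hT.le ht, hzx]) hqz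
    fun t _ => apply_eq_zero_of_outputEnergy_eq_zero hT hz0 _
  have hnorm : ‖x₀‖ = 1 := tendsto_nhds_unique hx.norm (by simp only [hx1, tendsto_const_nhds])
  simp [hx0] at hnorm

theorem exists_pos_forall_mul_norm_sq_le_outputEnergy (hS : S.IsCompactSemigroup) (hT : 0 < T)
    (hL : 0 ≤ L)
    (hAC : ∀ G : ℝ → X →L[𝕜] X, StronglyMeasurable G → (∀ s, ‖G s‖ ≤ L) →
      IsApproxControllable S B T G)
    (M : Submodule 𝕜 X) [FiniteDimensional 𝕜 M] (hε : 0 < ε) :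
    ∃ c > 0, ∀ G : C(Icc 0 T, X →L[𝕜] X), ‖G‖ ≤ L → ∀ x : X,
      c * ‖x‖ ^ 2 ≤ ε * ‖x - M.starProjection x‖ ^ 2
        + outputEnergy hT.le B.adjoint (trajectory (S.adj hS) hT.le G x) := by
  set Φ : {G : C(Icc 0 T, X →L[𝕜] X) // ‖G‖ ≤ L} → X → ℝ := fun G x =>
    ε * ‖x - M.starProjection x‖ ^ 2
      + outputEnergy hT.le B.adjoint (trajectory (S.adj hS) hT.le G x) with hΦ
  have hM (x : X) : 0 ≤ ε * ‖x - M.starProjection x‖ ^ 2 := by positivity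
  have henergy (G : C(Icc 0 T, X →L[𝕜] X)) (x : X) :
      0 ≤ outputEnergy hT.le B.adjoint (trajectory (S.adj hS) hT.le G x) :=
    outputEnergy_nonneg hT.le _ _
  obtain ⟨c, hc, hcΦ⟩ := exists_pos_forall_mul_norm_sq_le 𝕜 (Φ := Φ)
    (fun G x => add_nonneg (hM x) (henergy G x))
    (fun G c x => by
      simp only [hΦ, trajectory_smul, outputEnergy_smul, map_smul, ← smul_sub, norm_smul]
      ring)
    fun G x hx hlim => by
      have hxM : Tendsto (fun n => ε * ‖x n - M.starProjection (x n)‖ ^ 2) atTop (𝓝 0) :=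
        squeeze_zero (fun n => hM _) (fun n => le_add_of_nonneg_right (henergy _ _)) hlim
      obtain ⟨x₀, -, hx₀⟩ := exists_tendsto_of_tendsto_sub_starProjection hx (M := M) (by
        simpa [tendsto_zero_iff_norm_tendsto_zero, hε.ne', Real.sqrt_sq]
          using (hxM.const_mul ε⁻¹).sqrt)
      exact not_tendsto_outputEnergy_trajectory hS hT hL hAC (fun n => (G n).2) hx₀ hx
        ((squeeze_zero (fun n => henergy _ _) (fun n => le_add_of_nonneg_left (hM _))
          hlim).mono_left Nat.hyperfilter_le_atTop)
  exact ⟨c, hc, fun G hG => hcΦ ⟨G, hG⟩⟩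

end Coercivity

section Gramian

lemma inner_sub_starProjection {𝕜 X : Type*} [RCLike 𝕜] [NormedAddCommGroup X]
    [InnerProductSpace 𝕜 X] (M : Submodule 𝕜 X) [M.HasOrthogonalProjection] (x : X) :
    inner 𝕜 x (x - M.starProjection x) = ((‖x - M.starProjection x‖ ^ 2 : ℝ) : 𝕜) := by
  have horth : inner 𝕜 (M.starProjection x) (x - M.starProjection x) = 0 :=
    Submodule.inner_right_of_mem_orthogonal (M.starProjection_apply_mem x)
      (M.sub_starProjection_mem_orthogonal x)
  rw [RCLike.ofReal_pow, ← inner_self_eq_norm_sq_to_K, inner_sub_left, horth, sub_zero]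

variable {𝕜 X W : Type*} [RCLike 𝕜]
  [NormedAddCommGroup X] [InnerProductSpace 𝕜 X] [CompleteSpace X]
  [NormedSpace ℝ X] [IsScalarTower ℝ 𝕜 X]
  [NormedAddCommGroup W] [InnerProductSpace 𝕜 W] [CompleteSpace W]
  {Z : Type*} [TopologicalSpace Z] {T : ℝ} {S : C0Semigroup 𝕜 X}

lemma adjoint_evolution_projIcc (hS : S.IsCompactSemigroup) (hT : 0 ≤ T)
    (G : C(Icc 0 T, X →L[𝕜] X)) (s : ℝ) (x : X) :
    (evolution S hT G T s).adjoint x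
      = evolution (S.adj hS) hT (adjointReversed G) (T - projIcc 0 T hT s) 0 x := by
  have hproj : evolution S hT G T s = evolution S hT G T (projIcc 0 T hT s) := by
    ext x
    simp only [evolution_apply, projIcc_val]
  rw [hproj, adjoint_evolution hS hT G (projIcc 0 T hT s).2.1 (projIcc 0 T hT s).2.2 le_rfl,
    sub_self]

lemma continuous_adjoint_evolution_apply (hS : S.IsCompactSemigroup) (hT : 0 ≤ T)
    {G : Z → C(Icc 0 T, X →L[𝕜] X)} (hG : Continuous G) {s : Z → ℝ} (hs : Continuous s)
    {x : Z → X} (hx : Continuous x) :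
    Continuous fun z => (evolution S hT (G z) T (s z)).adjoint (x z) := by
  simp only [adjoint_evolution_projIcc hS]
  exact continuous_evolution_apply (S.adj hS) hT (continuous_adjointReversed hG)
    (continuous_const.sub (continuous_subtype_val.comp (continuous_projIcc.comp hs)))
    continuous_const hx

/-- The feedback `B B* 𝔗(T, s; G)* x`. -/
def adjointFeedback (S : C0Semigroup 𝕜 X) (hT : 0 ≤ T) (B : W →L[𝕜] X)
    (G : C(Icc 0 T, X →L[𝕜] X)) (x : X) (s : ℝ) : X :=
  B (B.adjoint ((evolution S hT G T s).adjoint x))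

lemma continuous_adjointFeedback (hS : S.IsCompactSemigroup) (hT : 0 ≤ T) (B : W →L[𝕜] X)
    {G : Z → C(Icc 0 T, X →L[𝕜] X)} (hG : Continuous G) {x : Z → X} (hx : Continuous x)
    {s : Z → ℝ} (hs : Continuous s) :
    Continuous fun z => adjointFeedback S hT B (G z) (x z) (s z) :=
  B.continuous.comp (B.adjoint.continuous.comp
    (continuous_adjoint_evolution_apply hS hT hG hs hx))

lemma norm_adjointFeedback_le (S : C0Semigroup 𝕜 X) (hT : 0 ≤ T) (B : W →L[𝕜] X)
    {G : C(Icc 0 T, X →L[𝕜] X)} {L : ℝ} (hG : ‖G‖ ≤ L) (x : X) (s : ℝ) :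
    ‖adjointFeedback S hT B G x s‖ ≤ ‖B‖ * (‖B‖ * (evolutionBound S T L * ‖x‖)) := by
  refine B.le_opNorm_of_le (B.adjoint.le_of_opNorm_le_of_le ?_
    ((evolution S hT G T s).adjoint.le_of_opNorm_le ?_ x))
  · rw [LinearIsometryEquiv.norm_map]
  · rw [LinearIsometryEquiv.norm_map]
    exact norm_evolution_le S hT hG T s

lemma continuous_evolution_adjointFeedback (hS : S.IsCompactSemigroup) (hT : 0 ≤ T)
    (B : W →L[𝕜] X) {G : Z → C(Icc 0 T, X →L[𝕜] X)} (hG : Continuous G) {x : Z → X}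
    (hx : Continuous x) {s : Z → ℝ} (hs : Continuous s) :
    Continuous fun z =>
      evolution S hT (G z) T (s z) (adjointFeedback S hT B (G z) (x z) (s z)) :=
  continuous_evolution_apply S hT hG continuous_const hs
    (continuous_adjointFeedback hS hT B hG hx hs)

lemma intervalIntegrable_evolution_adjointFeedback (hS : S.IsCompactSemigroup) (hT : 0 ≤ T)
    (B : W →L[𝕜] X) (G : C(Icc 0 T, X →L[𝕜] X)) (x : X) (a b : ℝ) :
    IntervalIntegrable (fun s => evolution S hT G T s (adjointFeedback S hT B G x s)) volume a b :=
  (continuous_evolution_adjointFeedback hS hT B continuous_const continuous_const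
    continuous_id).intervalIntegrable a b

lemma continuous_integral_evolution_adjointFeedback (hS : S.IsCompactSemigroup) (hT : 0 ≤ T)
    (B : W →L[𝕜] X) {G : Z → C(Icc 0 T, X →L[𝕜] X)} (hG : Continuous G) {x : Z → X}
    (hx : Continuous x) : Continuous fun z =>
      ∫ s in (0 : ℝ)..T, evolution S hT (G z) T s (adjointFeedback S hT B (G z) (x z) s) := by
  refine intervalIntegral.continuous_parametric_intervalIntegral_of_continuous'
    (f := fun z s => evolution S hT (G z) T s (adjointFeedback S hT B (G z) (x z) s)) ?_ 0 T
  exact continuous_evolution_adjointFeedback hS hT B (hG.comp continuous_fst)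
    (hx.comp continuous_fst) continuous_snd

/-- The controllability Gramian `x ↦ ∫₀ᵀ 𝔗(T, s; G) B B* 𝔗(T, s; G)* x ds`, as a bounded
operator. -/
def controlGramian (hS : S.IsCompactSemigroup) (hT : 0 ≤ T) (B : W →L[𝕜] X)
    (G : C(Icc 0 T, X →L[𝕜] X)) : X →L[𝕜] X where
  toFun x := ∫ s in (0 : ℝ)..T, evolution S hT G T s (adjointFeedback S hT B G x s)
  map_add' x y := by
    rw [← intervalIntegral.integral_add
      (intervalIntegrable_evolution_adjointFeedback hS hT B G x 0 T)
      (intervalIntegrable_evolution_adjointFeedback hS hT B G y 0 T)]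
    simp only [adjointFeedback, map_add]
  map_smul' c x := by
    rw [RingHom.id_apply, ← intervalIntegral.integral_smul]
    simp only [adjointFeedback, map_smul]
  cont := continuous_integral_evolution_adjointFeedback hS hT B continuous_const continuous_id

lemma controlGramian_apply (hS : S.IsCompactSemigroup) (hT : 0 ≤ T) (B : W →L[𝕜] X)
    (G : C(Icc 0 T, X →L[𝕜] X)) (x : X) :
    controlGramian hS hT B G x
      = ∫ s in (0 : ℝ)..T, evolution S hT G T s (adjointFeedback S hT B G x s) := rfl

lemma inner_controlGramian (hS : S.IsCompactSemigroup) (hT : 0 ≤ T) (B : W →L[𝕜] X)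
    (G : C(Icc 0 T, X →L[𝕜] X)) (x : X) :
    inner 𝕜 x (controlGramian hS hT B G x)
      = (outputEnergy hT B.adjoint (trajectory (S.adj hS) hT (adjointReversed G) x) : 𝕜) := by
  have hreverse := intervalIntegral.integral_comp_sub_left (a := 0) (b := T)
    (fun t => ‖B.adjoint (trajectory (S.adj hS) hT (adjointReversed G) x
      (projIcc 0 T hT t))‖ ^ 2) T
  rw [sub_self, sub_zero] at hreverse
  rw [controlGramian_apply, inner_intervalIntegral_right
    (intervalIntegrable_evolution_adjointFeedback hS hT B G x 0 T), outputEnergy, ← hreverse,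
    intervalIntegral.integral_of_le hT, intervalIntegral.integral_of_le hT, ← integral_ofReal]
  refine setIntegral_congr_fun measurableSet_Ioc fun s hs => ?_
  have htraj : trajectory (S.adj hS) hT (adjointReversed G) x (projIcc 0 T hT (T - s))
      = (evolution S hT G T s).adjoint x := by
    rw [adjoint_evolution hS hT G hs.1.le hs.2 le_rfl, sub_self,
      projIcc_of_mem hT ⟨sub_nonneg.2 hs.2, sub_le_self T hs.1.le⟩]
    rfl
  simp only [htraj, adjointFeedback]
  rw [← ContinuousLinearMap.adjoint_inner_left, ← ContinuousLinearMap.adjoint_inner_left,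
    inner_self_eq_norm_sq_to_K, RCLike.ofReal_pow]

/-- The operator `ε (I - π_M) + Γ₀ᵀ(G)` as a bounded operator. -/
def regularizedControlGramian (hS : S.IsCompactSemigroup) (hT : 0 ≤ T) (B : W →L[𝕜] X)
    (M : Submodule 𝕜 X) [M.HasOrthogonalProjection] (ε : ℝ) (G : C(Icc 0 T, X →L[𝕜] X)) :
    X →L[𝕜] X :=
  (ε : 𝕜) • (ContinuousLinearMap.id 𝕜 X - M.starProjection) + controlGramian hS hT B G

variable (hS : S.IsCompactSemigroup) (hT : 0 ≤ T) (B : W →L[𝕜] X) (M : Submodule 𝕜 X)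
  [M.HasOrthogonalProjection] (ε : ℝ)

lemma regularizedControlGramian_apply (G : C(Icc 0 T, X →L[𝕜] X)) (x : X) :
    regularizedControlGramian hS hT B M ε G x
      = ε • (x - M.starProjection x) + controlGramian hS hT B G x := by
  rw [RCLike.real_smul_eq_coe_smul (K := 𝕜)]
  rfl

lemma continuous_regularizedControlGramian_apply {G : Z → C(Icc 0 T, X →L[𝕜] X)}
    (hG : Continuous G) {x : Z → X} (hx : Continuous x) :
    Continuous fun z => regularizedControlGramian hS hT B M ε (G z) (x z) := by
  simp only [regularizedControlGramian_apply, controlGramian_apply]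
  exact (by fun_prop : Continuous fun z => ε • (x z - M.starProjection (x z))).add
    (continuous_integral_evolution_adjointFeedback hS hT B hG hx)

lemma inner_regularizedControlGramian (G : C(Icc 0 T, X →L[𝕜] X)) (x : X) :
    inner 𝕜 x (regularizedControlGramian hS hT B M ε G x)
      = ((ε * ‖x - M.starProjection x‖ ^ 2
        + outputEnergy hT B.adjoint (trajectory (S.adj hS) hT (adjointReversed G) x) : ℝ) : 𝕜) := by
  rw [regularizedControlGramian_apply, inner_add_right, RCLike.real_smul_eq_coe_smul (K := 𝕜),
    inner_smul_right, inner_sub_starProjection, inner_controlGramian, RCLike.ofReal_add,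
    RCLike.ofReal_mul]

theorem exists_pos_forall_mul_norm_sq_le_inner_regularizedControlGramian {L : ℝ} (hT : 0 < T)
    (hL : 0 ≤ L)
    (hAC : ∀ G : ℝ → X →L[𝕜] X, StronglyMeasurable G → (∀ s, ‖G s‖ ≤ L) →
      IsApproxControllable S B T G)
    (M : Submodule 𝕜 X) [FiniteDimensional 𝕜 M] {ε : ℝ} (hε : 0 < ε) :
    ∃ c > 0, ∀ G : C(Icc 0 T, X →L[𝕜] X), ‖G‖ ≤ L → ∀ x : X,
      c * ‖x‖ ^ 2 ≤ ‖inner 𝕜 x (regularizedControlGramian hS hT.le B M ε G x)‖ := by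
  obtain ⟨c, hc, hcoercive⟩ := exists_pos_forall_mul_norm_sq_le_outputEnergy hS hT hL hAC M hε
  refine ⟨c, hc, fun G hG x => ?_⟩
  rw [inner_regularizedControlGramian, RCLike.norm_ofReal]
  exact (hcoercive _ (norm_adjointReversed_le hG) x).trans (le_abs_self _)

end Gramian

section Coercive

variable {𝕜 X : Type*} [RCLike 𝕜] [NormedAddCommGroup X] [InnerProductSpace 𝕜 X]
  {c : ℝ} {A : X →L[𝕜] X}

lemma mul_norm_le_norm_apply_of_coercive (hA : ∀ x, c * ‖x‖ ^ 2 ≤ ‖inner 𝕜 x (A x)‖) (x : X) :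
    c * ‖x‖ ≤ ‖A x‖ := by
  rcases eq_or_ne x 0 with rfl | hx
  · simp
  · refine le_of_mul_le_mul_left ?_ (norm_pos_iff.2 hx)
    calc ‖x‖ * (c * ‖x‖) = c * ‖x‖ ^ 2 := by ring
      _ ≤ ‖inner 𝕜 x (A x)‖ := hA x
      _ ≤ ‖x‖ * ‖A x‖ := norm_inner_le_norm x (A x)

variable [CompleteSpace X]

lemma isUnit_of_coercive (hc : 0 < c) (hA : ∀ x, c * ‖x‖ ^ 2 ≤ ‖inner 𝕜 x (A x)‖) : IsUnit A :=
  A.isUnit_of_forall_le_norm_inner_map (c := ⟨c, hc.le⟩) hc fun x => by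
    rw [norm_inner_symm, mul_comm]
    exact hA x

lemma norm_inverse_apply_le_of_coercive (hc : 0 < c)
    (hA : ∀ x, c * ‖x‖ ^ 2 ≤ ‖inner 𝕜 x (A x)‖) (x : X) : ‖Ring.inverse A x‖ ≤ c⁻¹ * ‖x‖ := by
  have hAx : A (Ring.inverse A x) = x :=
    DFunLike.congr_fun (Ring.mul_inverse_cancel A (isUnit_of_coercive hc hA)) x
  rw [← div_eq_inv_mul, le_div_iff₀' hc]
  simpa only [hAx] using mul_norm_le_norm_apply_of_coercive hA (Ring.inverse A x)

/- Only strong continuity of `A` is assumed, so continuity of inversion in operator norm does not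
apply; it is the uniform bound on the inverses that makes the resolvent identity converge. -/
lemma continuous_inverse_apply_of_coercive {Z : Type*} [TopologicalSpace Z] {A : Z → X →L[𝕜] X}
    (hc : 0 < c) (hA : ∀ z x, c * ‖x‖ ^ 2 ≤ ‖inner 𝕜 x (A z x)‖)
    (hAc : ∀ x, Continuous fun z => A z x) {y : Z → X} (hy : Continuous y) :
    Continuous fun z => Ring.inverse (A z) (y z) := by
  have hunit (z : Z) := isUnit_of_coercive hc (hA z)
  refine continuous_iff_continuousAt.2 fun z₀ => ?_
  set x₀ := Ring.inverse (A z₀) (y z₀)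
  have hAx₀ : A z₀ x₀ = y z₀ := DFunLike.congr_fun (Ring.mul_inverse_cancel _ (hunit z₀)) (y z₀)
  have hlim : Tendsto (fun z => c⁻¹ * ‖y z - A z x₀‖) (𝓝 z₀) (𝓝 0) := by
    simpa [hAx₀] using ((hy.sub (hAc x₀)).norm.const_mul c⁻¹).tendsto z₀
  refine tendsto_iff_norm_sub_tendsto_zero.2 (squeeze_zero (fun _ => norm_nonneg _) (fun z => ?_)
    hlim)
  have hx₀z : Ring.inverse (A z) (A z x₀) = x₀ :=
    DFunLike.congr_fun (Ring.inverse_mul_cancel _ (hunit z)) x₀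
  calc ‖Ring.inverse (A z) (y z) - x₀‖ = ‖Ring.inverse (A z) (y z - A z x₀)‖ := by
        rw [map_sub, hx₀z]
    _ ≤ c⁻¹ * ‖y z - A z x₀‖ := norm_inverse_apply_le_of_coercive hc (hA z) _

end Coercive

section FixedPoint

variable {𝕜 X : Type*} [RCLike 𝕜] [NormedAddCommGroup X] [NormedSpace 𝕜 X] [CompleteSpace X]
  [NormedSpace ℝ X] [IsScalarTower ℝ 𝕜 X] {Z : Type*} [TopologicalSpace Z]
  {S : C0Semigroup 𝕜 X} {T L R : ℝ}

/-- The mild solution `t ↦ 𝔗(t, 0; G) x₀ + ∫₀ᵗ 𝔗(t, s; G) w(s) ds` with inhomogeneity `w`. -/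
def mildState (S : C0Semigroup 𝕜 X) (hT : 0 ≤ T) (G : C(Icc 0 T, X →L[𝕜] X)) (x₀ : X)
    (w : ℝ → X) (t : ℝ) : X :=
  evolution S hT G t 0 x₀ + ∫ s in (0 : ℝ)..t, evolution S hT G t s (w s)

lemma continuous_integral_evolution (hT : 0 ≤ T) {G : Z → C(Icc 0 T, X →L[𝕜] X)}
    (hG : Continuous G) {w : Z → ℝ → X} (hw : Continuous (Function.uncurry w)) {t : Z → ℝ}
    (ht : Continuous t) :
    Continuous fun z => ∫ s in (0 : ℝ)..t z, evolution S hT (G z) (t z) s (w z s) :=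
  intervalIntegral.continuous_parametric_intervalIntegral_of_continuous
    (continuous_evolution_apply S hT (hG.comp continuous_fst) (ht.comp continuous_fst)
      continuous_snd hw) ht

lemma continuous_mildState (hT : 0 ≤ T) {G : Z → C(Icc 0 T, X →L[𝕜] X)} (hG : Continuous G)
    (x₀ : X) {w : Z → ℝ → X} (hw : Continuous (Function.uncurry w)) {t : Z → ℝ}
    (ht : Continuous t) : Continuous fun z => mildState S hT (G z) x₀ (w z) (t z) :=
  (continuous_evolution_apply S hT hG ht continuous_const continuous_const).add
    (continuous_integral_evolution hT hG hw ht)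

lemma norm_integral_evolution_le (hT : 0 ≤ T) {G : C(Icc 0 T, X →L[𝕜] X)} (hG : ‖G‖ ≤ L)
    {w : ℝ → X} (hw : ∀ s ∈ Icc 0 T, ‖w s‖ ≤ R) {t : ℝ} (ht : t ∈ Icc 0 T) :
    ‖∫ s in (0 : ℝ)..t, evolution S hT G t s (w s)‖ ≤ evolutionBound S T L * R * T := by
  have hbound := (evolutionBound_pos S T L).le
  have hR : 0 ≤ R := (norm_nonneg _).trans (hw 0 ⟨le_rfl, hT⟩)
  calc ‖∫ s in (0 : ℝ)..t, evolution S hT G t s (w s)‖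
      ≤ evolutionBound S T L * R * |t - 0| :=
        intervalIntegral.norm_integral_le_of_norm_le_const fun s hs => by
          rw [uIoc_of_le ht.1] at hs
          refine (norm_evolution_apply_le S hT hG t s _).trans ?_
          gcongr
          exact hw s ⟨hs.1.le, hs.2.trans ht.2⟩
    _ ≤ evolutionBound S T L * R * T := by
        rw [sub_zero, abs_of_nonneg ht.1]
        gcongr
        exact ht.2

lemma norm_mildState_le (hT : 0 ≤ T) {G : C(Icc 0 T, X →L[𝕜] X)} (hG : ‖G‖ ≤ L) (x₀ : X)
    {w : ℝ → X} (hw : ∀ s ∈ Icc 0 T, ‖w s‖ ≤ R) {t : ℝ} (ht : t ∈ Icc 0 T) :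
    ‖mildState S hT G x₀ w t‖
      ≤ evolutionBound S T L * ‖x₀‖ + evolutionBound S T L * R * T :=
  norm_add_le_of_le (norm_evolution_apply_le S hT hG t 0 x₀)
    (norm_integral_evolution_le hT hG hw ht)

lemma exists_mem_boundedForcing_mildState_eq (hT : 0 ≤ T) (hL : 0 ≤ L)
    {G : C(Icc 0 T, X →L[𝕜] X)} (hG : ‖G‖ ≤ L) (x₀ : X) {w : ℝ → X} (hwc : Continuous w)
    (hw : ∀ s ∈ Icc 0 T, ‖w s‖ ≤ R) :
    ∃ q ∈ boundedForcing X T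
        (R + L * (evolutionBound S T L * ‖x₀‖ + evolutionBound S T L * R * T)),
      ∀ t ∈ Icc 0 T, mildState S hT G x₀ w t = S.extend t x₀ + duhamel S q t := by
  refine ⟨fun r => w r + G (projIcc 0 T hT r) (mildState S hT G x₀ w r), ⟨?_, fun s hs => ?_⟩,
    fun t ht => eq_integral_of_eq_evolution S hT G x₀ hwc (fun _ _ => rfl) ht⟩
  · exact hwc.add ((G.continuous.comp continuous_projIcc).clm_apply
      (continuous_mildState hT (G := fun _ => G) continuous_const x₀ (w := fun _ => w)
        (hwc.comp continuous_snd) continuous_id))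
  · refine norm_add_le_of_le (hw s hs) ((ContinuousLinearMap.le_of_opNorm_le _
      ((G.norm_coe_le_norm _).trans hG) _).trans ?_)
    gcongr
    exact norm_mildState_le hT hG x₀ hw hs

theorem exists_fixedPoint_mildState (hS : ∀ t > 0, IsCompactOperator (S.op t)) (hT : 0 ≤ T)
    (hL : 0 ≤ L) {G : C(Icc 0 T, X) → C(Icc 0 T, X →L[𝕜] X)} (hGc : Continuous G)
    (hG : ∀ z, ‖G z‖ ≤ L) {w : C(Icc 0 T, X) → ℝ → X} (hwc : Continuous (Function.uncurry w))
    (hwR : ∀ z, ∀ s ∈ Icc 0 T, ‖w z s‖ ≤ R) (x₀ : X) :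
    ∃ Θ : C(Icc 0 T, X) → C(Icc 0 T, X),
      (∀ z t, Θ z t = mildState S hT (G z) x₀ (w z) t) ∧ ∃ y, Function.IsFixedPt Θ y := by
  have hstate : Continuous fun p : C(Icc 0 T, X) × Icc 0 T =>
      mildState S hT (G p.1) x₀ (w p.1) p.2 :=
    continuous_mildState (w := fun p : C(Icc 0 T, X) × Icc 0 T => w p.1) hT
      (hGc.comp continuous_fst) x₀
      (hwc.comp ((continuous_fst.comp continuous_fst).prodMk continuous_snd))
      (continuous_subtype_val.comp continuous_snd)
  let Θ : C(C(Icc 0 T, X), C(Icc 0 T, X)) := ContinuousMap.curry ⟨_, hstate⟩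
  have hcompact := (isCompact_closure_setOf_eq_duhamel hS hT
    (R := R + L * (evolutionBound S T L * ‖x₀‖ + evolutionBound S T L * R * T))).image
    (continuous_const_add (orbit S T x₀))
  refine ⟨Θ, fun _ _ => rfl,
    schauder_exists_fixedPoint Θ.continuous hcompact fun z => ?_⟩
  obtain ⟨q, hq, hstate_eq⟩ := exists_mem_boundedForcing_mildState_eq (S := S) hT hL (hG z) x₀
    (hwc.comp (Continuous.prodMk_right z)) (hwR z)
  exact ⟨Θ z - orbit S T x₀, subset_closure ⟨q, hq, fun t => sub_eq_of_eq_add'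
    (hstate_eq t t.2)⟩, add_sub_cancel _ _⟩

end FixedPoint

section Steering

variable {𝕜 X W : Type*} [RCLike 𝕜]
  [NormedAddCommGroup X] [InnerProductSpace 𝕜 X] [CompleteSpace X]
  [NormedSpace ℝ X] [IsScalarTower ℝ 𝕜 X]
  [NormedAddCommGroup W] [InnerProductSpace 𝕜 W] [CompleteSpace W]
  {S : C0Semigroup 𝕜 X} {T L R c ε : ℝ}
  (hS : S.IsCompactSemigroup) (hT : 0 ≤ T) (B : W →L[𝕜] X)
  (M : Submodule 𝕜 X) [M.HasOrthogonalProjection] (x₀ h : X)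

/-- The inhomogeneity `B u_ε + γ` for a fixed operator family `G` and a fixed source `γ`, where
`B u_ε(s) = B B* 𝔗(T, s; G)* (ε (I - π_M) + Γ₀ᵀ(G))⁻¹ (h - 𝔗(T, 0; G) x₀ - ∫₀ᵀ 𝔗(T, r; G) γ(r) dr)`
steers towards `h`. -/
def steeredForcing (ε : ℝ) (G : C(Icc 0 T, X →L[𝕜] X)) (γ : ℝ → X) (s : ℝ) : X :=
  adjointFeedback S hT B G
    (Ring.inverse (regularizedControlGramian hS hT B M ε G) (h - mildState S hT G x₀ γ T)) s + γ s

lemma norm_steeredForcing_le {G : C(Icc 0 T, X →L[𝕜] X)} (hG : ‖G‖ ≤ L) (hc : 0 < c)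
    (hcoercive : ∀ x, c * ‖x‖ ^ 2 ≤ ‖inner 𝕜 x (regularizedControlGramian hS hT B M ε G x)‖)
    {γ : ℝ → X} (hγ : ∀ s ∈ Icc 0 T, ‖γ s‖ ≤ R) {s : ℝ} (hs : s ∈ Icc 0 T) :
    ‖steeredForcing hS hT B M x₀ h ε G γ s‖ ≤
      ‖B‖ * (‖B‖ * (evolutionBound S T L * (c⁻¹ * (‖h‖
        + (evolutionBound S T L * ‖x₀‖ + evolutionBound S T L * R * T))))) + R := by
  have hbound := (evolutionBound_pos S T L).le
  refine norm_add_le_of_le ((norm_adjointFeedback_le S hT B hG _ s).trans ?_) (hγ s hs)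
  gcongr
  refine (norm_inverse_apply_le_of_coercive hc hcoercive _).trans ?_
  gcongr
  exact norm_sub_le_of_le le_rfl (norm_mildState_le hT hG x₀ hγ ⟨hT, le_rfl⟩)

lemma continuous_steeredForcing {Z : Type*} [TopologicalSpace Z]
    {G : Z → C(Icc 0 T, X →L[𝕜] X)} (hG : Continuous G) (hc : 0 < c)
    (hcoercive : ∀ z x,
      c * ‖x‖ ^ 2 ≤ ‖inner 𝕜 x (regularizedControlGramian hS hT B M ε (G z) x)‖)
    {γ : Z → ℝ → X} (hγ : Continuous (Function.uncurry γ)) :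
    Continuous (Function.uncurry fun z => steeredForcing hS hT B M x₀ h ε (G z) (γ z)) := by
  have hresidual : Continuous fun z => h - mildState S hT (G z) x₀ (γ z) T :=
    continuous_const.sub (continuous_mildState hT hG x₀ hγ continuous_const)
  have hinverse := continuous_inverse_apply_of_coercive hc hcoercive
    (fun x => continuous_regularizedControlGramian_apply hS hT B M ε hG continuous_const) hresidual
  exact (continuous_adjointFeedback hS hT B (hG.comp continuous_fst)
    (hinverse.comp continuous_fst) continuous_snd).add hγ

end Steering

section Comparison

variable {𝕜 X W : Type*} [RCLike 𝕜]
  [NormedAddCommGroup X] [InnerProductSpace 𝕜 X] [CompleteSpace X]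
  [NormedSpace ℝ X] [IsScalarTower ℝ 𝕜 X]
  [NormedAddCommGroup W] [InnerProductSpace 𝕜 W] [CompleteSpace W]
  {S : C0Semigroup 𝕜 X} {T ε : ℝ} {hT : 0 ≤ T} {G : C(Icc 0 T, X →L[𝕜] X)} {G' : ℝ → X →L[𝕜] X}

lemma evolutionOperator_eq_evolution (hG' : ∀ t : Icc 0 T, G' t = G t) {s t : ℝ} (hs : 0 ≤ s)
    (hst : s ≤ t) (ht : t ≤ T) : evolutionOperator S T G' t s = evolution S hT G t s :=
  (isEvolutionOperator_evolutionOperator hT hG').eq_evolution hT hG' hs hst ht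

lemma integral_evolutionOperator_eq (hG' : ∀ t : Icc 0 T, G' t = G t) {w w' : ℝ → X}
    (hw : ∀ s ∈ Icc 0 T, w' s = w s) {t : ℝ} (ht : t ∈ Icc 0 T) :
    ∫ s in (0 : ℝ)..t, evolutionOperator S T G' t s (w' s)
      = ∫ s in (0 : ℝ)..t, evolution S hT G t s (w s) := by
  refine intervalIntegral.integral_congr fun s hs => ?_
  rw [uIcc_of_le ht.1] at hs
  simp only [evolutionOperator_eq_evolution (hT := hT) hG' hs.1 hs.2 ht.2,
    hw s ⟨hs.1, hs.2.trans ht.2⟩]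

variable (hS : S.IsCompactSemigroup) (B : W →L[𝕜] X) (M : Submodule 𝕜 X)
  [M.HasOrthogonalProjection]

lemma regularizedGramian_eq_regularizedControlGramian (hG' : ∀ t : Icc 0 T, G' t = G t) :
    regularizedGramian S B T M ε G' = regularizedControlGramian hS hT B M ε G := by
  funext x
  rw [regularizedControlGramian_apply, regularizedGramian, gramian, controlGramian_apply,
    integral_evolutionOperator_eq hG' (w := adjointFeedback S hT B G x) (fun s hs => ?_)
      ⟨hT, le_rfl⟩]
  rw [adjointFeedback, evolutionOperator_eq_evolution hG' hs.1 hs.2 le_rfl]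

lemma exists_continuousLinearEquiv_eq_regularizedGramian (hG' : ∀ t : Icc 0 T, G' t = G t)
    (hunit : IsUnit (regularizedControlGramian hS hT B M ε G)) :
    ∃ A : X ≃L[𝕜] X, ∀ x, A x = regularizedGramian S B T M ε G' x := by
  obtain ⟨u, hu⟩ := hunit
  refine ⟨ContinuousLinearEquiv.unitsEquiv 𝕜 X u, fun x => ?_⟩
  rw [regularizedGramian_eq_regularizedControlGramian (hT := hT) hS B M hG', ← hu]
  rfl

lemma invFun_regularizedGramian (hG' : ∀ t : Icc 0 T, G' t = G t)
    (hunit : IsUnit (regularizedControlGramian hS hT B M ε G)) (x : X) :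
    Function.invFun (regularizedGramian S B T M ε G') x
      = Ring.inverse (regularizedControlGramian hS hT B M ε G) x := by
  rw [regularizedGramian_eq_regularizedControlGramian (hT := hT) hS B M hG']
  set N := regularizedControlGramian hS hT B M ε G
  have hleft : Function.LeftInverse ⇑(Ring.inverse N) N :=
    DFunLike.congr_fun (Ring.inverse_mul_cancel N hunit)
  have hright : Function.RightInverse ⇑(Ring.inverse N) N :=
    DFunLike.congr_fun (Ring.mul_inverse_cancel N hunit)
  exact congrFun (Function.invFun_eq_of_injective_of_rightInverse hleft.injective hright) x

lemma thetaFun_eq_mildState {f g : ℝ → X → X} {x₀ h : X} {z γ : ℝ → X}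
    (hG : ∀ t : Icc 0 T, linearization f z t = G t) (hγ : ∀ s ∈ Icc 0 T, γ s = g s (z s))
    (hunit : IsUnit (regularizedControlGramian hS hT B M ε G)) {t : ℝ} (ht : t ∈ Icc 0 T) :
    thetaFun S B T f g M x₀ h ε z t
      = mildState S hT G x₀ (steeredForcing hS hT B M x₀ h ε G γ) t := by
  rw [thetaFun, mildState, evolutionOperator_eq_evolution hG le_rfl ht.1 ht.2,
    integral_evolutionOperator_eq hG (fun s hs => ?_) ht]
  rw [feedbackControl, invFun_regularizedGramian hS B M hG hunit, steeredForcing, adjointFeedback,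
    mildState, sub_sub, evolutionOperator_eq_evolution hG le_rfl hT le_rfl,
    evolutionOperator_eq_evolution hG hs.1 hs.2 le_rfl, hγ s hs,
    integral_evolutionOperator_eq hG (fun r hr => (hγ r hr).symm) ⟨hT, le_rfl⟩]

end Comparison

section Nonlinearities

variable {𝕜 X : Type*} [RCLike 𝕜] [NormedAddCommGroup X] {T : ℝ}

lemma exists_continuous_linearization [InnerProductSpace 𝕜 X] [NormedSpace ℝ X]
    [IsScalarTower ℝ 𝕜 X] (hT : 0 ≤ T) {f : ℝ → X → X} {L : ℝ}
    (hf : ContinuousOn (fun p : ℝ × X => fderiv 𝕜 (f p.1) p.2) (Icc 0 T ×ˢ univ))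
    (hfL : ∀ t ∈ Icc 0 T, ∀ z : X, ‖fderiv 𝕜 (f t) z‖ ≤ L) :
    ∃ G : C(Icc 0 T, X) → C(Icc 0 T, X →L[𝕜] X), Continuous G ∧ (∀ z, ‖G z‖ ≤ L) ∧
      ∀ (z : C(Icc 0 T, X)) (t : Icc 0 T), linearization f (IccExtend hT z) t = G z t := by
  have hL : 0 ≤ L := (norm_nonneg _).trans (hfL 0 ⟨le_rfl, hT⟩ 0)
  have hmean : Continuous fun p : Icc 0 T × X => (meanDerivative f p.1 p.2 : X →L[𝕜] X) := by
    refine intervalIntegral.continuous_parametric_intervalIntegral_of_continuous'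
      (f := fun (p : Icc 0 T × X) r => fderiv 𝕜 (f p.1) (r • p.2)) ?_ 0 1
    exact hf.comp_continuous (f := fun q : (Icc 0 T × X) × ℝ => ((q.1.1 : ℝ), q.2 • q.1.2))
      (by fun_prop) fun q => ⟨q.1.1.2, trivial⟩
  have hjoint : Continuous fun q : C(Icc 0 T, X) × Icc 0 T =>
      (meanDerivative f q.2 (q.1 q.2) : X →L[𝕜] X) :=
    hmean.comp (continuous_snd.prodMk (continuous_fst.eval continuous_snd))
  refine ⟨ContinuousMap.curry ⟨_, hjoint⟩, ContinuousMap.continuous _,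
    fun z => (ContinuousMap.norm_le _ hL).2 fun t => ?_, fun z t => ?_⟩
  · refine (intervalIntegral.norm_integral_le_of_norm_le_const fun r _ => hfL t t.2 _).trans ?_
    simp
  · rw [linearization, IccExtend_val]
    rfl

lemma exists_continuous_superposition (hT : 0 ≤ T) {g : ℝ → X → X}
    (hg : ContinuousOn (Function.uncurry g) (Icc 0 T ×ˢ univ)) {m : ℝ → ℝ}
    (hm : ContinuousOn m (Icc 0 T)) (hgm : ∀ t ∈ Icc 0 T, ∀ z, ‖g t z‖ ≤ m t) :
    ∃ (γ : C(Icc 0 T, X) → ℝ → X) (R : ℝ), Continuous (Function.uncurry γ) ∧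
      (∀ z, ∀ s ∈ Icc 0 T, ‖γ z s‖ ≤ R) ∧ ∀ z, ∀ s ∈ Icc 0 T, γ z s = g s (IccExtend hT z s) := by
  obtain ⟨R, hR⟩ := isCompact_Icc.exists_bound_of_continuousOn hm
  refine ⟨fun z s => g (projIcc 0 T hT s) (z (projIcc 0 T hT s)), R, ?_, fun z s _ => ?_,
    fun z s hs => ?_⟩
  · have hproj : Continuous fun q : C(Icc 0 T, X) × ℝ => projIcc 0 T hT q.2 :=
      continuous_projIcc.comp continuous_snd
    exact hg.comp_continuous ((continuous_subtype_val.comp hproj).prodMk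
      (continuous_fst.eval hproj)) fun q => ⟨(projIcc 0 T hT q.2).2, trivial⟩
  · exact (hgm _ (projIcc 0 T hT s).2 _).trans
      ((le_abs_self _).trans (hR _ (projIcc 0 T hT s).2))
  · simp only [projIcc_of_mem hT hs, IccExtend_of_mem hT _ hs]

end Nonlinearities

end EvolutionControl

end

open EvolutionControl in
theorem mainTheorem3_general
    {𝕜 X W : Type*} [RCLike 𝕜]
    [NormedAddCommGroup X] [InnerProductSpace 𝕜 X] [NormedSpace ℝ X] [IsScalarTower ℝ 𝕜 X]
    [CompleteSpace X]
    [NormedAddCommGroup W] [InnerProductSpace 𝕜 W] [CompleteSpace W]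
    (T : ℝ) (hT : 0 < T)
    (S : C0Semigroup 𝕜 X) (hS : S.IsCompactSemigroup) (B : W →L[𝕜] X)
    (f : ℝ → X → X) (_hf_diff : ∀ t ∈ Icc (0 : ℝ) T, Differentiable 𝕜 (f t))
    (hf_cont : ContinuousOn (fun p : ℝ × X => fderiv 𝕜 (f p.1) p.2) (Icc 0 T ×ˢ univ))
    (L : ℝ) (hf_bound : ∀ t ∈ Icc (0 : ℝ) T, ∀ z : X, ‖fderiv 𝕜 (f t) z‖ ≤ L)
    (g : ℝ → X → X) (hg : ContinuousOn (Function.uncurry g) (Icc 0 T ×ˢ univ))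
    (m : ℝ → ℝ) (hm : ContinuousOn m (Icc 0 T))
    (hg_bound : ∀ t ∈ Icc (0 : ℝ) T, ∀ z : X, ‖g t z‖ ≤ m t)
    (hAC : ∀ G : ℝ → X →L[𝕜] X, StronglyMeasurable G → (∀ s, ‖G s‖ ≤ L) →
      IsApproxControllable S B T G)
    (M : Submodule 𝕜 X) [FiniteDimensional 𝕜 M] (x₀ h : X) (ε : ℝ) (hε : 0 < ε) :
    (∀ z : C(Icc (0 : ℝ) T, X),
      IsEvolutionOperator S T (linearization f (IccExtend hT.le z))
        (evolutionOperator S T (linearization f (IccExtend hT.le z)) : ℝ → ℝ → X →L[𝕜] X) ∧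
      ∃ R : X ≃L[𝕜] X, ∀ x : X,
        R x = regularizedGramian S B T M ε (linearization f (IccExtend hT.le z)) x) ∧
    ∃ Θ : C(Icc (0 : ℝ) T, X) → C(Icc (0 : ℝ) T, X),
      (∀ (z : C(Icc (0 : ℝ) T, X)) (t : Icc (0 : ℝ) T),
        Θ z t = thetaFun S B T f g M x₀ h ε (IccExtend hT.le z) t) ∧
      ∃ y : C(Icc (0 : ℝ) T, X), Function.IsFixedPt Θ y := by
  have hL : 0 ≤ L := (norm_nonneg _).trans (hf_bound 0 ⟨le_rfl, hT.le⟩ 0)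
  obtain ⟨G, hGcont, hGL, hG⟩ := exists_continuous_linearization hT.le hf_cont hf_bound
  obtain ⟨γ, R, hγcont, hγR, hγ⟩ := exists_continuous_superposition hT.le hg hm hg_bound
  obtain ⟨c, hc, hcoercive⟩ :=
    exists_pos_forall_mul_norm_sq_le_inner_regularizedControlGramian hS B hT hL hAC M hε
  have hunit z : IsUnit (regularizedControlGramian hS hT.le B M ε (G z)) :=
    isUnit_of_coercive hc (hcoercive (G z) (hGL z))
  refine ⟨fun z => ⟨isEvolutionOperator_evolutionOperator hT.le (hG z),
    exists_continuousLinearEquiv_eq_regularizedGramian hS B M (hG z) (hunit z)⟩, ?_⟩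
  obtain ⟨Θ, hΘ, hfixed⟩ := exists_fixedPoint_mildState hS hT.le hL hGcont hGL
    (continuous_steeredForcing hS hT.le B M x₀ h hGcont hc (fun z => hcoercive (G z) (hGL z))
      hγcont)
    (fun z _ => norm_steeredForcing_le hS hT.le B M x₀ h (hGL z) hc (hcoercive (G z) (hGL z))
      (hγR z)) x₀
  exact ⟨Θ, fun z t => (hΘ z t).trans
    (thetaFun_eq_mildState hS B M (hG z) (hγ z) (hunit z) t.2).symm, hfixed⟩

open EvolutionControl in
theorem mainTheorem3
    {𝕜 X W : Type*} [RCLike 𝕜]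
    [NormedAddCommGroup X] [InnerProductSpace 𝕜 X] [NormedSpace ℝ X] [IsScalarTower ℝ 𝕜 X]
    [CompleteSpace X] [TopologicalSpace.SeparableSpace X]
    [NormedAddCommGroup W] [InnerProductSpace 𝕜 W] [CompleteSpace W]
    [TopologicalSpace.SeparableSpace W]
    (T : ℝ) (hT : 0 < T)
    -- (S): `A` generates a compact `C₀`-semigroup and `B` is bounded
    (A : X →ₗ.[𝕜] X) (S : C0Semigroup 𝕜 X) (_hA : S.IsGenerator A)
    (hS : S.IsCompactSemigroup) (B : W →L[𝕜] X)
    -- (F)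
    (f : ℝ → X → X)
    (hf : ContinuousOn (Function.uncurry f) (Icc 0 T ×ˢ univ))
    (hf_diff : ∀ t ∈ Icc (0 : ℝ) T, Differentiable 𝕜 (f t))
    (hf_cont : ContinuousOn (fun p : ℝ × X => fderiv 𝕜 (f p.1) p.2) (Icc 0 T ×ˢ univ))
    (L : ℝ) (hf_bound : ∀ t ∈ Icc (0 : ℝ) T, ∀ z : X, ‖fderiv 𝕜 (f t) z‖ ≤ L)
    -- (G)
    (g : ℝ → X → X)
    (hg : ContinuousOn (Function.uncurry g) (Icc 0 T ×ˢ univ))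
    (m : ℝ → ℝ) (hm : ContinuousOn m (Icc 0 T))
    (hg_bound : ∀ t ∈ Icc (0 : ℝ) T, ∀ z : X, ‖g t z‖ ≤ m t)
    -- (AC)
    (hAC : ∀ G : ℝ → X →L[𝕜] X, MemLp G 2 (volume.restrict (Icc 0 T)) →
      IsApproxControllable S B T G)
    -- the finite-dimensional subspace, the initial state, the target and the parameter
    (M : Submodule 𝕜 X) [FiniteDimensional 𝕜 M] (x₀ h : X) (ε : ℝ) (hε : 0 < ε) :
    -- the objects entering `Θ_ε z` are well defined for every `z`
    (∀ z : C(Icc (0 : ℝ) T, X),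
      IsEvolutionOperator S T (linearization f (IccExtend hT.le z))
        (evolutionOperator S T (linearization f (IccExtend hT.le z)) : ℝ → ℝ → X →L[𝕜] X) ∧
      ∃ R : X ≃L[𝕜] X, ∀ x : X,
        R x = regularizedGramian S B T M ε (linearization f (IccExtend hT.le z)) x) ∧
    -- `Θ_ε` maps `C([0,T], X)` into itself and has a fixed point
    ∃ Θ : C(Icc (0 : ℝ) T, X) → C(Icc (0 : ℝ) T, X),
      (∀ (z : C(Icc (0 : ℝ) T, X)) (t : Icc (0 : ℝ) T),
        Θ z t = thetaFun S B T f g M x₀ h ε (IccExtend hT.le z) t) ∧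
      ∃ y : C(Icc (0 : ℝ) T, X), Function.IsFixedPt Θ y :=
  mainTheorem3_general T hT S hS B f hf_diff hf_cont L hf_bound g hg m hm hg_bound
    (fun G hG hGL => hAC G (.of_bound hG.aestronglyMeasurable L (.of_forall hGL))) M x₀ h ε hε
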